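/- **Setting.** Let $\mathcal X\subset\mathbb R^d$ be a locally finite set, invariant under the translations by a Bravais lattice $\Gamma=\mathrm{Span}_{\mathbb Z}\{a_1,\dots,a_d\}$ ($a_1,\dots,a_d$ linearly independent), and let $\mathcal H=\ell^2(\mathcal X)\otimes\mathbb C^N$ carry the (magnetic) translations $(T_\gamma\psi)(x)=M(\gamma,x)\psi(x-\gamma)$, where $M(\gamma,x)$ are unitaries on $\mathbb C^N$ with $M(\gamma_1+\gamma_2,x)=M(\gamma_2,x)M(\gamma_1,x-\gamma_2)$. Operators commuting with all $T_\gamma$ are called periodic. Put $\mathcal C_L=\{x\in\mathcal X: x=\sum_k\alpha_ka_k,\ |\alpha_k|\le L/2\}$, and let $\chi_\Omega$ be the multiplication by the characteristic function of $\Omega$; $\mathcal C_1$ is assumed to be a fundamental cell, i.e. its translates by distinct vectors of $\Gamma$ are disjoint. The trace per unit volume is $\tau(A)=\lim_{L\to\infty,\,L\text{ odd}}|\mathcal C_L|^{-1}\mathrm{Tr}(\chi_{\mathcal C_L}A\chi_{\mathcal C_L})$, $X_k$ is the $k$-th position operator, and an overline denotes the closure of a commutator initially defined on rapidly decreasing functions.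 Let $H_0$ be a self-adjoint periodic operator on $\mathcal H$ with finite-range hopping (there is $r$ such that the matrix elements $H_0(x,y)$ vanish for $|x-y|>r$), let $\mu\in\mathbb R$ lie outside the spectrum of $H_0$, and $\Pi_0=\chi_{(-\infty,\mu)}(H_0)$. Let $S=\mathbf 1\otimes s$ with $s=s^*$ on $\mathbb C^N$, and let $S$ be periodic. Fix $i\ne j$ in $\{1,\dots,d\}$ and set $$\mathcal I(A)=\frac{\mathrm i}{2\pi}\oint_{C}(H_0-z)^{-1}[A,\Pi_0](H_0-z)^{-1}\,dz,$$ where $C$ is a positively oriented circle crossing $\mathbb R$ at $\mu$ and below the spectrum of $H_0$. Let $$\Pi_1=\mathcal I\big(\overline{[X_j,\Pi_0]}\big),\qquad \mathcal S=\mathrm i\,\mathcal I\big(\big[\overline{[X_j,\Pi_0]},\Pi_0\big]\big),\qquad \Pi^\varepsilon=e^{-\mathrm i\varepsilon\mathcal S}\Pi_0e^{\mathrm i\varepsilon\mathcal S}\quad(0\le\varepsilon\le1),$$ $$J_{\rm conv}=\tfrac12\big(\mathrm i\overline{[H_0,X_i]}S+\mathrm iS\overline{[H_0,X_i]}\big),\qquad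 J_{\rm prop}=\mathrm i\overline{[H_0,X_i]}S+\mathrm iX_i[H_0,S].$$ The conductivities $\sigma_{\rm conv}$, $\sigma_{\rm prop}$ are defined by $\mathrm{Re}\,\tau(J_{\rm conv/prop}\Pi^\varepsilon)-\mathrm{Re}\,\tau(J_{\rm conv/prop}\Pi_0)=\varepsilon\,\sigma_{\rm conv/prop}+o(\varepsilon)$ as $\varepsilon\downarrow0$, and $\sigma_{\rm rot}=\mathrm{Re}\,\tau(\mathrm iX_i[H_0,S]\Pi_1)$. **Symmetry.** Let $\vartheta=2\pi/n$ with an integer $n\ge2$, let $\mathrm R$ be the rotation by $\vartheta$ in the $(x_i,x_j)$-plane, $\rho$ a unitary on $\mathbb C^N$, and $(R\psi)(x)=\rho\,\psi(\mathrm R^{-1}x)$. Let $b_1,\dots,b_d$ be a second $\mathbb Z$-basis of $\Gamma$ whose cell $\widetilde{\mathcal C}_1=\{x\in\mathcal X:x=\sum_k\alpha_kb_k,\ |\alpha_k|\le1/2\}$ is again a fundamental cell, let $P_\gamma=(\mathcal C_1-\gamma)\cap\widetilde{\mathcal C}_1$ for $\gamma\in\Gamma$, and let $I$ be the finite set of $\gamma\in\Gamma$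 with $P_\gamma\neq\varnothing$. Assume that $\mathrm R$ leaves $\Gamma$ and $\mathcal X$ invariant, that $R$ commutes with $H_0$ and with the multiplication by the characteristic function of $\bigcup_{\eta\in\Gamma}(P_\gamma+\eta)$ for every $\gamma\in I$, and that $\rho^{-1}s\rho=s$. **Statement.** (a) If, in addition, for every $\gamma\in I$ the projection $\chi_{P_\gamma}$ on $\ell^2(\mathcal X)$ has rank one, then $\overline{[\Pi_0,X_j]}$ and $\overline{[H_0,X_i]}$ are everywhere defined bounded operators, all the traces per unit volume above and $\sigma_{\rm conv},\sigma_{\rm prop},\sigma_{\rm rot}$ exist, and $$\sigma_{\rm rot}=0,\qquad\text{equivalently}\qquad \sigma_{\rm prop}=\sigma_{\rm conv}.$$ (b) The Kane–Mele model is in this class. Precisely, on the honeycomb structure with bond length $1$, centred at a hexagon, with $N=2$ and ordinary translations ($M=\mathbf 1$), let $H_0$ have, for real parameters $t,\lambda_{SO},\lambda_R,\lambda_v$, the amplitudes from $y$ to $x$ given by $t\mathbf 1+\mathrm i\lambda_R(\boldsymbol\sigma\times(x-y))_z$ for nearest neighbours, $\mathrm i\lambda_{SO}\nu_{xy}\sigma_z$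 for next-nearest neighbours, where $\nu_{xy}=\tfrac2{\sqrt3}\big((z-y)\times(x-z)\big)_z$ with $z$ the common nearest neighbour of $x$ and $y$, and $\pm\lambda_v\mathbf 1$ for $x=y$, the sign depending on the sublattice. Let $\mu$ lie outside the spectrum of $H_0$ and let $s=\sigma_z/2$. Then for $i\neq j$ in $\{1,2\}$ there are $n$, $\rho$ and $b_1,b_2$ as above for which all the hypotheses hold; hence $\sigma_{\rm rot}=0$ and $\sigma_{\rm prop}=\sigma_{\rm conv}$. -/

import Mathlib

namespace SCond

noncomputable section

/-! ### The one-particle space of a discrete model -/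

/-- Physical space `ℝᵈ` with its Euclidean norm. -/
abbrev Sp (d : ℕ) : Type := EuclideanSpace ℝ (Fin d)

/-- Internal degrees of freedom `ℂᴺ`. -/
abbrev Spin (N : ℕ) : Type := EuclideanSpace ℂ (Fin N)

/-- `ℓ²(X; V)`, that is `L²(X) ⊗ V` for the counting measure on `X`. -/
abbrev Hilb {d : ℕ} (X : Set (Sp d)) (V : Type) [NormedAddCommGroup V]
    [InnerProductSpace ℂ V] : Type :=
  lp (fun _ : X => V) 2

section Operators

variable {d : ℕ} {X : Set (Sp d)} {V : Type} [NormedAddCommGroup V] [InnerProductSpace ℂ V]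

theorem memlp_comp (e : X ≃ X) (U : X → V →L[ℂ] V) (C : ℝ)
    (hU : ∀ x, ‖U x‖ ≤ C) (ψ : Hilb X V) : Memℓp (fun x => U x (ψ (e x))) 2 := by
  have h2 : (0 : ℝ) < (2 : ENNReal).toReal := by norm_num
  have hψ : Summable fun x => ‖ψ x‖ ^ (2 : ENNReal).toReal := (lp.memℓp ψ).summable h2
  refine memℓp_gen ?_
  have hs := ((e.summable_iff.mpr hψ).mul_left (|C| ^ (2 : ENNReal).toReal))
  refine Summable.of_nonneg_of_le (fun x => by positivity) (fun x => ?_) hs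
  rw [Function.comp_apply, ← Real.mul_rpow (abs_nonneg _) (norm_nonneg _)]
  refine Real.rpow_le_rpow (norm_nonneg _) ?_ h2.le
  exact ((U x).le_opNorm _).trans
    (mul_le_mul_of_nonneg_right ((hU x).trans (le_abs_self C)) (norm_nonneg _))

theorem norm_comp_le (e : X ≃ X) (U : X → V →L[ℂ] V) (C : ℝ)
    (hU : ∀ x, ‖U x‖ ≤ C) (ψ : Hilb X V) :
    ‖(⟨fun x => U x (ψ (e x)), memlp_comp e U C hU ψ⟩ : Hilb X V)‖ ≤ |C| * ‖ψ‖ := by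
  have h2 : (0 : ℝ) < (2 : ENNReal).toReal := by norm_num
  have hψ : Summable fun x => ‖ψ x‖ ^ (2 : ENNReal).toReal := (lp.memℓp ψ).summable h2
  refine lp.norm_le_of_tsum_le h2 (by positivity) ?_
  rw [Real.mul_rpow (abs_nonneg _) (norm_nonneg _), lp.norm_rpow_eq_tsum h2,
    ← e.tsum_eq (fun x => ‖ψ x‖ ^ (2 : ENNReal).toReal), ← tsum_mul_left]
  refine Summable.tsum_le_tsum (fun x => ?_)
    ((memlp_comp e U C hU ψ).summable h2) ((e.summable_iff.mpr hψ).mul_left _)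
  rw [← Real.mul_rpow (abs_nonneg _) (norm_nonneg _)]
  refine Real.rpow_le_rpow (norm_nonneg _) ?_ h2.le
  exact ((U x).le_opNorm _).trans
    (mul_le_mul_of_nonneg_right ((hU x).trans (le_abs_self C)) (norm_nonneg _))

/-- The bounded operator `(W ψ)(x) = U x (ψ (e x))`. -/
def wcomp (e : X ≃ X) (U : X → V →L[ℂ] V) (C : ℝ) (hU : ∀ x, ‖U x‖ ≤ C) :
    Hilb X V →L[ℂ] Hilb X V :=
  LinearMap.mkContinuous
    { toFun := fun ψ => ⟨fun x => U x (ψ (e x)), memlp_comp e U C hU ψ⟩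
      map_add' := fun φ ψ => by
        ext x : 2
        exact (U x).map_add _ _
      map_smul' := fun c ψ => by
        ext x : 2
        simp }
    |C| (norm_comp_le e U C hU)

@[simp] theorem wcomp_apply (e : X ≃ X) (U : X → V →L[ℂ] V) (C : ℝ) (hU : ∀ x, ‖U x‖ ≤ C)
    (ψ : Hilb X V) (x : X) : wcomp e U C hU ψ x = U x (ψ (e x)) := rfl

theorem norm_unitary_le (U : V ≃ₗᵢ[ℂ] V) :
    ‖(U.toContinuousLinearEquiv : V →L[ℂ] V)‖ ≤ 1 :=
  ContinuousLinearMap.opNorm_le_bound _ zero_le_one (fun v => by simp)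

/-- The operator `(W ψ)(x) = U x (ψ (e x))` for a family of unitaries `U x`. -/
def unitaryComp (e : X ≃ X) (U : X → V ≃ₗᵢ[ℂ] V) : Hilb X V →L[ℂ] Hilb X V :=
  wcomp e (fun x => ((U x).toContinuousLinearEquiv : V →L[ℂ] V)) 1
    (fun x => norm_unitary_le (U x))

open scoped Classical in
theorem norm_indicator_le (Ω : Set (Sp d)) (x : X) :
    ‖(if (x : Sp d) ∈ Ω then 1 else 0 : V →L[ℂ] V)‖ ≤ 1 := by
  split_ifs
  · exact ContinuousLinearMap.norm_id_le
  · simp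

open scoped Classical in
/-- The projection `χ_Ω`, multiplication by the characteristic function of `Ω`. -/
def chi (X : Set (Sp d)) (V : Type) [NormedAddCommGroup V] [InnerProductSpace ℂ V]
    (Ω : Set (Sp d)) : Hilb X V →L[ℂ] Hilb X V :=
  wcomp (Equiv.refl X) (fun x => if (x : Sp d) ∈ Ω then 1 else 0) 1 (norm_indicator_le Ω)

/-- The operator `1 ⊗ s` on `L²(X) ⊗ V`. -/
def fibreOp (X : Set (Sp d)) (s : V →L[ℂ] V) : Hilb X V →L[ℂ] Hilb X V :=
  wcomp (Equiv.refl X) (fun _ => s) ‖s‖ (fun _ => le_rfl)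

open scoped Classical in
/-- The vector `δ_x ⊗ v`. -/
def site (x : X) (v : V) : Hilb X V := lp.single 2 x v

/-! ### Unbounded operators -/

/-- A bounded operator as an everywhere defined partial operator. -/
def ofBdd (A : Hilb X V →L[ℂ] Hilb X V) : Hilb X V →ₗ.[ℂ] Hilb X V :=
  (A : Hilb X V →ₗ[ℂ] Hilb X V).toPMap ⊤

/-- The product `f A` of a partial operator `f` and a bounded operator `A`, on its natural
domain `{ψ | A ψ ∈ D(f)}`. -/
def mulBdd (f : Hilb X V →ₗ.[ℂ] Hilb X V) (A : Hilb X V →L[ℂ] Hilb X V) :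
    Hilb X V →ₗ.[ℂ] Hilb X V where
  domain := f.domain.comap (A : Hilb X V →ₗ[ℂ] Hilb X V)
  toFun :=
    { toFun := fun ψ => f ⟨A ψ, ψ.2⟩
      map_add' := fun φ ψ => by
        rw [← f.map_add]
        congr 1
        ext : 1
        simp
      map_smul' := fun c ψ => by
        rw [← f.map_smul]
        congr 1
        ext : 1
        simp }

/-- Functions on `X` with `g ψ ∈ ℓ²`, for a real function `g`. -/
def weightDomain (V : Type) [NormedAddCommGroup V] [InnerProductSpace ℂ V] (g : X → ℝ) :
    Submodule ℂ (Hilb X V) where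
  carrier := {ψ | Memℓp (fun x => ((g x : ℝ) : ℂ) • ψ x) 2}
  zero_mem' := by simpa using (zero_mem_ℓp' (E := fun _ : X => V) (p := 2))
  add_mem' := fun {φ ψ} hφ hψ => by
    have h := Memℓp.add hφ hψ
    simp only [Set.mem_ofPred_eq]
    convert h using 1
    ext x
    simp
  smul_mem' := fun c ψ hψ => by
    have h := Memℓp.const_smul hψ c
    simp only [Set.mem_ofPred_eq]
    convert h using 1
    ext x
    simp [smul_comm c]

/-- The position operator `X_j`, `(X_j ψ)(x) = x_j ψ(x)`, on its maximal domain. -/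
def pos (X : Set (Sp d)) (V : Type) [NormedAddCommGroup V] [InnerProductSpace ℂ V]
    (j : Fin d) : Hilb X V →ₗ.[ℂ] Hilb X V where
  domain := weightDomain V (fun x : X => (x : Sp d) j)
  toFun :=
    { toFun := fun ψ => ⟨fun x => (((x : Sp d) j : ℝ) : ℂ) • ψ.1 x, ψ.2⟩
      map_add' := fun φ ψ => by
        ext x : 2
        exact smul_add _ _ _
      map_smul' := fun c ψ => by
        ext x : 2
        simp [smul_comm c] }

/-- Rapidly decreasing functions: `⟨x⟩ʳ ψ ∈ ℓ²` for every `r`.  Under the Bloch-Floquet-Zak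
transform these are exactly the smooth equivariant functions of the quasi-momentum. -/
def rapidDecay (X : Set (Sp d)) (V : Type) [NormedAddCommGroup V] [InnerProductSpace ℂ V] :
    Submodule ℂ (Hilb X V) :=
  ⨅ r : ℕ, weightDomain V (fun x : X => √(1 + ‖(x : Sp d)‖ ^ 2) ^ r)

/-- The commutator `[A, X_j] = A X_j - X_j A` on the rapidly decreasing functions. -/
def commPos (A : Hilb X V →L[ℂ] Hilb X V) (j : Fin d) : Hilb X V →ₗ.[ℂ] Hilb X V :=
  ((A : Hilb X V →ₗ[ℂ] Hilb X V).compPMap (pos X V j) - mulBdd (pos X V j) A).domRestrict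
    (rapidDecay X V)

/-- `f` is closable and its closure is the everywhere defined bounded operator `B`. -/
def IsBddClosure (f : Hilb X V →ₗ.[ℂ] Hilb X V) (B : Hilb X V →L[ℂ] Hilb X V) : Prop :=
  f.IsClosable ∧ f.closure = ofBdd B

open scoped Classical in
/-- The bounded operator which is the closure of `[A, X_j]` (with the dummy value `0` if the
closure is not an everywhere defined bounded operator). -/
def derPos (A : Hilb X V →L[ℂ] Hilb X V) (j : Fin d) : Hilb X V →L[ℂ] Hilb X V :=
  if h : ∃ B, IsBddClosure (commPos A j) B then h.choose else 0

end Operators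

open scoped Classical in
/-- The spectral projection `χ_{(-∞, μ)}(A)` of a bounded self-adjoint operator.  It is used for
`μ` outside the spectrum, where the characteristic function is continuous on the spectrum. -/
def spectralProj {H : Type} [NormedAddCommGroup H] [InnerProductSpace ℂ H] [CompleteSpace H]
    (A : H →L[ℂ] H) (μ : ℝ) : H →L[ℂ] H :=
  cfc (fun e : ℝ => if e < μ then 1 else 0) A

/-! ### Lattices and cells -/

section Geometry

variable {d : ℕ}

/-- The Bravais lattice `Γ` spanned over `ℤ` by `a₁, …, a_d`. -/
abbrev lattice (a : Fin d → Sp d) : Submodule ℤ (Sp d) := Submodule.span ℤ (Set.range a)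

/-- The cell `𝒞_L = {x ∈ X | x = ∑ α_j a_j, |α_j| ≤ L/2}`. -/
def cell (X : Set (Sp d)) (a : Fin d → Sp d) (L : ℕ) : Set (Sp d) :=
  {x | x ∈ X ∧ ∃ α : Fin d → ℝ, x = ∑ j, α j • a j ∧ ∀ j, |α j| ≤ (L : ℝ) / 2}

/-- The translates of `𝒞₁` by lattice vectors are pairwise disjoint (they always cover `X`), so
that `𝒞₁` is a fundamental cell.  As null sets of the counting measure are empty, this says that
no site lies on the boundary of a translate of the closed parallelepiped. -/
def IsPrimitiveCell (X : Set (Sp d)) (a : Fin d → Sp d) : Prop :=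
  ∀ γ ∈ lattice a, γ ≠ 0 → ∀ x ∈ cell X a 1, x + γ ∉ cell X a 1

/-- The piece `P_γ = T_{-γ} 𝒞₁ ∩ 𝒞̃₁` attached to two cells, spanned by `a` and by `b`. -/
def piece (X : Set (Sp d)) (a b : Fin d → Sp d) (γ : Sp d) : Set (Sp d) :=
  {x | x + γ ∈ cell X a 1 ∧ x ∈ cell X b 1}

/-- The union `⋃_{η ∈ Γ} T_η P` of the lattice translates of `P`. -/
def orbit (a : Fin d → Sp d) (P : Set (Sp d)) : Set (Sp d) :=
  {x | ∃ η ∈ lattice a, ∃ p ∈ P, x = p + η}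

/-- The translation `x ↦ x - γ` as a permutation of the crystal. -/
def latticeShift {X : Set (Sp d)} {a : Fin d → Sp d}
    (h : ∀ γ ∈ lattice a, ∀ x ∈ X, x + γ ∈ X) (γ : lattice a) : X ≃ X where
  toFun x := ⟨x - γ, by
    simpa [sub_eq_add_neg] using h (-γ) (neg_mem γ.2) x x.2⟩
  invFun x := ⟨x + γ, h γ γ.2 x x.2⟩
  left_inv x := by simp
  right_inv x := by simp

/-- The counterclockwise rotation of angle `θ` in the plane `(x_i, x_j)`. -/
def rotVec (i j : Fin d) (θ : ℝ) (x : Sp d) : Sp d :=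
  WithLp.toLp 2 fun k =>
    if k = i then Real.cos θ * x i - Real.sin θ * x j
    else if k = j then Real.sin θ * x i + Real.cos θ * x j
    else x k

theorem rotVec_neg_rotVec {i j : Fin d} (hij : i ≠ j) (θ : ℝ) (x : Sp d) :
    rotVec i j (-θ) (rotVec i j θ x) = x := by
  ext k
  have h := Real.sin_sq_add_cos_sq θ
  by_cases hi : k = i
  · subst hi
    simp only [rotVec, if_true, hij.symm, if_false, Real.cos_neg, Real.sin_neg]
    linear_combination (x k) * h
  · by_cases hj : k = j
    · subst hj
      simp only [rotVec, if_true, hi, if_false, Real.cos_neg, Real.sin_neg]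
      linear_combination (x k) * h
    · simp [rotVec, hi, hj]

theorem rotVec_rotVec_neg {i j : Fin d} (hij : i ≠ j) (θ : ℝ) (x : Sp d) :
    rotVec i j θ (rotVec i j (-θ) x) = x := by
  simpa using rotVec_neg_rotVec hij (-θ) x

/-- The inverse rotation `x ↦ R_θ⁻¹ x` as a permutation of an invariant crystal. -/
def rotSites {X : Set (Sp d)} {i j : Fin d} (hij : i ≠ j) (θ : ℝ)
    (h : ∀ x, x ∈ X ↔ rotVec i j θ x ∈ X) : X ≃ X where
  toFun x := ⟨rotVec i j (-θ) x, by rw [h, rotVec_rotVec_neg hij]; exact x.2⟩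
  invFun x := ⟨rotVec i j θ x, (h x).1 x.2⟩
  left_inv x := by simp [rotVec_rotVec_neg hij]
  right_inv x := by simp [rotVec_neg_rotVec hij]

end Geometry

/-! ### Discrete crystals, Hamiltonians and the trace per unit volume -/

/-- A discrete `d`-dimensional crystal with `N` internal degrees of freedom per site: a locally
finite set of sites, invariant under the Bravais lattice spanned by `a`, together with the
unitaries `M(γ, x)` which define the (magnetic) translations. -/
structure Crystal (d N : ℕ) where
  sites : Set (Sp d)
  a : Fin d → Sp d
  linInd : LinearIndependent ℝ a
  locFinite : ∀ K : Set (Sp d), IsCompact K → (sites ∩ K).Finite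
  add_mem : ∀ γ ∈ lattice a, ∀ x ∈ sites, x + γ ∈ sites
  primitive : IsPrimitiveCell sites a
  M : lattice a → sites → (Spin N ≃ₗᵢ[ℂ] Spin N)
  cocycle : ∀ γ₁ γ₂ x, M (γ₁ + γ₂) x = M γ₂ x * M γ₁ (latticeShift add_mem γ₂ x)

namespace Crystal

variable {d N : ℕ} (C : Crystal d N)

/-- The Hilbert space `L²(X) ⊗ ℂᴺ`. -/
abbrev H : Type := Hilb C.sites (Spin N)

/-- Bounded operators on `L²(X) ⊗ ℂᴺ`. -/
abbrev Op : Type := C.H →L[ℂ] C.H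

/-- The (magnetic) translation `(T_γ ψ)(x) = M(γ, x) ψ(x - γ)`. -/
def T (γ : lattice C.a) : C.Op := unitaryComp (latticeShift C.add_mem γ) (C.M γ)

/-- Periodic operators: those which commute with all `T_γ`. -/
def IsPeriodic (A : C.Op) : Prop := ∀ γ, A * C.T γ = C.T γ * A

/-- Finite-range hopping: the matrix elements `A(x, y)` vanish for `|x - y| > r`. -/
def HasFiniteRange (A : C.Op) : Prop :=
  ∃ r : ℝ, ∀ x y : C.sites, r < dist (x : Sp d) y → ∀ v : Spin N, A (site y v) x = 0

open scoped Classical in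
/-- The contribution of the site `x` to the trace of `A`, namely `∑_k ⟨δ_x ⊗ e_k, A (δ_x ⊗ e_k)⟩`
(vectors outside the domain of `A` are ignored; there are none where this is used). -/
def siteTrace (A : C.H →ₗ.[ℂ] C.H) (x : C.sites) : ℂ :=
  ∑ k : Fin N, if h : site x (EuclideanSpace.single k (1 : ℂ)) ∈ A.domain
    then (A ⟨_, h⟩ : C.H) x k else 0

/-- `Tr(χ_Ω A χ_Ω)`, computed in the position basis, for `Ω` with finitely many sites. -/
def traceOn (Ω : Set (Sp d)) (A : C.H →ₗ.[ℂ] C.H) : ℂ :=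
  ∑ᶠ (x : C.sites) (_ : (x : Sp d) ∈ Ω), C.siteTrace A x

/-- The trace per unit volume of `A` exists and equals `t`: the compactly supported functions lie
in the domain of `A`, and `|𝒞_L|⁻¹ Tr(χ_L A χ_L) → t` as `L = 2 m + 1 → ∞`. -/
def HasTracePerVolume (A : C.H →ₗ.[ℂ] C.H) (t : ℂ) : Prop :=
  (∀ x v, site x v ∈ A.domain) ∧
  Filter.Tendsto
    (fun m : ℕ => C.traceOn (cell C.sites C.a (2 * m + 1)) A
      / ((cell C.sites C.a (2 * m + 1)).ncard : ℂ))
    Filter.atTop (nhds t)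

end Crystal

/-- A discrete Hamiltonian `H₀` with finite-range hopping on the crystal `C`, a Fermi energy `μ` in
a spectral gap, and a generalized spin `s` on `ℂᴺ` for which `S = 1 ⊗ s` is periodic. -/
structure Model {d N : ℕ} (C : Crystal d N) where
  H0 : C.Op
  selfAdjoint : IsSelfAdjoint H0
  periodic : C.IsPeriodic H0
  finiteRange : C.HasFiniteRange H0
  μ : ℝ
  gap : (μ : ℂ) ∉ spectrum ℂ H0
  s : Spin N →L[ℂ] Spin N
  s_selfAdjoint : IsSelfAdjoint s
  s_periodic : C.IsPeriodic (fibreOp C.sites s)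

namespace Model

variable {d N : ℕ} {C : Crystal d N} (Q : Model C)

/-- The operator `S = 1 ⊗ s`. -/
def S : C.Op := fibreOp C.sites Q.s

/-- The Fermi projector `Π₀ = χ_{(-∞, μ)}(H₀)`. -/
def Pi0 : C.Op := spectralProj Q.H0 Q.μ

/-- A real number below `μ` and below the spectrum of `H₀`. -/
def bottom : ℝ := -(‖Q.H0‖ + |Q.μ| + 1)

/-- The map `ℐ(A) = (i/2π) ∮ (H₀ - z)⁻¹ [A, Π₀] (H₀ - z)⁻¹ dz`.  The contour is the positively
oriented circle which crosses the real axis in the gap at `μ` and below the spectrum of `H₀`. -/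
def invLiouville (A : C.Op) : C.Op :=
  (Complex.I / (2 * Real.pi)) •
    circleIntegral
      (fun z : ℂ => Ring.inverse (Q.H0 - z • (1 : C.Op)) * (A * Q.Pi0 - Q.Pi0 * A)
        * Ring.inverse (Q.H0 - z • (1 : C.Op)))
      (((Q.bottom + Q.μ) / 2 : ℝ) : ℂ) ((Q.μ - Q.bottom) / 2)

/-- The closure of `[X_j, Π₀]`. -/
def derPi0 (j : Fin d) : C.Op := -derPos Q.Pi0 j

/-- The linear response `Π₁ = ℐ([X_j, Π₀])` of the state to the field in direction `j`. -/
def Pi1 (j : Fin d) : C.Op := Q.invLiouville (Q.derPi0 j)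

/-- The generator `𝒮 = i ℐ([[X_j, Π₀], Π₀])` of the almost-stationary state. -/
def generator (j : Fin d) : C.Op :=
  Complex.I • Q.invLiouville (Q.derPi0 j * Q.Pi0 - Q.Pi0 * Q.derPi0 j)

/-- The non-equilibrium almost-stationary state `Π^ε = e^{-iε𝒮} Π₀ e^{iε𝒮}` of
`H₀ - ε X_j`. -/
def PiEps (j : Fin d) (ε : ℝ) : C.Op :=
  NormedSpace.exp (-(Complex.I * ε) • Q.generator j) * Q.Pi0
    * NormedSpace.exp ((Complex.I * ε) • Q.generator j)

/-- The conventional `S`-current `½ (i [H₀, X_i] S + i S [H₀, X_i])`, with the closure of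
`[H₀, X_i]`. -/
def Jconv (i : Fin d) : C.H →ₗ.[ℂ] C.H :=
  ofBdd ((1 / 2 : ℂ) •
    (Complex.I • (derPos Q.H0 i * Q.S) + Complex.I • (Q.S * derPos Q.H0 i)))

/-- The proper `S`-current `i [H₀, X_i] S + i X_i [H₀, S]`. -/
def Jprop (i : Fin d) : C.H →ₗ.[ℂ] C.H :=
  ofBdd (Complex.I • (derPos Q.H0 i * Q.S))
    + Complex.I • mulBdd (pos C.sites (Spin N) i) (Q.H0 * Q.S - Q.S * Q.H0)

/-- The `S`-rotation operator `i X_i [H₀, S] Π₁`, where `Π₁` refers to the direction `j`. -/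
def rotationOp (i j : Fin d) : C.H →ₗ.[ℂ] C.H :=
  mulBdd (Complex.I • mulBdd (pos C.sites (Spin N) i) (Q.H0 * Q.S - Q.S * Q.H0)) (Q.Pi1 j)

/-- `σ` is the `S`-conductivity of the current `J` in response to a field in direction `j`: the
traces per unit volume of `J Π₀` and of `J Π^ε`, `0 ≤ ε ≤ 1`, exist, and
`Re τ(J Π^ε) - Re τ(J Π₀) = ε σ + o(ε)` as `ε ↓ 0`. -/
def IsConductivity (J : C.H →ₗ.[ℂ] C.H) (j : Fin d) (σ : ℝ) : Prop :=
  ∃ (t₀ : ℂ) (t : ℝ → ℂ),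
    C.HasTracePerVolume (mulBdd J Q.Pi0) t₀ ∧
    (∀ ε ∈ Set.Icc (0 : ℝ) 1, C.HasTracePerVolume (mulBdd J (Q.PiEps j ε)) (t ε)) ∧
    (fun ε : ℝ => (t ε).re - t₀.re - ε * σ) =o[nhdsWithin 0 (Set.Ioi 0)] (fun ε : ℝ => ε)

/-- `σ` is the conventional `S`-conductivity `σ_conv,ij`. -/
def IsSigmaConv (i j : Fin d) (σ : ℝ) : Prop := Q.IsConductivity (Q.Jconv i) j σ

/-- `σ` is the proper `S`-conductivity `σ_prop,ij`. -/
def IsSigmaProp (i j : Fin d) (σ : ℝ) : Prop := Q.IsConductivity (Q.Jprop i) j σ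

/-- `σ` is the rotation `S`-conductivity `σ_rot,ij = Re τ(i X_i [H₀, S] Π₁)`. -/
def IsSigmaRot (i j : Fin d) (σ : ℝ) : Prop :=
  ∃ t : ℂ, C.HasTracePerVolume (Q.rotationOp i j) t ∧ t.re = σ

/-- The commutators which enter the definitions, `[Π₀, X_j]` and `[H₀, X_i]` on the rapidly
decreasing functions, close to everywhere defined bounded operators. -/
def WellPosed (i j : Fin d) : Prop :=
  (∃ B, IsBddClosure (commPos Q.Pi0 j) B) ∧ (∃ B, IsBddClosure (commPos Q.H0 i) B)

/-- The rotation operator `(R ψ)(x) = ρ ψ(R_θ⁻¹ x)`. -/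
def rotOp {X : Set (Sp d)} {i j : Fin d} (hij : i ≠ j) (θ : ℝ)
    (h : ∀ x, x ∈ X ↔ rotVec i j θ x ∈ X) (ρ : Spin N ≃ₗᵢ[ℂ] Spin N) :
    Hilb X (Spin N) →L[ℂ] Hilb X (Spin N) :=
  unitaryComp (rotSites hij θ h) (fun _ => ρ)

/-- The model is symmetric under the rotation of angle `2π/n` in the plane `(x_i, x_j)`, acting on
the internal degrees of freedom by the unitary `ρ`; the pieces `P_γ` are those of the cells
spanned by `C.a` and by a second basis `b` of the lattice.  As the rotation operator `R` is
unitary, `R⁻¹ A R = A` is written `A R = R A`. -/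
structure RotSymmetric (i j : Fin d) (hij : i ≠ j) (n : ℕ) (ρ : Spin N ≃ₗᵢ[ℂ] Spin N)
    (b : Fin d → Sp d) : Prop where
  basis : lattice b = lattice C.a
  primitive : IsPrimitiveCell C.sites b
  lattice_rot : ∀ γ, γ ∈ lattice C.a ↔ rotVec i j (2 * Real.pi / n) γ ∈ lattice C.a
  sites_rot : ∀ x, x ∈ C.sites ↔ rotVec i j (2 * Real.pi / n) x ∈ C.sites
  piece_rot : ∀ γ ∈ lattice C.a,
    chi C.sites (Spin N) (orbit C.a (piece C.sites C.a b γ)) * rotOp hij _ sites_rot ρ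
      = rotOp hij _ sites_rot ρ * chi C.sites (Spin N) (orbit C.a (piece C.sites C.a b γ))
  H0_rot : Q.H0 * rotOp hij _ sites_rot ρ = rotOp hij _ sites_rot ρ * Q.H0
  s_rot : ∀ v, Q.s (ρ v) = ρ (Q.s v)

end Model

/-- Every nonempty piece `P_γ` has a characteristic function which, as a projection on `L²(X)`, has
rank one.  The set `I` of the decomposition consists of the `γ` for which `P_γ` is nonempty. -/
def PiecesRankOne {d N : ℕ} (C : Crystal d N) (b : Fin d → Sp d) : Prop :=
  ∀ γ ∈ lattice C.a, (piece C.sites C.a b γ).Nonempty →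
    Module.finrank ℂ
      (LinearMap.range (chi C.sites ℂ (piece C.sites C.a b γ)).toLinearMap) = 1

/-! ### The Kane-Mele model -/

/-- A lattice basis of the honeycomb structure with bond length `1`; the two vectors form an angle
of `2π/3`. -/
def honeyBasis : Fin 2 → Sp 2 := ![!₂[√3, 0], !₂[-√3 / 2, 3 / 2]]

/-- Position of a site relative to the centre of a hexagon. -/
def honeyOffset : Sp 2 := !₂[√3 / 2, -1 / 2]

/-- The first sublattice of the honeycomb structure. -/
def honeyA : Set (Sp 2) := {x | x - honeyOffset ∈ lattice honeyBasis}

/-- The second sublattice of the honeycomb structure. -/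
def honeyB : Set (Sp 2) := {x | x + honeyOffset ∈ lattice honeyBasis}

theorem honey_linInd : LinearIndependent ℝ honeyBasis := by
  rw [honeyBasis, LinearIndependent.pair_iff]
  intro s t h
  have h0 := congrArg (fun v : Sp 2 => v 0) h
  have h1 := congrArg (fun v : Sp 2 => v 1) h
  have h3 : (0 : ℝ) < √3 := by positivity
  simp at h0 h1
  subst h1
  simpa using h0

theorem honey_locFinite (K : Set (Sp 2)) (hK : IsCompact K) :
    ((honeyA ∪ honeyB) ∩ K).Finite := by
  have hfin : ∀ v : Sp 2, ({x | x - v ∈ lattice honeyBasis} ∩ K).Finite := by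
    intro v
    let B := basisOfLinearIndependentOfCardEqFinrank honey_linInd (by simp)
    have hB : ⇑B = honeyBasis := coe_basisOfLinearIndependentOfCardEqFinrank _ _
    have hb : Bornology.IsBounded ((fun x => x - v) '' K) :=
      (hK.image (by fun_prop)).isBounded
    have hf := ZSpan.setFinite_inter B hb
    rw [hB] at hf
    refine (hf.preimage (f := fun x => x - v) (sub_left_injective.injOn)).subset ?_
    rintro x ⟨hx, hxK⟩
    exact ⟨⟨x, hxK, rfl⟩, hx⟩
  rw [Set.union_inter_distrib_right]
  refine (hfin honeyOffset).union ?_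
  have := hfin (-honeyOffset)
  simpa [honeyB] using this

theorem honey_add_mem (γ : Sp 2) (hγ : γ ∈ lattice honeyBasis) (x : Sp 2)
    (hx : x ∈ honeyA ∪ honeyB) : x + γ ∈ honeyA ∪ honeyB := by
  rcases hx with hx | hx
  · left
    have := add_mem (show x - honeyOffset ∈ lattice honeyBasis from hx) hγ
    show x + γ - honeyOffset ∈ lattice honeyBasis
    rwa [add_sub_right_comm]
  · right
    have := add_mem (show x + honeyOffset ∈ lattice honeyBasis from hx) hγ
    show x + γ + honeyOffset ∈ lattice honeyBasis
    rwa [add_right_comm]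

theorem mem_honeyLattice {γ : Sp 2} (h : γ ∈ lattice honeyBasis) :
    ∃ m n : ℤ, γ 0 = √3 * m - √3 / 2 * n ∧ γ 1 = 3 / 2 * n := by
  rw [lattice, Submodule.mem_span_range_iff_exists_fun] at h
  obtain ⟨c, rfl⟩ := h
  refine ⟨c 0, c 1, ?_, ?_⟩
  · simp [Fin.sum_univ_two, honeyBasis]
    ring
  · simp [Fin.sum_univ_two, honeyBasis]
    ring

theorem honey_primitive : IsPrimitiveCell (honeyA ∪ honeyB) honeyBasis := by
  have h3 : (0 : ℝ) < √3 := by positivity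
  have key : ∀ x ∈ cell (honeyA ∪ honeyB) honeyBasis 1, x = honeyOffset ∨ x = -honeyOffset := by
    rintro x ⟨hx, α, hα, hb⟩
    have e0 : x 0 = √3 * α 0 - √3 / 2 * α 1 := by
      rw [hα]; simp [Fin.sum_univ_two, honeyBasis]; ring
    have e1 : x 1 = 3 / 2 * α 1 := by
      rw [hα]; simp [Fin.sum_univ_two, honeyBasis]; ring
    have b0 := abs_le.1 (hb 0)
    have b1 := abs_le.1 (hb 1)
    norm_num at b0 b1
    have zero : ∀ m : ℤ, ∀ α c : ℝ, |c| ≤ 1 / 3 → α = m + c → -(1 / 2) ≤ α → α ≤ 1 / 2 →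
        m = 0 := by
      intro m α c hc e h1 h2
      have hc := abs_le.1 hc
      have a1 : (m : ℝ) < 1 := by linarith
      have a2 : (-1 : ℝ) < m := by linarith
      have a1' : m < 1 := by exact_mod_cast a1
      have a2' : -1 < m := by exact_mod_cast a2
      omega
    rcases hx with hx | hx
    · left
      obtain ⟨m, n, hm, hn⟩ := mem_honeyLattice hx
      simp [honeyOffset] at hm hn
      have f1 : α 1 = n + (-1 / 3) := by linarith
      have f0 : α 0 = m + 1 / 3 := by
        have : √3 * α 0 = √3 * (m + 1 / 3) := by rw [f1] at e0; linarith
        exact mul_left_cancel₀ h3.ne' this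
      have n0 := zero n _ _ (by rw [abs_le]; norm_num) f1 b1.1 b1.2
      have m0 := zero m _ _ (by rw [abs_le]; norm_num) f0 b0.1 b0.2
      subst n0 m0
      ext k
      fin_cases k
      · simp [honeyOffset] at *; linarith
      · simp [honeyOffset] at *; linarith
    · right
      obtain ⟨m, n, hm, hn⟩ := mem_honeyLattice hx
      simp [honeyOffset] at hm hn
      have f1 : α 1 = n + 1 / 3 := by linarith
      have f0 : α 0 = m + (-1 / 3) := by
        have : √3 * α 0 = √3 * (m + (-1 / 3)) := by rw [f1] at e0; linarith
        exact mul_left_cancel₀ h3.ne' this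
      have n0 := zero n _ _ (by rw [abs_le]; norm_num) f1 b1.1 b1.2
      have m0 := zero m _ _ (by rw [abs_le]; norm_num) f0 b0.1 b0.2
      subst n0 m0
      ext k
      fin_cases k
      · simp [honeyOffset] at *; linarith
      · simp [honeyOffset] at *; linarith
  intro γ hγ hne x hx hx'
  obtain ⟨m, n, hm, hn⟩ := mem_honeyLattice hγ
  have hcase : γ = 0 ∨ γ = (2 : ℝ) • honeyOffset ∨ γ = (-2 : ℝ) • honeyOffset := by
    have hg : γ = (x + γ) - x := by abel
    rcases key x hx with h | h <;> rcases key _ hx' with h' | h' <;> rw [hg, h', h]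
    · left; abel
    · right; right; module
    · right; left; module
    · left; abel
  rcases hcase with h | h | h
  · exact hne h
  · rw [h] at hn
    simp [honeyOffset] at hn
    have : (3 * n : ℤ) = -2 := by
      have : (3 * n : ℝ) = -2 := by linarith
      exact_mod_cast this
    omega
  · rw [h] at hn
    simp [honeyOffset] at hn
    have : (3 * n : ℤ) = 2 := by
      have : (3 * n : ℝ) = 2 := by linarith
      exact_mod_cast this
    omega

/-- The honeycomb structure with spin `1/2` and ordinary translations. -/
def honeycomb : Crystal 2 2 where
  sites := honeyA ∪ honeyB
  a := honeyBasis
  linInd := honey_linInd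
  locFinite := honey_locFinite
  add_mem := honey_add_mem
  primitive := honey_primitive
  M := fun _ _ => 1
  cocycle := fun _ _ _ => rfl

def pauliX : Matrix (Fin 2) (Fin 2) ℂ := !![0, 1; 1, 0]
def pauliY : Matrix (Fin 2) (Fin 2) ℂ := !![0, -Complex.I; Complex.I, 0]
def pauliZ : Matrix (Fin 2) (Fin 2) ℂ := !![1, 0; 0, -1]

/-- The spin operator `s_z`, half of the third Pauli matrix. -/
def spinZ : Spin 2 →L[ℂ] Spin 2 := Matrix.toEuclideanCLM (𝕜 := ℂ) ((1 / 2 : ℂ) • pauliZ)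

/-- The sign `ν = (2/√3) (d₁ × d₂)_z` of the path from `y` to its next-nearest neighbour `x` along
two bonds `d₁ = z - y` and `d₂ = x - z`; the intermediate site `z` is unique. -/
def kmNu (x y : Sp 2) : ℝ :=
  ∑ᶠ (z : Sp 2) (_ : z ∈ honeyA ∪ honeyB ∧ dist z y = 1 ∧ dist x z = 1),
    2 / √3 * ((z - y) 0 * (x - z) 1 - (z - y) 1 * (x - z) 0)

open scoped Classical in
/-- The hopping amplitudes from `y` to `x` of the Kane-Mele Hamiltonian: nearest-neighbour hopping
`t`, spin-orbit coupling `i λ_SO ν σ_z` between next-nearest neighbours, nearest-neighbour Rashba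
coupling `i λ_R (σ × d)_z` with `d = x - y`, and a staggered sublattice potential `± λ_v`. -/
def kmHop (t lso lr lv : ℝ) (x y : Sp 2) : Matrix (Fin 2) (Fin 2) ℂ :=
  (if dist x y = 1 then
    (t : ℂ) • 1 + (Complex.I * lr) •
      ((((x - y) 1 : ℝ) : ℂ) • pauliX - (((x - y) 0 : ℝ) : ℂ) • pauliY) else 0)
  + (if dist x y = √3 then (Complex.I * lso * kmNu x y) • pauliZ else 0)
  + (if x = y then ((if x ∈ honeyA then lv else -lv : ℝ) : ℂ) • 1 else 0)

/-- `H₀` is the Kane-Mele Hamiltonian with the given parameters. -/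
def IsKaneMele (t lso lr lv : ℝ) (H0 : honeycomb.Op) : Prop :=
  ∀ (x y : honeycomb.sites) (v : Spin 2),
    H0 (site y v) x = Matrix.toEuclideanCLM (𝕜 := ℂ) (kmHop t lso lr lv x y) v

end

end SCond

/-! Let f_k(x) be the trace over the internal space of the diagonal matrix element at x of [H₀, S]
Π₁, where Π₁ is the response to a field in direction k, for k = i, j. The theorem reduces to the
vanishing of f_j at every site (`Model.diagTrace_torque_Pi1_eq_zero`). The commutators of Π₀ with
X_i and X_j rotate as a vector (`KerDer.rot`), while H₀, Π₀ and S commute with R. Hence (f_i, f_j)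
at the rotated site is a rotation of (f_i, f_j) at the original one. On the other hand, a rank-one
piece consists of a single site (`eq_of_finrank_range_chi`), and R preserves the lattice orbit of
each piece (`rot_mem_orbit`), so R moves each representative in the second cell by a lattice vector.
The functions f_k are lattice invariant, so (f_i, f_j) is a fixed vector of a nontrivial plane
rotation, and therefore zero.

The consequence for the conductivities (`Model.sigma_of_diagTrace_eq_zero`) rests on an explicit
form of the trace per unit volume. Every operator that occurs has diagonal traces of the form g(x) +
x_i h(x) with g, h lattice invariant. Over boxes of odd side the lattice vectors sum to zero, so the
averages are independent of the box and equal the mean over one cell (`Crystal.hasTracePerVolume`).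
The state Π^ε has derivative Π₁ at 0, because Π₁ = -i[𝒮, Π₀] (`Model.Pi1_eq_commutator`). Thus σ_rot
is the real part of a cell mean of i x_i f_j, which is zero, and the same term is the contribution
of i X_i [H₀, S] to σ_prop. The remaining difference between the two currents is the order of S and
i[H₀, X_i], which the real part of the trace does not see, by cyclicity and self-adjointness
(`Model.re_cellMean_current`).

Boundedness and domain questions are all settled by one notion, `HasDer`: norm differentiability at
t = 0 of e^{itX_k} A e^{-itX_k}. It holds for finite-range operators by a Schur test and is
inherited by products, inverses, exponentials and contour integrals. Since Π₀ is a Riesz integral of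
resolvents (`spectralProj_eq_contourInt`), it reaches Π₀, Π₁, 𝒮 and Π^ε. Such a derivative has, up
to a factor i, the matrix elements of the commutator with X_k, and this forces the closure of the
commutator to be bounded and the domain of X_k to be preserved.

For the Kane–Mele model the rotation by 2π/3 about a hexagon centre moves each site by a lattice
vector. The second basis is the rotated first one, which separates the two sublattices into
different pieces (`IsThirdTurn.eq_of_mem_piece`), and ρ = diag(1, e^{iθ}) compensates the phase
acquired by the Rashba term (`kmHop_turn`). -/

namespace SCond
noncomputable section

/-! ### Matrix elements, and commutators with position as closed operators -/

section Sites

variable {d : ℕ} {X : Set (Sp d)} {V : Type} [NormedAddCommGroup V] [InnerProductSpace ℂ V]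

open scoped Classical in
theorem site_apply (y x : X) (v : V) : site y v x = if x = y then v else 0 := by
  simp only [site, lp.single_apply, Pi.single_apply]

@[simp] theorem site_apply_self (x : X) (v : V) : site x v x = v := by simp [site_apply]

theorem site_apply_ne {x y : X} (h : x ≠ y) (v : V) : site y v x = 0 := by simp [site_apply, h]

theorem site_add (x : X) (v w : V) : site x (v + w) = site x v + site x w :=
  lp.single_add (E := fun _ : X => V) 2 x v w

theorem site_smul (x : X) (c : ℂ) (v : V) : site x (c • v) = c • site x v :=
  lp.single_smul (E := fun _ : X => V) 2 x c v

theorem norm_site (x : X) (v : V) : ‖site x v‖ = ‖v‖ :=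
  lp.norm_single (E := fun _ : X => V) (p := 2) (by norm_num) x v

/-- Evaluation at the site `x`. -/
def ev (x : X) : Hilb X V →L[ℂ] V := lp.evalCLM ℂ (fun _ : X => V) 2 x

theorem norm_apply_le (ψ : Hilb X V) (x : X) : ‖ψ x‖ ≤ ‖ψ‖ :=
  lp.norm_apply_le_norm (by norm_num) ψ x

theorem hasSum_site (ψ : Hilb X V) : HasSum (fun y => site y (ψ y)) ψ := by
  simpa [site] using lp.hasSum_single (E := fun _ : X => V) (p := 2) (by norm_num) ψ

theorem hasSum_apply_site (A : Hilb X V →L[ℂ] Hilb X V) (ψ : Hilb X V) (x : X) :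
    HasSum (fun y => A (site y (ψ y)) x) (A ψ x) :=
  (hasSum_site ψ).mapL ((ev x).comp A)

theorem op_ext {A B : Hilb X V →L[ℂ] Hilb X V}
    (h : ∀ y v x, A (site y v) x = B (site y v) x) : A = B := by
  ext ψ x : 3
  exact (hasSum_apply_site A ψ x).unique
    ((hasSum_apply_site B ψ x).congr_fun (fun y => h y (ψ y) x))

/-- The position of `x` along the axis `j`, as a complex number. -/
abbrev co (j : Fin d) (x : X) : ℂ := (((x : Sp d) j : ℝ) : ℂ)

theorem mem_weightDomain_of_eq {g : X → ℝ} {ψ φ : Hilb X V}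
    (h : ∀ x, φ x = ((g x : ℝ) : ℂ) • ψ x) : ψ ∈ weightDomain V g := by
  show Memℓp (fun y : X => ((g y : ℝ) : ℂ) • ψ y) 2
  have : (fun y : X => ((g y : ℝ) : ℂ) • ψ y) = φ := funext fun x => (h x).symm
  rw [this]
  exact φ.2

theorem site_mem_weightDomain (g : X → ℝ) (x : X) (v : V) : site x v ∈ weightDomain V g := by
  refine mem_weightDomain_of_eq (φ := site x (((g x : ℝ) : ℂ) • v)) fun y => ?_
  by_cases h : y = x
  · subst h; rw [site_apply_self, site_apply_self]
  · rw [site_apply_ne h, site_apply_ne h, smul_zero]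

theorem site_mem_pos_domain (j : Fin d) (x : X) (v : V) : site x v ∈ (pos X V j).domain :=
  site_mem_weightDomain _ x v

theorem pos_apply (j : Fin d) (ψ : (pos X V j).domain) (x : X) :
    pos X V j ψ x = co j x • (ψ : Hilb X V) x := rfl

/-- `B` has the matrix elements of the commutator `[A, X_j]`. -/
def KerDer (j : Fin d) (A B : Hilb X V →L[ℂ] Hilb X V) : Prop :=
  ∀ y v x, B (site y v) x = (co j y - co j x) • A (site y v) x

/-- For ψ in the domain of X_j both ψ and X_j ψ are in ℓ², so A may be expanded over sites on each
of them. This extends the commutator identity from single sites to the whole maximal domain. -/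
theorem KerDer.apply {j : Fin d} {A B : Hilb X V →L[ℂ] Hilb X V} (h : KerDer j A B)
    (ψ : (pos X V j).domain) (x : X) :
    B ψ x = A (pos X V j ψ) x - co j x • A (ψ : Hilb X V) x := by
  refine (hasSum_apply_site B ψ x).unique ?_
  have h1 := hasSum_apply_site A (pos X V j ψ) x
  have h2 := (hasSum_apply_site A (ψ : Hilb X V) x).const_smul (co j x)
  refine (h1.sub h2).congr_fun fun y => ?_
  rw [h, pos_apply, site_smul, map_smul, lp.coeFn_smul, Pi.smul_apply, sub_smul]

/-- Pointwise X_j A ψ = A X_j ψ - B ψ, and the right side is in ℓ². -/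
theorem KerDer.mem_domain {j : Fin d} {A B : Hilb X V →L[ℂ] Hilb X V} (h : KerDer j A B)
    {ψ : Hilb X V} (hψ : ψ ∈ (pos X V j).domain) : A ψ ∈ (pos X V j).domain := by
  refine mem_weightDomain_of_eq (φ := A (pos X V j ⟨ψ, hψ⟩) - B ψ) fun x => ?_
  rw [lp.coeFn_sub, Pi.sub_apply, h.apply ⟨ψ, hψ⟩ x]
  abel

theorem site_mem_rapidDecay (x : X) (v : V) : site x v ∈ rapidDecay X V := by
  rw [rapidDecay, Submodule.mem_iInf]
  intro r
  exact site_mem_weightDomain _ x v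

theorem ofBdd_injective {A B : Hilb X V →L[ℂ] Hilb X V} (h : ofBdd A = ofBdd B) : A = B := by
  ext1 ψ
  have hA : (ψ, A ψ) ∈ (ofBdd A).graph := (ofBdd A).mem_graph ⟨ψ, trivial⟩
  rw [h] at hA
  exact LinearPMap.mem_graph_snd_inj _ hA ((ofBdd B).mem_graph ⟨ψ, trivial⟩) rfl

theorem mem_graph_ofBdd {B : Hilb X V →L[ℂ] Hilb X V} {p : Hilb X V × Hilb X V} :
    p ∈ (ofBdd B).graph ↔ p.2 = B p.1 := by
  rw [LinearPMap.mem_graph_iff]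
  constructor
  · rintro ⟨y, hy, h⟩
    rw [← h, ← hy]; rfl
  · intro h
    exact ⟨⟨p.1, trivial⟩, rfl, h.symm⟩

/-- The finitely supported functions are a core for any bounded B: the expansion of ψ over sites
converges together with its image, so the graph of B lies in the closure of the graph of f. The
reverse inclusion holds because the graph of B is closed. -/
theorem isBddClosure_of_dense {f : Hilb X V →ₗ.[ℂ] Hilb X V} {B : Hilb X V →L[ℂ] Hilb X V}
    (hs : ∀ x v, site x v ∈ f.domain) (hf : ∀ ψ : f.domain, f ψ = B ψ) : IsBddClosure f B := by
  have hg : f.graph.topologicalClosure = (ofBdd B).graph := by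
    apply le_antisymm
    · refine Submodule.topologicalClosure_minimal _ ?_ ?_
      · rintro p hp
        obtain ⟨y, hy, h⟩ := (LinearPMap.mem_graph_iff _).1 hp
        rw [mem_graph_ofBdd, ← h, ← hy, hf]
      · have : ((ofBdd B).graph : Set (Hilb X V × Hilb X V)) = {p | p.2 = B p.1} := by
          ext p; exact mem_graph_ofBdd
        rw [this]
        exact isClosed_eq continuous_snd (B.continuous.comp continuous_fst)
    · rintro ⟨ψ, φ⟩ hp
      rw [mem_graph_ofBdd] at hp
      simp only at hp
      subst hp
      have h1 := hasSum_site ψ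
      have h2 : HasSum (fun y => (site y (ψ y), B (site y (ψ y)))) (ψ, B ψ) :=
        h1.prodMk (h1.mapL B)
      refine (Submodule.isClosed_topologicalClosure f.graph).mem_of_tendsto h2
        (Filter.Eventually.of_forall fun s => ?_)
      refine Submodule.sum_mem _ fun y _ => Submodule.le_topologicalClosure _ ?_
      have := f.mem_graph ⟨site y (ψ y), hs y _⟩
      rwa [hf] at this
  have hc : f.IsClosable := ⟨ofBdd B, hg⟩
  refine ⟨hc, LinearPMap.eq_of_eq_graph ?_⟩
  rw [← hc.graph_closure_eq_closure_graph, hg]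

theorem KerDer.isBddClosure {j : Fin d} {A B : Hilb X V →L[ℂ] Hilb X V} (h : KerDer j A B) :
    IsBddClosure (commPos A j) B := by
  refine isBddClosure_of_dense (fun x v => ?_) ?_
  · refine ⟨site_mem_rapidDecay x v, site_mem_pos_domain j x v, ?_⟩
    exact h.mem_domain (site_mem_pos_domain j x v)
  · rintro ⟨ψ, hψ, h1, h2⟩
    ext x : 2
    rw [h.apply ⟨ψ, h1⟩ x]
    rfl

/-- A bounded closure is unique, so the choice inside `derPos` is determined and its default value 0
plays no role. -/
theorem KerDer.derPos_eq {j : Fin d} {A B : Hilb X V →L[ℂ] Hilb X V} (h : KerDer j A B) :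
    derPos A j = B := by
  have hex : ∃ B, IsBddClosure (commPos A j) B := ⟨B, h.isBddClosure⟩
  rw [derPos, dif_pos hex]
  exact ofBdd_injective (hex.choose_spec.2.symm.trans h.isBddClosure.2)

end Sites

end

end SCond

namespace SCond
noncomputable section

/-! ### Schur test for kernels of finite range -/

section Kernels

variable {d : ℕ} {X : Set (Sp d)} {V : Type} [NormedAddCommGroup V] [InnerProductSpace ℂ V]

/-- The embedding `v ↦ δ_y ⊗ v`. -/
def siteL (y : X) : V →L[ℂ] Hilb X V :=
  LinearMap.mkContinuous
    { toFun := site y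
      map_add' := site_add y
      map_smul' := site_smul y } 1 (fun v => by
        rw [one_mul]; exact (norm_site y v).le)

/-- The matrix element `A(x, y)`. -/
def entry (A : Hilb X V →L[ℂ] Hilb X V) (x y : X) : V →L[ℂ] V :=
  (ev x).comp (A.comp (siteL y))

@[simp] theorem entry_apply (A : Hilb X V →L[ℂ] Hilb X V) (x y : X) (v : V) :
    entry A x y v = A (site y v) x := rfl

theorem norm_entry_le (A : Hilb X V →L[ℂ] Hilb X V) (x y : X) : ‖entry A x y‖ ≤ ‖A‖ := by
  refine ContinuousLinearMap.opNorm_le_bound _ (norm_nonneg A) fun v => ?_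
  rw [entry_apply, ← norm_site y v]
  exact (norm_apply_le _ x).trans (A.le_opNorm _)

variable (nb : X → Finset X) (n : ℕ) (K : ℝ) (k : X → X → V →L[ℂ] V)

theorem sum_sq_norm_le (s : Finset X) (ψ : Hilb X V) : ∑ x ∈ s, ‖ψ x‖ ^ 2 ≤ ‖ψ‖ ^ 2 := by
  have := lp.sum_rpow_le_norm_rpow (E := fun _ : X => V) (p := 2) (by norm_num) ψ s
  simpa using this

/-- Cauchy–Schwarz in each row costs one factor n. Exchanging the two sums costs another, because
the symmetry of the neighbourhoods turns the bound on rows into a bound on columns. -/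
theorem kernel_sum_le (hcard : ∀ x, (nb x).card ≤ n) (hsymm : ∀ x y, y ∈ nb x → x ∈ nb y)
    (hk : ∀ x y, ‖k x y‖ ≤ K) (ψ : Hilb X V) (s : Finset X) :
    ∑ x ∈ s, ‖∑ y ∈ nb x, k x y (ψ y)‖ ^ 2 ≤ (n * K * ‖ψ‖) ^ 2 := by
  classical
  have h1 : ∀ x ∈ s, ‖∑ y ∈ nb x, k x y (ψ y)‖ ^ 2 ≤ n * K ^ 2 * ∑ y ∈ nb x, ‖ψ y‖ ^ 2 := by
    intro x _
    calc ‖∑ y ∈ nb x, k x y (ψ y)‖ ^ 2 ≤ (∑ y ∈ nb x, K * ‖ψ y‖) ^ 2 := by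
          gcongr
          refine (norm_sum_le _ _).trans (Finset.sum_le_sum fun y _ => ?_)
          exact ((k x y).le_opNorm _).trans
            (mul_le_mul_of_nonneg_right (hk x y) (norm_nonneg _))
      _ ≤ (nb x).card * ∑ y ∈ nb x, (K * ‖ψ y‖) ^ 2 := sq_sum_le_card_mul_sum_sq
      _ ≤ n * ∑ y ∈ nb x, (K * ‖ψ y‖) ^ 2 := by
          gcongr
          exact_mod_cast hcard x
      _ = n * K ^ 2 * ∑ y ∈ nb x, ‖ψ y‖ ^ 2 := by
          rw [mul_assoc, Finset.mul_sum (a := K ^ 2)]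
          simp only [mul_pow]
  have h2 : ∑ x ∈ s, ∑ y ∈ nb x, ‖ψ y‖ ^ 2 ≤ n * ‖ψ‖ ^ 2 := by
    rw [Finset.sum_comm' (t' := s.biUnion nb) (s' := fun y => s.filter fun x => y ∈ nb x)
      (by intro x y; simp only [Finset.mem_biUnion, Finset.mem_filter]; grind)]
    calc ∑ y ∈ s.biUnion nb, ∑ x ∈ s with y ∈ nb x, ‖ψ y‖ ^ 2
        ≤ ∑ y ∈ s.biUnion nb, n * ‖ψ y‖ ^ 2 := by
          refine Finset.sum_le_sum fun y _ => ?_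
          rw [Finset.sum_const, nsmul_eq_mul]
          gcongr
          refine le_trans (Finset.card_le_card fun x hx => ?_) (hcard y)
          exact hsymm x y (Finset.mem_filter.1 hx).2
      _ ≤ n * ‖ψ‖ ^ 2 := by
          rw [← Finset.mul_sum]
          gcongr
          exact sum_sq_norm_le _ ψ
  calc ∑ x ∈ s, ‖∑ y ∈ nb x, k x y (ψ y)‖ ^ 2
      ≤ ∑ x ∈ s, n * K ^ 2 * ∑ y ∈ nb x, ‖ψ y‖ ^ 2 := Finset.sum_le_sum h1
    _ = n * K ^ 2 * ∑ x ∈ s, ∑ y ∈ nb x, ‖ψ y‖ ^ 2 := (Finset.mul_sum _ _ _).symm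
    _ ≤ n * K ^ 2 * (n * ‖ψ‖ ^ 2) := by gcongr
    _ = (n * K * ‖ψ‖) ^ 2 := by ring

/-- Schur test: a bounded kernel with at most `n` entries in every row and column defines a
bounded operator. -/
theorem exists_op_of_kernel (hcard : ∀ x, (nb x).card ≤ n) (hsymm : ∀ x y, y ∈ nb x → x ∈ nb y)
    (hK : 0 ≤ K) (hk : ∀ x y, ‖k x y‖ ≤ K) :
    ∃ A : Hilb X V →L[ℂ] Hilb X V, ‖A‖ ≤ n * K ∧
      ∀ ψ x, A ψ x = ∑ y ∈ nb x, k x y (ψ y) := by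
  have hmem : ∀ ψ : Hilb X V, Memℓp (fun x => ∑ y ∈ nb x, k x y (ψ y)) 2 := fun ψ => by
    refine memℓp_gen' (C := (n * K * ‖ψ‖) ^ 2) fun s => ?_
    have := kernel_sum_le nb n K k hcard hsymm hk ψ s
    simpa using this
  refine ⟨LinearMap.mkContinuous
    { toFun := fun ψ => ⟨fun x => ∑ y ∈ nb x, k x y (ψ y), hmem ψ⟩
      map_add' := fun φ ψ => by
        ext x : 2
        show ∑ y ∈ nb x, k x y ((φ + ψ) y)
          = ∑ y ∈ nb x, k x y (φ y) + ∑ y ∈ nb x, k x y (ψ y)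
        simp only [lp.coeFn_add, Pi.add_apply, map_add, Finset.sum_add_distrib]
      map_smul' := fun c ψ => by
        ext x : 2
        show ∑ y ∈ nb x, k x y ((c • ψ) y) = c • ∑ y ∈ nb x, k x y (ψ y)
        simp only [lp.coeFn_smul, Pi.smul_apply, map_smul, Finset.smul_sum] }
    (n * K) ?_, ?_, ?_⟩
  · intro ψ
    refine lp.norm_le_of_forall_sum_le (E := fun _ : X => V) (p := 2) (by norm_num)
      (by positivity) fun s => ?_
    have := kernel_sum_le nb n K k hcard hsymm hk ψ s
    simpa using this
  · exact LinearMap.mkContinuous_norm_le _ (by positivity) _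
  · intro ψ x; rfl

end Kernels

/-! ### Cells, lattice translations and periodic matrix elements -/

section CrystalGeometry

variable {d N : ℕ}

theorem span_real_eq_top {a b : Fin d → Sp d} (ha : LinearIndependent ℝ a)
    (h : lattice b = lattice a) : Submodule.span ℝ (Set.range b) = ⊤ := by
  have ht : Submodule.span ℝ (Set.range a) = ⊤ :=
    ha.span_eq_top_of_card_eq_finrank' (by simp)
  rw [eq_top_iff, ← ht, Submodule.span_le]
  rintro x ⟨k, rfl⟩
  have : a k ∈ lattice b := h ▸ Submodule.subset_span ⟨k, rfl⟩
  exact Submodule.span_le_restrictScalars ℤ ℝ _ this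

/-- Rounding the real coordinates to the nearest integers gives the lattice vector. Only spanning is
needed, so this serves the second basis as well as the first. -/
theorem exists_sub_mem_cell {X : Set (Sp d)} {b : Fin d → Sp d}
    (hX : ∀ γ ∈ lattice b, ∀ x ∈ X, x + γ ∈ X)
    (hb : Submodule.span ℝ (Set.range b) = ⊤) {x : Sp d} (hx : x ∈ X) :
    ∃ γ ∈ lattice b, x - γ ∈ cell X b 1 := by
  have : x ∈ Submodule.span ℝ (Set.range b) := hb ▸ trivial
  obtain ⟨c, rfl⟩ := (Submodule.mem_span_range_iff_exists_fun ℝ).1 this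
  have hmem : ∑ k, (round (c k)) • b k ∈ lattice b :=
    Submodule.sum_mem _ fun k _ => Submodule.smul_mem _ _ (Submodule.subset_span ⟨k, rfl⟩)
  refine ⟨_, hmem, ?_, fun k => c k - round (c k), ?_, fun k => ?_⟩
  · rw [sub_eq_add_neg]; exact hX _ (neg_mem hmem) _ hx
  · rw [← Finset.sum_sub_distrib]
    refine Finset.sum_congr rfl fun k _ => ?_
    rw [sub_smul, Int.cast_smul_eq_zsmul]
  · simpa using abs_sub_round (c k)

namespace Crystal

variable (C : Crystal d N)

theorem span_a : Submodule.span ℝ (Set.range C.a) = ⊤ := span_real_eq_top C.linInd rfl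

/-- The translation `x ↦ x + γ` of the sites. -/
def shift (γ : lattice C.a) : C.sites ≃ C.sites := (latticeShift C.add_mem γ).symm

@[simp] theorem coe_shift (γ : lattice C.a) (x : C.sites) :
    (C.shift γ x : Sp d) = x + γ := rfl

theorem finite_cell (L : ℕ) : (cell C.sites C.a L).Finite := by
  have hK : IsCompact ((fun α : Fin d → ℝ => ∑ k, α k • C.a k) ''
      Set.Icc (fun _ => -((L : ℝ) / 2)) (fun _ => (L : ℝ) / 2)) :=
    isCompact_Icc.image (by fun_prop)
  refine (C.locFinite _ hK).subset ?_
  rintro x ⟨hx, α, rfl, hα⟩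
  exact ⟨hx, α, ⟨fun k => (abs_le.1 (hα k)).1, fun k => (abs_le.1 (hα k)).2⟩, rfl⟩

/-- The sites of the fundamental cell. -/
def cellSites : Finset C.sites :=
  ((C.finite_cell 1).preimage (Subtype.val_injective.injOn)).toFinset

@[simp] theorem mem_cellSites {x : C.sites} :
    x ∈ C.cellSites ↔ (x : Sp d) ∈ cell C.sites C.a 1 := by
  simp [cellSites]

theorem exists_shift (x : C.sites) : ∃ (c : C.sites) (γ : lattice C.a),
    c ∈ C.cellSites ∧ C.shift γ c = x := by
  obtain ⟨γ, hγ, h⟩ := exists_sub_mem_cell C.add_mem C.span_a x.2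
  refine ⟨⟨x - γ, h.1⟩, ⟨γ, hγ⟩, by simpa using h, ?_⟩
  ext1
  simp

theorem shift_inj {c c' : C.sites} {γ γ' : lattice C.a} (hc : c ∈ C.cellSites)
    (hc' : c' ∈ C.cellSites) (h : C.shift γ c = C.shift γ' c') : γ = γ' ∧ c = c' := by
  rw [mem_cellSites] at hc hc'
  have h' : (c : Sp d) + γ = c' + γ' := congrArg Subtype.val h
  have hγ : γ = γ' := by
    by_contra hne
    refine C.primitive (γ - γ' : Sp d) (sub_mem γ.2 γ'.2) ?_ c hc ?_
    · rw [sub_ne_zero]; exact fun h => hne (Subtype.ext h)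
    · rw [← add_sub_assoc, h', add_sub_cancel_right]; exact hc'
  subst hγ
  exact ⟨rfl, (C.shift γ).injective h⟩

/-- The sites at distance at most `r` from `x`. -/
def nbhd (r : ℝ) (x : C.sites) : Finset C.sites :=
  ((C.locFinite (Metric.closedBall (x : Sp d) r) (isCompact_closedBall _ _)).preimage
    (Subtype.val_injective.injOn)).toFinset

@[simp] theorem mem_nbhd {r : ℝ} {x y : C.sites} :
    y ∈ C.nbhd r x ↔ dist (x : Sp d) y ≤ r := by
  simp [nbhd, dist_comm, Subtype.dist_eq]

theorem dist_shift (γ : lattice C.a) (x y : C.sites) :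
    dist (C.shift γ x : Sp d) (C.shift γ y) = dist (x : Sp d) y := by simp

/-- Lattice translations are isometries of the sites, so the maximum over the finitely many sites of
one cell is a uniform bound. -/
theorem exists_card_nbhd_le (r : ℝ) : ∃ n : ℕ, ∀ x, (C.nbhd r x).card ≤ n := by
  refine ⟨C.cellSites.sup fun c => (C.nbhd r c).card, fun x => ?_⟩
  obtain ⟨c, γ, hc, rfl⟩ := C.exists_shift x
  refine le_trans (Finset.card_le_card_of_injOn (C.shift γ).symm ?_
    (C.shift γ).symm.injective.injOn) (Finset.le_sup (f := fun c => (C.nbhd r c).card) hc)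
  intro y hy
  obtain ⟨z, rfl⟩ := (C.shift γ).surjective y
  simp only [Finset.mem_coe, mem_nbhd, dist_shift, Equiv.symm_apply_apply] at hy ⊢
  exact hy

-- The constant n is fixed before the kernel: it depends on the range alone. The derivative estimate
-- below needs one constant for a whole family of kernels indexed by t.
open scoped Classical in
theorem exists_op_of_kernel (r : ℝ) : ∃ n : ℕ, ∀ (k : C.sites → C.sites → Spin N →L[ℂ] Spin N)
    (K : ℝ), 0 ≤ K → (∀ x y : C.sites, dist (x : Sp d) y ≤ r → ‖k x y‖ ≤ K) →
      ∃ A : C.Op, ‖A‖ ≤ n * K ∧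
        ∀ y v x, A (site y v) x = if dist (x : Sp d) y ≤ r then k x y v else 0 := by
  obtain ⟨n, hn⟩ := C.exists_card_nbhd_le r
  refine ⟨n, fun k K hK hk => ?_⟩
  obtain ⟨A, hA, h⟩ := SCond.exists_op_of_kernel (C.nbhd r) n K
    (fun x y => if dist (x : Sp d) y ≤ r then k x y else 0) hn
    (fun x y h => by simpa [dist_comm] using h) hK (fun x y => by
      split_ifs with h
      · exact hk x y h
      · simpa using hK)
  refine ⟨A, hA, fun y v x => ?_⟩
  rw [h]
  by_cases hxy : dist (x : Sp d) y ≤ r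
  · rw [Finset.sum_eq_single y]
    · rw [site_apply_self]; simp [hxy]
    · intro z _ hz
      rw [site_apply_ne hz, map_zero]
    · intro h'; exact absurd (C.mem_nbhd.2 hxy) h'
  · rw [if_neg hxy]
    refine Finset.sum_eq_zero fun z hz => ?_
    have hz' : z ≠ y := fun e => hxy (e ▸ C.mem_nbhd.1 hz)
    rw [site_apply_ne hz', map_zero]

theorem T_site (γ : lattice C.a) (x : C.sites) (v : Spin N) :
    C.T γ (site x v) = site (C.shift γ x) (C.M γ (C.shift γ x) v) := by
  ext y : 2
  show C.M γ y (site x v (latticeShift C.add_mem γ y)) = _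
  by_cases h : y = C.shift γ x
  · subst h
    rw [site_apply_self, show latticeShift C.add_mem γ (C.shift γ x) = x from
      Equiv.apply_symm_apply _ _, site_apply_self]
  · rw [site_apply_ne h, site_apply_ne, map_zero]
    intro h'
    exact h (by rw [← h']; exact (Equiv.symm_apply_apply _ _).symm)

theorem T_apply_shift (γ : lattice C.a) (x : C.sites) (ψ : C.H) :
    C.T γ ψ (C.shift γ x) = C.M γ (C.shift γ x) (ψ x) := by
  show C.M γ _ (ψ (latticeShift C.add_mem γ (C.shift γ x))) = _
  rw [show latticeShift C.add_mem γ (C.shift γ x) = x from Equiv.apply_symm_apply _ _]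

variable {C}

theorem IsPeriodic.entry_shift {A : C.Op} (hA : C.IsPeriodic A) (γ : lattice C.a)
    (x y : C.sites) (v : Spin N) :
    A (site (C.shift γ y) (C.M γ (C.shift γ y) v)) (C.shift γ x)
      = C.M γ (C.shift γ x) (A (site y v) x) := by
  rw [← T_site, ← T_apply_shift]
  exact congrArg (fun B : C.Op => B (site y v) (C.shift γ x)) (hA γ)

theorem isPeriodic_iff {A : C.Op} : C.IsPeriodic A ↔ ∀ γ x y v,
    A (site (C.shift γ y) (C.M γ (C.shift γ y) v)) (C.shift γ x)
      = C.M γ (C.shift γ x) (A (site y v) x) := by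
  refine ⟨fun h γ x y v => h.entry_shift γ x y v, fun h γ => op_ext fun y v x => ?_⟩
  obtain ⟨x, rfl⟩ := (C.shift γ).surjective x
  show A (C.T γ (site y v)) _ = C.T γ (A (site y v)) _
  rw [T_site, T_apply_shift, h]

end Crystal

end CrystalGeometry

end

end SCond

namespace SCond
noncomputable section

/-! ### Calculus of differentiability under conjugation -/

section OneParameter

variable {R : Type*} [NormedRing R] [NormedAlgebra ℂ R]

/-- A curve of units `u t` with `(u t)⁻¹ = u (-t)`. -/
structure IsUnitCurve (u : ℝ → R) : Prop where
  zero : u 0 = 1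
  mul_neg : ∀ t, u t * u (-t) = 1

omit [NormedAlgebra ℂ R] in
theorem IsUnitCurve.neg_mul {u : ℝ → R} (hu : IsUnitCurve u) (t : ℝ) : u (-t) * u t = 1 := by
  simpa using hu.mul_neg (-t)

/-- `B` is the derivative at `t = 0` of `u t A (u t)⁻¹`. -/
def HasDer (u : ℝ → R) (A B : R) : Prop :=
  HasDerivAt (fun t : ℝ => u t * A * u (-t)) B 0

variable {u : ℝ → R} {A B A' B' : R}

theorem HasDer.unique (h : HasDer u A B) (h' : HasDer u A B') : B = B' :=
  HasDerivAt.unique h h'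

theorem HasDer.congr (h : HasDer u A A') (hB : A' = B') : HasDer u A B' := hB ▸ h

theorem HasDer.add (hA : HasDer u A A') (hB : HasDer u B B') : HasDer u (A + B) (A' + B') := by
  have := HasDerivAt.add hA hB
  refine this.congr_of_eventuallyEq (Filter.Eventually.of_forall fun t => ?_)
  simp only [Pi.add_apply, mul_add, add_mul]

theorem HasDer.smul (c : ℂ) (hA : HasDer u A A') : HasDer u (c • A) (c • A') := by
  have := HasDerivAt.const_smul c hA
  refine this.congr_of_eventuallyEq (Filter.Eventually.of_forall fun t => ?_)
  simp only [Pi.smul_apply, mul_smul_comm, smul_mul_assoc]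

theorem HasDer.neg (hA : HasDer u A A') : HasDer u (-A) (-A') := by
  simpa using hA.smul (-1)

theorem HasDer.sub (hA : HasDer u A A') (hB : HasDer u B B') : HasDer u (A - B) (A' - B') := by
  simpa [sub_eq_add_neg] using hA.add hB.neg

theorem HasDer.mul (hu : IsUnitCurve u) (hA : HasDer u A A') (hB : HasDer u B B') :
    HasDer u (A * B) (A' * B + A * B') := by
  have := HasDerivAt.mul hA hB
  simp only [neg_zero, hu.zero, one_mul, mul_one] at this
  refine this.congr_of_eventuallyEq (Filter.Eventually.of_forall fun t => ?_)
  calc u t * (A * B) * u (-t) = u t * A * (u (-t) * u t) * B * u (-t) := by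
        rw [hu.neg_mul]; noncomm_ring
    _ = _ := by simp only [Pi.mul_apply]; noncomm_ring

theorem HasDer.of_commute (hu : IsUnitCurve u) (hA : ∀ t, u t * A = A * u t) : HasDer u A 0 := by
  have : (fun t : ℝ => u t * A * u (-t)) = fun _ => A := funext fun t => by
    rw [hA, mul_assoc, hu.mul_neg, mul_one]
  rw [HasDer, this]
  exact hasDerivAt_const _ _

/-- A bounded linear map that intertwines the two conjugations carries derivatives along. This is
used to enter the algebra of functions on the contour through the constants, and to leave it by
integration. -/
theorem HasDer.map {S : Type*} [NormedRing S] [NormedAlgebra ℂ S] {v : ℝ → S}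
    (L : R →L[ℂ] S) (hL : ∀ t a, L (u t * a * u (-t)) = v t * L a * v (-t))
    (hA : HasDer u A A') : HasDer v (L A) (L A') := by
  have h : HasDerivAt (fun t : ℝ => (L.restrictScalars ℝ) (u t * A * u (-t)))
      ((L.restrictScalars ℝ) A') 0 :=
    (L.restrictScalars ℝ).hasFDerivAt.comp_hasDerivAt 0 hA
  refine h.congr_of_eventuallyEq (Filter.Eventually.of_forall fun t => ?_)
  exact (hL t A).symm

omit [NormedAlgebra ℂ R] in
theorem IsUnitCurve.conj_ringInverse (hu : IsUnitCurve u) (hA : IsUnit A) (t : ℝ) :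
    u t * Ring.inverse A * u (-t) = Ring.inverse (u t * A * u (-t)) := by
  obtain ⟨a, rfl⟩ := hA
  let w : Rˣ := ⟨u t, u (-t), hu.mul_neg t, hu.neg_mul t⟩
  have h1 : u t * (a : R) * u (-t) = ((w * a * w⁻¹ : Rˣ) : R) := rfl
  rw [h1, Ring.inverse_unit, Ring.inverse_unit, mul_inv_rev, mul_inv_rev, inv_inv, ← mul_assoc]
  rfl

variable [CompleteSpace R]

/-- Conjugation passes inside the inverse, so this is the chain rule with the Fréchet derivative of
inversion at a unit. -/
theorem HasDer.ringInverse (hu : IsUnitCurve u) (hA : HasDer u A A') (hA' : IsUnit A) :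
    HasDer u (Ring.inverse A) (-(Ring.inverse A * A' * Ring.inverse A)) := by
  obtain ⟨a, rfl⟩ := hA'
  have h0 : u 0 * (a : R) * u (-0) = a := by simp [hu.zero]
  have h1 := hasFDerivAt_ringInverse (𝕜 := ℝ) a
  rw [← h0] at h1
  have := h1.comp_hasDerivAt (0 : ℝ) hA
  have h2 : HasDer u (Ring.inverse (a : R)) _ :=
    this.congr_of_eventuallyEq (Filter.Eventually.of_forall fun t =>
      hu.conj_ringInverse a.isUnit t)
  exact h2.congr (by simp)

theorem IsUnitCurve.conj_exp (hu : IsUnitCurve u) (t : ℝ) :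
    u t * NormedSpace.exp A * u (-t) = NormedSpace.exp (u t * A * u (-t)) := by
  let w : Rˣ := ⟨u t, u (-t), hu.mul_neg t, hu.neg_mul t⟩
  let _ : NormedAlgebra ℚ R := NormedAlgebra.restrictScalars ℚ ℂ R
  exact (NormedSpace.exp_units_conj w A).symm

/-- Existence suffices: for Π^ε the derivative is needed only to preserve the domain of X_i, and its
value never enters. -/
theorem HasDer.exp (hu : IsUnitCurve u) (hA : HasDer u A A') :
    ∃ B, HasDer u (NormedSpace.exp A) B := by
  have h1 : DifferentiableAt ℝ (NormedSpace.exp : R → R) (u 0 * A * u (-0)) :=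
    (NormedSpace.exp_analytic (𝕂 := ℝ) _).differentiableAt
  have := (h1.comp (0 : ℝ) hA.differentiableAt).hasDerivAt
  refine ⟨_, this.congr_of_eventuallyEq (Filter.Eventually.of_forall fun t => ?_)⟩
  exact hu.conj_exp t

end OneParameter

/-! ### The unitary group generated by a position operator -/

section Phase

variable {d : ℕ} {X : Set (Sp d)} {V : Type} [NormedAddCommGroup V] [InnerProductSpace ℂ V]

theorem norm_phase_le (j : Fin d) (t : ℝ) (x : X) :
    ‖Complex.exp (t * co j x * Complex.I) • (1 : V →L[ℂ] V)‖ ≤ 1 := by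
  rw [norm_smul, ← Complex.ofReal_mul, Complex.norm_exp_ofReal_mul_I, one_mul]
  exact ContinuousLinearMap.norm_id_le

/-- Multiplication by `e^{i t x_j}`. -/
def phase (j : Fin d) (t : ℝ) : Hilb X V →L[ℂ] Hilb X V :=
  wcomp (Equiv.refl X) (fun x => Complex.exp (t * co j x * Complex.I) • 1) 1 (norm_phase_le j t)

@[simp] theorem phase_apply (j : Fin d) (t : ℝ) (ψ : Hilb X V) (x : X) :
    phase j t ψ x = Complex.exp (t * co j x * Complex.I) • ψ x := rfl

theorem phase_site (j : Fin d) (t : ℝ) (x : X) (v : V) :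
    phase j t (site x v) = Complex.exp (t * co j x * Complex.I) • site x v := by
  ext y : 2
  rw [phase_apply, lp.coeFn_smul, Pi.smul_apply]
  by_cases h : y = x
  · subst h; rfl
  · simp only [site_apply_ne h, smul_zero]

theorem isUnitCurve_phase (j : Fin d) :
    IsUnitCurve (phase j : ℝ → Hilb X V →L[ℂ] Hilb X V) where
  zero := by
    ext ψ x : 3
    simp
  mul_neg t := by
    ext ψ x : 3
    show Complex.exp _ • Complex.exp _ • ψ x = ψ x
    rw [smul_smul, ← Complex.exp_add]
    simp

theorem conj_phase_site (j : Fin d) (t : ℝ) (A : Hilb X V →L[ℂ] Hilb X V) (y : X) (v : V)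
    (x : X) : (phase j t * A * phase j (-t) : Hilb X V →L[ℂ] Hilb X V) (site y v) x
      = Complex.exp (t * ((co j x - co j y) * Complex.I)) • A (site y v) x := by
  show phase j t (A (phase j (-t) (site y v))) x = _
  rw [phase_apply, phase_site, map_smul, lp.coeFn_smul, Pi.smul_apply, smul_smul,
    ← Complex.exp_add]
  congr 2
  push_cast
  ring

/-- Conjugation multiplies A(x, y) by e^{it(x_j - y_j)}, whose derivative at 0 is i(x_j - y_j). The
further factor i turns this into y_j - x_j, the sign of [A, X_j]. -/
theorem HasDer.kerDer {j : Fin d} {A B : Hilb X V →L[ℂ] Hilb X V}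
    (h : HasDer (phase j) A B) : KerDer j A (Complex.I • B) := by
  intro y v x
  have h1 : HasDerivAt (fun t : ℝ =>
      (phase j t * A * phase j (-t) : Hilb X V →L[ℂ] Hilb X V) (site y v) x)
      (B (site y v) x) 0 :=
    (((ev x).comp (ContinuousLinearMap.apply ℂ (Hilb X V) (site y v))).restrictScalars
      ℝ).hasFDerivAt.comp_hasDerivAt 0 h
  have h2 : HasDerivAt
      (fun t : ℝ => Complex.exp (t * ((co j x - co j y) * Complex.I)) • A (site y v) x)
      (((co j x - co j y) * Complex.I) • A (site y v) x) 0 := by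
    have h3 : HasDerivAt (fun t : ℝ => Complex.exp (t * ((co j x - co j y) * Complex.I)))
        ((co j x - co j y) * Complex.I) 0 := by
      have := ((Complex.ofRealCLM.hasDerivAt (x := (0 : ℝ))).mul_const
        ((co j x - co j y) * Complex.I)).cexp
      simpa using this
    exact h3.smul_const _
  simp only [conj_phase_site] at h1
  rw [show (Complex.I • B) (site y v) x = Complex.I • B (site y v) x from rfl, h1.unique h2,
    smul_smul]
  congr 1
  linear_combination (co j x - co j y) * Complex.I_sq

end Phase

/-! ### Finite-range operators are differentiable -/

section FiniteRange

variable {d N : ℕ} {C : Crystal d N}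

theorem entry_eq_zero {A : C.Op} {r : ℝ}
    (hA : ∀ x y : C.sites, r < dist (x : Sp d) y → ∀ v : Spin N, A (site y v) x = 0)
    {x y : C.sites} (h : ¬ dist (x : Sp d) y ≤ r) (v : Spin N) : A (site y v) x = 0 :=
  hA x y (not_le.1 h) v

theorem abs_coord_sub_le (j : Fin d) (x y : C.sites) :
    ‖co j x - co j y‖ ≤ dist (x : Sp d) y := by
  rw [← Complex.ofReal_sub, Complex.norm_real, dist_eq_norm]
  exact PiLp.norm_apply_le ((x : Sp d) - (y : Sp d)) j

/-- Operators with finite range are smooth along the group generated by `X_j`, and the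
derivative has finite range. -/
theorem Crystal.HasFiniteRange.exists_hasDer {A : C.Op} (hA : C.HasFiniteRange A) (j : Fin d) :
    ∃ B : C.Op, C.HasFiniteRange B ∧ HasDer (phase j) A B := by
  classical
  obtain ⟨r, hr⟩ := hA
  obtain ⟨n, hn⟩ := C.exists_op_of_kernel r
  have hA0 := norm_nonneg A
  obtain ⟨B, -, hB⟩ := hn (fun x y => ((co j x - co j y) * Complex.I) • entry A x y)
    (|r| * ‖A‖) (by positivity) (fun x y h => by
      rw [norm_smul, norm_mul, Complex.norm_I, mul_one]
      gcongr
      · exact ((abs_coord_sub_le j x y).trans h).trans (le_abs_self r)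
      · exact norm_entry_le A x y)
  refine ⟨B, ⟨r, fun x y h v => by rw [hB, if_neg h.not_ge]⟩, ?_⟩
  refine hasDerivAt_iff_isLittleO_nhds_zero.2 ?_
  -- The remainder is again a kernel of range r, with entries controlled by |e^w - 1 - w| ≤ |w|² for
  -- |w| ≤ 1. The Schur constant n does not depend on t, so the operator norm is of order t².
  have key : ∀ t : ℝ, |t| * |r| ≤ 1 →
      ‖phase j t * A * phase j (-t) - A - t • B‖ ≤ n * ((|t| * |r|) ^ 2 * ‖A‖) := by
    intro t ht
    obtain ⟨D, hD, hD'⟩ := hn (fun x y =>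
      (Complex.exp (t * ((co j x - co j y) * Complex.I)) - 1
        - t * ((co j x - co j y) * Complex.I)) • entry A x y)
      ((|t| * |r|) ^ 2 * ‖A‖) (by positivity) (fun x y h => by
        have h1 : ‖(t : ℂ) * ((co j x - co j y) * Complex.I)‖ ≤ |t| * |r| := by
          rw [norm_mul, norm_mul, Complex.norm_I, mul_one, Complex.norm_real, Real.norm_eq_abs]
          gcongr
          exact ((abs_coord_sub_le j x y).trans h).trans (le_abs_self r)
        rw [norm_smul]
        gcongr
        · exact (Complex.norm_exp_sub_one_sub_id_le (h1.trans ht)).trans (by gcongr)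
        · exact norm_entry_le A x y)
    convert hD using 2
    refine op_ext fun y v x => ?_
    rw [hD']
    show (phase j t * A * phase j (-t) : C.Op) (site y v) x - A (site y v) x
      - (t : ℂ) • B (site y v) x = _
    rw [hB, conj_phase_site]
    split_ifs with h
    · have hs : ∀ c : ℂ, (c • entry A x y) v = c • A (site y v) x := fun _ => rfl
      rw [hs, hs]
      simp only [sub_smul, one_smul, smul_smul]
    · simp [entry_eq_zero hr h]
  have h1 : (fun h : ℝ => phase j (0 + h) * A * phase j (-(0 + h))
      - phase j 0 * A * phase j (-0) - h • B) =O[nhds 0] fun h : ℝ => h ^ 2 := by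
    refine Asymptotics.IsBigO.of_bound (n * (|r| ^ 2 * ‖A‖)) ?_
    have : ∀ᶠ t : ℝ in nhds 0, |t| * |r| < 1 := by
      have : Filter.Tendsto (fun t : ℝ => |t| * |r|) (nhds 0) (nhds (|0| * |r|)) :=
        (Continuous.tendsto (by fun_prop) 0)
      refine this.eventually_lt_const (by simp)
    filter_upwards [this] with t ht
    have := key t ht.le
    simp only [zero_add, neg_zero, (isUnitCurve_phase (X := C.sites) (V := Spin N) j).zero,
      one_mul, mul_one]
    refine this.trans (le_of_eq ?_)
    rw [norm_pow, Real.norm_eq_abs]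
    ring
  exact h1.trans_isLittleO (by
    simpa using Asymptotics.isLittleO_pow_id (𝕜 := ℝ) (n := 2) one_lt_two)

/-- X_j is not periodic, but only the difference y_j - x_j enters, and a common translation leaves
it unchanged. -/
theorem KerDer.isPeriodic {j : Fin d} {A B : C.Op} (h : KerDer j A B) (hA : C.IsPeriodic A) :
    C.IsPeriodic B := by
  rw [Crystal.isPeriodic_iff]
  intro γ x y v
  rw [h, h, hA.entry_shift, map_smul]
  congr 1
  simp [co]

end FiniteRange

end

end SCond

namespace SCond
noncomputable section

open Complex (I)

/-! ### Contour integrals of resolvents -/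

section ContourIntegral

/-- The parameter interval of a closed contour. -/
abbrev Ang : Type := Set.Icc (0 : ℝ) (2 * Real.pi)

theorem zero_le_two_pi : (0 : ℝ) ≤ 2 * Real.pi := by positivity

variable {E F : Type*} [NormedAddCommGroup E] [NormedSpace ℂ E]
  [NormedAddCommGroup F] [NormedSpace ℂ F]

/-- The integrand of a contour integral over a circle of radius `r`. -/
def contourFun (r : ℝ) (f : C(Ang, E)) (θ : ℝ) : E :=
  (circleMap 0 r θ * I) • f (Set.projIcc 0 (2 * Real.pi) zero_le_two_pi θ)

theorem continuous_contourFun (r : ℝ) (f : C(Ang, E)) : Continuous (contourFun r f) :=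
  ((continuous_circleMap 0 r).mul continuous_const).smul (f.continuous.comp continuous_projIcc)

theorem intervalIntegrable_contourFun (r : ℝ) (f : C(Ang, E)) (a b : ℝ) :
    IntervalIntegrable (contourFun r f) MeasureTheory.volume a b :=
  (continuous_contourFun r f).intervalIntegrable _ _

/-- `(i/2π) ∮ f(z) dz` over a circle of radius `r`, for a function `f` of the angle. -/
def contourInt (E : Type*) [NormedAddCommGroup E] [NormedSpace ℂ E] (r : ℝ) :
    C(Ang, E) →L[ℂ] E :=
  LinearMap.mkContinuous
    { toFun := fun f => (I / (2 * Real.pi)) • ∫ θ in 0..2 * Real.pi, contourFun r f θ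
      map_add' := fun f g => by
        rw [← smul_add, ← intervalIntegral.integral_add (intervalIntegrable_contourFun r f 0 _)
          (intervalIntegrable_contourFun r g 0 _)]
        simp only [contourFun, ContinuousMap.add_apply, smul_add]
      map_smul' := fun c f => by
        have h : ∀ θ, contourFun r (c • f) θ = c • contourFun r f θ := fun θ => by
          simp only [contourFun, ContinuousMap.smul_apply, smul_comm c]
        simp only [h]
        rw [intervalIntegral.integral_smul, smul_comm, RingHom.id_apply] }
    (‖I / (2 * Real.pi)‖ * (|r| * |2 * Real.pi - 0|)) (fun f => by
      show ‖(I / (2 * Real.pi) : ℂ) • ∫ θ in 0..2 * Real.pi, contourFun r f θ‖ ≤ _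
      rw [norm_smul, mul_assoc]
      gcongr
      rw [show |r| * |2 * Real.pi - 0| * ‖f‖ = (|r| * ‖f‖) * |2 * Real.pi - 0| by ring]
      refine intervalIntegral.norm_integral_le_of_norm_le_const fun θ _ => ?_
      rw [contourFun, norm_smul, norm_mul, norm_circleMap_zero, Complex.norm_I, mul_one]
      gcongr
      exact f.norm_coe_le_norm _)

theorem contourInt_apply (r : ℝ) (f : C(Ang, E)) :
    contourInt E r f = (I / (2 * Real.pi)) • ∫ θ in 0..2 * Real.pi, contourFun r f θ := rfl

theorem contourInt_eq_circleIntegral (c : ℂ) (r : ℝ) (f : C(Ang, E)) (g : ℂ → E)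
    (h : ∀ θ : Ang, f θ = g (circleMap c r θ)) :
    contourInt E r f = (I / (2 * Real.pi)) • circleIntegral g c r := by
  rw [contourInt_apply, circleIntegral]
  congr 1
  refine intervalIntegral.integral_congr fun θ hθ => ?_
  rw [Set.uIcc_of_le zero_le_two_pi] at hθ
  simp only [contourFun, deriv_circleMap, Set.projIcc_of_mem zero_le_two_pi hθ, h]

theorem map_contourInt [CompleteSpace E] [CompleteSpace F] (L : E →L[ℂ] F) (r : ℝ)
    (f : C(Ang, E)) (g : C(Ang, F)) (h : ∀ θ, g θ = L (f θ)) :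
    L (contourInt E r f) = contourInt F r g := by
  rw [contourInt_apply, contourInt_apply, map_smul]
  congr 1
  rw [← L.intervalIntegral_comp_comm (intervalIntegrable_contourFun r f 0 _)]
  simp only [contourFun, map_smul, h]

variable {R : Type*} [NormedRing R] [NormedAlgebra ℂ R] [CompleteSpace R]

/-- The constant function on the contour. -/
abbrev cst (a : R) : C(Ang, R) := ContinuousLinearMap.const ℂ Ang a

omit [CompleteSpace R] in
theorem cst_sub (a b : R) : cst (a - b) = cst a - cst b := rfl

omit [CompleteSpace R] in
theorem cst_smul (c : ℂ) (a : R) : cst (c • a) = c • cst a := rfl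

theorem mul_contourInt (a : R) (r : ℝ) (f : C(Ang, R)) :
    a * contourInt R r f = contourInt R r (cst a * f) :=
  map_contourInt (ContinuousLinearMap.mul ℂ R a) r f _ fun _ => rfl

theorem contourInt_mul (a : R) (r : ℝ) (f : C(Ang, R)) :
    contourInt R r f * a = contourInt R r (f * cst a) :=
  map_contourInt ((ContinuousLinearMap.mul ℂ R).flip a) r f _ fun _ => rfl

/-- The function `θ ↦ A - z(θ)`. -/
def pencil (A : R) (z : C(Ang, ℂ)) : C(Ang, R) where
  toFun θ := A - z θ • (1 : R)
  continuous_toFun := by fun_prop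

/-- The resolvent `θ ↦ (A - z(θ))⁻¹`. -/
def res (A : R) (z : C(Ang, ℂ)) : C(Ang, R) := Ring.inverse (pencil A z)

/-- The contour `z` avoids the spectrum of `A`. -/
def Avoids (A : R) (z : C(Ang, ℂ)) : Prop := ∀ θ, IsUnit (A - z θ • (1 : R))

variable {A : R} {z : C(Ang, ℂ)}

theorem Avoids.isUnit (h : Avoids A z) : IsUnit (pencil A z) :=
  (ContinuousMap.isUnit_iff_forall_isUnit _).2 h

theorem Avoids.res_apply (h : Avoids A z) (θ : Ang) :
    res A z θ = Ring.inverse (A - z θ • (1 : R)) := by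
  refine (Ring.inverse_eq_of_isUnit_mul (h θ) ?_).symm
  exact congrArg (fun f : C(Ang, R) => f θ) (Ring.mul_inverse_cancel _ h.isUnit)
where
  Ring.inverse_eq_of_isUnit_mul {a b : R} (ha : IsUnit a) (hab : a * b = 1) :
      Ring.inverse a = b := by
    obtain ⟨a, rfl⟩ := ha
    rw [Ring.inverse_unit, Units.inv_eq_of_mul_eq_one_right hab]

theorem Avoids.commute_res (h : Avoids A z) {b : R} (hb : Commute b A) :
    Commute (cst b) (res A z) := by
  have h1 : Commute (cst b) (pencil A z) := by
    ext θ
    show b * (A - z θ • (1 : R)) = (A - z θ • (1 : R)) * b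
    rw [mul_sub, sub_mul, hb.eq, mul_smul_comm, smul_mul_assoc, mul_one, one_mul]
  rw [res]
  obtain ⟨w, hw⟩ := h.isUnit
  rw [← hw, Ring.inverse_unit]
  rw [← hw] at h1
  exact h1.units_inv_right

theorem Avoids.commute_contourInt_res (h : Avoids A z) {b : R} (hb : Commute b A) (r : ℝ) :
    Commute b (contourInt R r (res A z)) := by
  rw [Commute, SemiconjBy, mul_contourInt, contourInt_mul, (h.commute_res hb).eq]

/-- The map `B ↦ (i/2π) ∮ (A - z)⁻¹ B (A - z)⁻¹ dz`. -/
def sandwich (A : R) (z : C(Ang, ℂ)) (r : ℝ) (B : R) : R :=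
  contourInt R r (res A z * cst B * res A z)

omit [CompleteSpace R] in
theorem sandwich_sub (r : ℝ) (B B' : R) :
    sandwich A z r (B - B') = sandwich A z r B - sandwich A z r B' := by
  rw [sandwich, sandwich, sandwich, ← map_sub, cst_sub, mul_sub, sub_mul]

omit [CompleteSpace R] in
theorem sandwich_smul (r : ℝ) (c : ℂ) (B : R) :
    sandwich A z r (c • B) = c • sandwich A z r B := by
  rw [sandwich, sandwich, ← map_smul, cst_smul,
    mul_smul_comm, smul_mul_assoc]

/-- Whatever commutes with A passes through the resolvents. Taking b to be a translation, the
rotation or Π₀ gives periodicity, rotation covariance and the algebra of Π₁. -/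
theorem Avoids.mul_sandwich (h : Avoids A z) {b : R} (hb : Commute b A) (r : ℝ) (B : R) :
    b * sandwich A z r B = sandwich A z r (b * B) := by
  rw [sandwich, sandwich, mul_contourInt]
  congr 1
  rw [← mul_assoc, ← mul_assoc, (h.commute_res hb).eq, mul_assoc (res A z)]
  rfl

theorem Avoids.sandwich_mul (h : Avoids A z) {b : R} (hb : Commute b A) (r : ℝ) (B : R) :
    sandwich A z r B * b = sandwich A z r (B * b) := by
  rw [sandwich, sandwich, contourInt_mul]
  congr 1
  rw [mul_assoc, ← (h.commute_res hb).eq, ← mul_assoc, mul_assoc (res A z)]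
  rfl

variable {u : ℝ → R} {A' B B' : R}

omit [CompleteSpace R] in
theorem IsUnitCurve.const (hu : IsUnitCurve u) : IsUnitCurve fun t => cst (u t) where
  zero := by rw [hu.zero]; rfl
  mul_neg t := by
    ext θ
    exact hu.mul_neg t

omit [CompleteSpace R] in
theorem HasDer.const (hA : HasDer u A A') : HasDer (fun t => cst (u t)) (cst A) (cst A') :=
  HasDer.map (v := fun t => SCond.cst (u t)) (ContinuousLinearMap.const ℂ Ang)
    (fun _ _ => by ext θ; rfl) hA

/-- The whole resolvent along the contour is a single inverse in the Banach algebra of continuous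
functions of the angle. Differentiability there is uniform in the angle, so it can be integrated
without further estimates. -/
theorem HasDer.resolvent (hu : IsUnitCurve u) (h : Avoids A z) (hA : HasDer u A A') :
    HasDer (fun t => cst (u t)) (res A z) (-(res A z * cst A' * res A z)) := by
  have h1 : HasDer (fun t => cst (u t)) (pencil A z) (cst A') := by
    let Z : C(Ang, R) := ⟨fun θ => z θ • (1 : R), by fun_prop⟩
    have hZ : HasDer (fun t => cst (u t)) Z 0 := .of_commute hu.const fun t => by
      ext θ
      show u t * (z θ • (1 : R)) = (z θ • (1 : R)) * u t
      rw [mul_smul_comm, smul_mul_assoc, one_mul, mul_one]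
    have := hA.const.sub hZ
    rwa [sub_zero] at this
  exact h1.ringInverse hu.const h.isUnit

theorem HasDer.integral {f f' : C(Ang, R)} (hf : HasDer (fun t => cst (u t)) f f')
    (r : ℝ) : HasDer u (contourInt R r f) (contourInt R r f') :=
  hf.map (contourInt R r) fun t f => by rw [mul_contourInt, contourInt_mul]

theorem HasDer.exists_sandwich (hu : IsUnitCurve u) (h : Avoids A z) (hA : HasDer u A A')
    (hB : HasDer u B B') (r : ℝ) : ∃ D, HasDer u (sandwich A z r B) D :=
  ⟨_, (((hA.resolvent hu h).mul hu.const hB.const).mul hu.const (hA.resolvent hu h)).integral r⟩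

theorem HasDer.integral_resolvent (hu : IsUnitCurve u) (h : Avoids A z) (hA : HasDer u A A')
    (r : ℝ) : HasDer u (contourInt R r (res A z)) (-sandwich A z r A') := by
  have := (hA.resolvent hu h).integral r
  rwa [map_neg] at this

end ContourIntegral

/-! ### The spectral projection as a Riesz integral -/

section Riesz

variable {H : Type} [NormedAddCommGroup H] [InnerProductSpace ℂ H] [CompleteSpace H]

/-- The circle which crosses the real axis at `b` and `μ`. -/
def circ (b μ : ℝ) : C(Ang, ℂ) where
  toFun θ := circleMap (((b + μ) / 2 : ℝ) : ℂ) ((μ - b) / 2) θ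
  continuous_toFun := (continuous_circleMap _ _).comp continuous_subtype_val

theorem circ_eq_of_im_eq_zero {b μ : ℝ} (θ : ℝ)
    (h : (circleMap (((b + μ) / 2 : ℝ) : ℂ) ((μ - b) / 2) θ).im = 0) :
    circleMap (((b + μ) / 2 : ℝ) : ℂ) ((μ - b) / 2) θ = b ∨
      circleMap (((b + μ) / 2 : ℝ) : ℂ) ((μ - b) / 2) θ = μ := by
  set w := circleMap (((b + μ) / 2 : ℝ) : ℂ) ((μ - b) / 2) θ with hw
  have h1 : ‖w - (((b + μ) / 2 : ℝ) : ℂ)‖ = |(μ - b) / 2| := by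
    have := circleMap_mem_sphere' (((b + μ) / 2 : ℝ) : ℂ) ((μ - b) / 2) θ
    rwa [mem_sphere_iff_norm] at this
  have h2 : w = ((w.re : ℝ) : ℂ) := Complex.ext rfl (by simpa using h)
  rw [h2, ← Complex.ofReal_sub, Complex.norm_real, Real.norm_eq_abs] at h1
  rw [h2]
  rcases abs_eq_abs.1 h1 with h1 | h1
  · right; congr 1; linarith
  · left; congr 1; linarith

variable {A : H →L[ℂ] H} {μ b : ℝ}

theorem norm_le_of_mem_spectrum {z : ℂ} (hz : z ∈ spectrum ℂ A) : ‖z‖ ≤ ‖A‖ := by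
  refine (spectrum.norm_le_norm_mul_of_mem hz).trans ?_
  have : ‖(1 : H →L[ℂ] H)‖ ≤ 1 := ContinuousLinearMap.norm_id_le
  nlinarith [norm_nonneg A]

omit [CompleteSpace H] in
theorem isUnit_sub_smul_one {z : ℂ} (hz : z ∉ spectrum ℂ A) : IsUnit (A - z • 1) := by
  rw [spectrum.notMem_iff, Algebra.algebraMap_eq_smul_one] at hz
  simpa using hz.neg

/-- The spectrum is real and the circle meets the real axis only at μ, which is in the gap, and at
b, which lies below -‖A‖. -/
theorem circ_notMem_spectrum (hA : IsSelfAdjoint A) (hμ : (μ : ℂ) ∉ spectrum ℂ A)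
    (hb : b < -‖A‖) (θ : ℝ) :
    circleMap (((b + μ) / 2 : ℝ) : ℂ) ((μ - b) / 2) θ ∉ spectrum ℂ A := by
  intro h
  have h0 := hA.mem_spectrum_eq_re h
  rcases circ_eq_of_im_eq_zero θ (by rw [h0]; simp) with h1 | h1
  · rw [h1] at h
    have := norm_le_of_mem_spectrum h
    rw [Complex.norm_real, Real.norm_eq_abs] at this
    have := abs_le.1 this
    linarith
  · exact hμ (h1 ▸ h)

theorem avoids_circ (hA : IsSelfAdjoint A) (hμ : (μ : ℂ) ∉ spectrum ℂ A) (hb : b < -‖A‖) :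
    Avoids A (circ b μ) := fun θ => isUnit_sub_smul_one (circ_notMem_spectrum hA hμ hb θ)

omit [CompleteSpace H] in
theorem continuousOn_spectrum_step (hμ : (μ : ℂ) ∉ spectrum ℂ A) :
    ContinuousOn (fun e : ℝ => if e < μ then (1 : ℝ) else 0) (spectrum ℝ A) := by
  intro e he
  have hne : e ≠ μ := by
    rintro rfl
    exact hμ ((spectrum.algebraMap_mem_iff ℂ).2 he)
  refine ContinuousAt.continuousWithinAt ?_
  rcases lt_or_gt_of_ne hne with h | h
  · refine (continuousAt_const (y := (1 : ℝ))).congr ?_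
    filter_upwards [eventually_lt_nhds h] with x hx
    rw [if_pos hx]
  · refine (continuousAt_const (y := (0 : ℝ))).congr ?_
    filter_upwards [eventually_gt_nhds h] with x hx
    rw [if_neg hx.not_gt]

theorem spectralProj_mul_self (hμ : (μ : ℂ) ∉ spectrum ℂ A) :
    spectralProj A μ * spectralProj A μ = spectralProj A μ := by
  classical
  have hc := continuousOn_spectrum_step hμ
  have h : spectralProj A μ = cfc (fun e : ℝ => if e < μ then (1 : ℝ) else 0) A := by
    rw [spectralProj]
  rw [h, ← cfc_mul _ _ A hc hc]
  congr 1
  ext e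
  split_ifs <;> simp

theorem isSelfAdjoint_spectralProj : IsSelfAdjoint (spectralProj A μ) := by
  rw [spectralProj]
  exact cfc_predicate _ A

/-- For e inside the circle, the sign in (e - z)⁻¹ = -(z - e)⁻¹ makes the integral -2πi, and i/2π
normalizes it to 1. For e > μ the integrand is holomorphic on the closed disc. -/
theorem contour_indicator {e : ℝ} (hb : b < μ) (hbe : b < e) (he : e ≠ μ) :
    (I / (2 * Real.pi)) * (∮ z in C((((b + μ) / 2 : ℝ) : ℂ), ((μ - b) / 2)), ((e : ℂ) - z)⁻¹)
      = if e < μ then 1 else 0 := by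
  have h0 : (∮ z in C((((b + μ) / 2 : ℝ) : ℂ), ((μ - b) / 2)), ((e : ℂ) - z)⁻¹)
      = -(∮ z in C((((b + μ) / 2 : ℝ) : ℂ), ((μ - b) / 2)), (z - e)⁻¹) := by
    rw [circleIntegral, circleIntegral, ← intervalIntegral.integral_neg]
    congr 1
    ext θ
    rw [← smul_neg, ← inv_neg, neg_sub]
  rw [h0]
  split_ifs with h
  · rw [circleIntegral.integral_sub_inv_of_mem_ball]
    · have : (Real.pi : ℂ) ≠ 0 := by exact_mod_cast Real.pi_ne_zero
      field_simp
      simp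
    · rw [mem_ball_iff_norm, ← Complex.ofReal_sub, Complex.norm_real, Real.norm_eq_abs, abs_lt]
      constructor <;> linarith
  · have hlt : μ < e := lt_of_le_of_ne (not_lt.1 h) he.symm
    rw [DiffContOnCl.circleIntegral_eq_zero (by linarith), neg_zero, mul_zero]
    refine DifferentiableOn.diffContOnCl fun z hz => ?_
    refine DifferentiableAt.differentiableWithinAt ?_
    refine ((differentiableAt_id).sub_const _).inv ?_
    rw [closure_ball _ (by linarith), mem_closedBall_iff_norm] at hz
    intro hze
    have : z = e := sub_eq_zero.1 hze
    rw [this, ← Complex.ofReal_sub, Complex.norm_real, Real.norm_eq_abs] at hz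
    have := (abs_le.1 hz).2
    linarith

/-- The spectral projection below a gap as a Riesz projection. -/
theorem spectralProj_eq_contourInt (hA : IsSelfAdjoint A) (hμ : (μ : ℂ) ∉ spectrum ℂ A)
    (hb : b < -‖A‖) (hbμ : b < μ) :
    spectralProj A μ = contourInt (H →L[ℂ] H) ((μ - b) / 2) (res A (circ b μ)) := by
  classical
  have hav := avoids_circ hA hμ hb
  rw [contourInt_eq_circleIntegral (((b + μ) / 2 : ℝ) : ℂ) ((μ - b) / 2) _
    (fun z => Ring.inverse (A - z • (1 : H →L[ℂ] H))) hav.res_apply]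
  set c : ℂ := (((b + μ) / 2 : ℝ) : ℂ) with hc
  set r : ℝ := (μ - b) / 2 with hr
  have hne : ∀ θ : ℝ, ∀ e ∈ spectrum ℂ A, e - circleMap c r θ ≠ 0 := by
    intro θ e he h
    rw [sub_eq_zero] at h
    exact circ_notMem_spectrum hA hμ hb θ (h ▸ he)
  let f : ℝ → ℂ → ℂ := fun θ e =>
    (I / (2 * Real.pi)) * ((circleMap 0 r θ * I) * (e - circleMap c r θ)⁻¹)
  have hnorm : IsStarNormal A := hA.isStarNormal
  have hf : ContinuousOn (Function.uncurry f) (Set.univ ×ˢ spectrum ℂ A) := by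
    refine continuousOn_const.mul (ContinuousOn.mul ?_ (ContinuousOn.inv₀ ?_ ?_))
    · exact (((continuous_circleMap 0 r).comp continuous_fst).mul continuous_const).continuousOn
    · exact (continuous_snd.sub ((continuous_circleMap c r).comp continuous_fst)).continuousOn
    · rintro ⟨θ, e⟩ ⟨-, he⟩
      exact hne θ e he
  have hcfc : ∀ θ : ℝ, cfc (f θ) A = (I / (2 * Real.pi)) •
      ((circleMap 0 r θ * I) • Ring.inverse (A - circleMap c r θ • (1 : H →L[ℂ] H))) := by
    intro θ
    have hinv : ContinuousOn (fun e : ℂ => (e - circleMap c r θ)⁻¹) (spectrum ℂ A) :=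
      ContinuousOn.inv₀ (by fun_prop) (hne θ)
    rw [show f θ = fun e => (I / (2 * Real.pi)) * ((circleMap 0 r θ * I)
        * (e - circleMap c r θ)⁻¹) from rfl,
      cfc_const_mul _ (fun e => (circleMap 0 r θ * I) * (e - circleMap c r θ)⁻¹) A
        (continuousOn_const.mul hinv),
      cfc_const_mul _ (fun e => (e - circleMap c r θ)⁻¹) A hinv,
      cfc_inv (fun e : ℂ => e - circleMap c r θ) A (hne θ) (by fun_prop),
      cfc_sub (fun e : ℂ => e) (fun _ => circleMap c r θ) A, cfc_id' ℂ A, cfc_const _ A,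
      Algebra.algebraMap_eq_smul_one]
  -- The functional calculus sees only values on the spectrum, where the step function agrees with
  -- the scalar contour integral.
  have hstep : spectralProj A μ = cfc (fun e : ℂ => ∫ θ in Set.Ioc 0 (2 * Real.pi), f θ e) A := by
    rw [spectralProj, cfc_real_eq_complex _ hA]
    refine cfc_congr fun e he => ?_
    have hre := hA.mem_spectrum_eq_re he
    have hle := norm_le_of_mem_spectrum he
    rw [hre, Complex.norm_real, Real.norm_eq_abs] at hle
    have hbe : b < e.re := by linarith [(abs_le.1 hle).1]
    have heμ : e.re ≠ μ := by
      intro h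
      exact hμ (h ▸ hre ▸ he)
    have key := contour_indicator (e := e.re) hbμ hbe heμ
    rw [← hre] at key
    rw [← intervalIntegral.integral_of_le zero_le_two_pi,
      intervalIntegral.integral_const_mul]
    rw [circleIntegral] at key
    simp only [deriv_circleMap, smul_eq_mul] at key
    rw [key]
    split_ifs <;> simp
  obtain ⟨M, hM⟩ :=
    (isCompact_Icc.prod (spectrum.isCompact (𝕜 := ℂ) A)).exists_bound_of_continuousOn
    (hf.mono (Set.prod_mono (Set.subset_univ (Set.Icc 0 (2 * Real.pi))) subset_rfl))
  -- The functional calculus is exchanged with the integral over the angle. Joint continuity on the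
  -- compact product of the angles and the spectrum supplies the constant majorant.
  rw [hstep, cfc_setIntegral measurableSet_Ioc f (fun _ => M) A
    (hf.mono (Set.prod_mono (Set.subset_univ _) subset_rfl)) ?_ ?_ hnorm]
  · rw [← intervalIntegral.integral_of_le zero_le_two_pi]
    simp only [hcfc]
    rw [intervalIntegral.integral_smul, circleIntegral]
    simp only [deriv_circleMap]
  · refine (MeasureTheory.ae_restrict_iff' measurableSet_Ioc).2 (Filter.Eventually.of_forall ?_)
    intro θ hθ e he
    exact hM (θ, e) ⟨Set.Ioc_subset_Icc_self hθ, he⟩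
  · exact (MeasureTheory.integrable_const M).hasFiniteIntegral

end Riesz

end

end SCond

/-! ### The trace per unit volume and its cyclicity -/

namespace SCond
noncomputable section

variable {d N : ℕ}

theorem sum_apply_single_eq_trace (f : Spin N →L[ℂ] Spin N) :
    ∑ k, f (EuclideanSpace.single k 1) k = LinearMap.trace ℂ (Spin N) f := by
  rw [LinearMap.trace_eq_sum_inner _ (EuclideanSpace.basisFun (Fin N) ℂ)]
  refine Finset.sum_congr rfl fun k _ => ?_
  rw [EuclideanSpace.basisFun_apply, EuclideanSpace.inner_single_left]
  simp

namespace Crystal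

variable (C : Crystal d N)

/-- The lattice vector with integer coordinates `n`. -/
def latVec (n : Fin d → ℤ) : lattice C.a :=
  ⟨∑ k, n k • C.a k, Submodule.sum_mem _ fun k _ =>
    Submodule.smul_mem _ _ (Submodule.subset_span ⟨k, rfl⟩)⟩

theorem latVec_injective : Function.Injective C.latVec := by
  intro n n' h
  have h1 : ∑ k, n k • C.a k = ∑ k, n' k • C.a k := congrArg Subtype.val h
  have h2 := Fintype.linearIndependent_iff.1 C.linInd (fun k => (n k - n' k : ℝ)) (by
    simp only [sub_smul, Finset.sum_sub_distrib, Int.cast_smul_eq_zsmul, h1, sub_self])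
  ext k
  have := h2 k
  exact_mod_cast sub_eq_zero.1 this

/-- Lattice coordinates in a box. -/
def box (d m : ℕ) : Finset (Fin d → ℤ) := Fintype.piFinset fun _ => Finset.Icc (-m : ℤ) m

theorem mem_box {m : ℕ} {n : Fin d → ℤ} : n ∈ box d m ↔ ∀ k, |n k| ≤ m := by
  simp [box, abs_le]

/-- The sites of the cell `𝒞_L`. -/
def cellFin (L : ℕ) : Finset C.sites :=
  ((C.finite_cell L).preimage (Subtype.val_injective.injOn)).toFinset

@[simp] theorem mem_cellFin {L : ℕ} {x : C.sites} :
    x ∈ C.cellFin L ↔ (x : Sp d) ∈ cell C.sites C.a L := by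
  simp [cellFin]

theorem ncard_cell (L : ℕ) : (cell C.sites C.a L).ncard = (C.cellFin L).card := by
  have : cell C.sites C.a L = Subtype.val '' (C.cellFin L : Set C.sites) := by
    ext x
    simp only [Set.mem_image, Finset.mem_coe, mem_cellFin, Subtype.exists, exists_and_left,
      exists_prop, exists_eq_right_right]
    exact ⟨fun h => ⟨h, h.1⟩, fun h => h.1⟩
  rw [this, Set.ncard_image_of_injective _ Subtype.val_injective, Set.ncard_coe_finset]

/-- An odd side 2m + 1 is tiled by unit intervals centred at the integers from -m to m. The two ends
are treated apart because rounding a boundary point such as m + 1/2 could leave this range. -/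
theorem exists_int_abs_le {m : ℕ} {α : ℝ} (h : |α| ≤ ((2 * m + 1 : ℕ) : ℝ) / 2) :
    ∃ n : ℤ, |n| ≤ m ∧ |α - n| ≤ 1 / 2 := by
  push_cast at h
  have h' := abs_le.1 h
  by_cases h1 : (m : ℝ) ≤ α
  · exact ⟨m, by simp, by rw [abs_le]; push_cast; constructor <;> linarith⟩
  by_cases h2 : α ≤ -m
  · exact ⟨-m, by simp, by rw [abs_le]; push_cast; constructor <;> linarith⟩
  · refine ⟨round α, ?_, abs_sub_round α⟩
    have h3 := abs_le.1 (abs_sub_round α)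
    push Not at h1 h2
    rw [abs_le]
    constructor
    · have : (-m - 1 : ℝ) < round α := by linarith
      have : (-m - 1 : ℤ) < round α := by exact_mod_cast this
      omega
    · have : (round α : ℝ) < m + 1 := by linarith
      have : (round α : ℤ) < m + 1 := by exact_mod_cast this
      omega

/-- The large cell is a disjoint union of translates of the unit cell. Disjointness comes from
primitivity, and covering from rounding coordinates within the box. -/
theorem sum_cellFin {M : Type*} [AddCommMonoid M] (F : C.sites → M) (m : ℕ) :
    ∑ x ∈ C.cellFin (2 * m + 1), F x
      = ∑ n ∈ box d m, ∑ c ∈ C.cellSites, F (C.shift (C.latVec n) c) := by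
  rw [← Finset.sum_product']
  symm
  refine Finset.sum_nbij (fun p => C.shift (C.latVec p.1) p.2) ?_ ?_ ?_ fun _ _ => rfl
  · rintro ⟨n, c⟩ hp
    obtain ⟨hn, hc⟩ := Finset.mem_product.1 hp
    rw [mem_box] at hn
    obtain ⟨hX, α, hα, hb⟩ := C.mem_cellSites.1 hc
    rw [mem_cellFin]
    refine ⟨(C.shift (C.latVec n) c).2, fun k => α k + n k, ?_, fun k => ?_⟩
    · rw [coe_shift, hα]
      simp only [latVec, add_smul, Finset.sum_add_distrib, Int.cast_smul_eq_zsmul]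
    · have h1 := abs_le.1 (hb k)
      have h2 : |(n k : ℝ)| ≤ m := by exact_mod_cast hn k
      have h2 := abs_le.1 h2
      push_cast at h1 ⊢
      rw [abs_le]
      constructor <;> linarith
  · rintro ⟨n, c⟩ hp ⟨n', c'⟩ hp' h
    have hc := (Finset.mem_product.1 (Finset.mem_coe.1 hp)).2
    have hc' := (Finset.mem_product.1 (Finset.mem_coe.1 hp')).2
    obtain ⟨h1, h2⟩ := C.shift_inj hc hc' h
    exact Prod.ext (C.latVec_injective h1) h2
  · intro x hx
    obtain ⟨hX, α, hα, hb⟩ := C.mem_cellFin.1 (Finset.mem_coe.1 hx)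
    choose n hn hn' using fun k => exists_int_abs_le (hb k)
    refine ⟨(n, C.shift (C.latVec (-n)) x), ?_, ?_⟩
    · refine Finset.mem_coe.2 (Finset.mem_product.2 ⟨mem_box.2 hn, C.mem_cellSites.2 ?_⟩)
      refine ⟨(C.shift (C.latVec (-n)) x).2, fun k => α k - n k, ?_, fun k => ?_⟩
      · rw [coe_shift, hα]
        simp only [latVec, sub_smul, Finset.sum_sub_distrib, Int.cast_smul_eq_zsmul, Pi.neg_apply,
          neg_smul, Finset.sum_neg_distrib]
        rw [sub_eq_add_neg]
      · simpa using hn' k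
    · ext1
      simp only [coe_shift, latVec, Pi.neg_apply, neg_smul, Finset.sum_neg_distrib]
      abel

theorem card_cellFin (m : ℕ) :
    (C.cellFin (2 * m + 1)).card = (box d m).card * C.cellSites.card := by
  rw [Finset.card_eq_sum_ones, C.sum_cellFin]
  simp

/-- Functions of the sites which are invariant under the lattice. -/
def IsInvariant (g : C.sites → ℂ) : Prop := ∀ γ x, g (C.shift γ x) = g x

/-- The average of a function over the fundamental cell. -/
def cellMean (g : C.sites → ℂ) : ℂ := (∑ c ∈ C.cellSites, g c) / (C.cellSites.card : ℂ)

theorem sum_latVec_box (m : ℕ) (i : Fin d) :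
    ∑ n ∈ box d m, (((C.latVec n : Sp d) i : ℝ) : ℂ) = 0 := by
  have h : ∑ n ∈ box d m, (((C.latVec n : Sp d) i : ℝ) : ℂ)
      = -∑ n ∈ box d m, (((C.latVec n : Sp d) i : ℝ) : ℂ) := by
    rw [← Finset.sum_neg_distrib]
    refine Finset.sum_nbij' (fun n => -n) (fun n => -n) ?_ ?_ (fun _ _ => neg_neg _)
      (fun _ _ => neg_neg _) ?_
    · intro n hn; rw [mem_box] at hn ⊢; simpa using hn
    · intro n hn; rw [mem_box] at hn ⊢; simpa using hn
    · intro n _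
      rw [← Complex.ofReal_neg]
      congr 1
      simp [latVec]
  exact self_eq_neg.1 h

/-- Translation adds to x_i the i-th component of a lattice vector. These components cancel over a
box symmetric under n ↦ -n, so the unbounded factor x_i does no harm. -/
theorem sum_cellFin_invariant {g h : C.sites → ℂ} (hg : C.IsInvariant g) (hh : C.IsInvariant h)
    (i : Fin d) (m : ℕ) :
    ∑ x ∈ C.cellFin (2 * m + 1), (g x + co i x * h x)
      = (box d m).card * ∑ c ∈ C.cellSites, (g c + co i c * h c) := by
  rw [sum_cellFin]
  have h1 : ∀ n, ∀ c, g (C.shift (C.latVec n) c)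
      + co i (C.shift (C.latVec n) c) * h (C.shift (C.latVec n) c)
      = (g c + co i c * h c) + (((C.latVec n : Sp d) i : ℝ) : ℂ) * h c := by
    intro n c
    rw [hg, hh]
    simp only [co, coe_shift, PiLp.add_apply, Complex.ofReal_add]
    ring
  simp only [h1, Finset.sum_add_distrib, Finset.sum_const, nsmul_eq_mul]
  rw [← Finset.sum_mul_sum, sum_latVec_box, zero_mul, add_zero]
  ring

/-- The normalized traces over odd cells do not depend on the size of the cell, so the limit is that
of a constant sequence. -/
theorem hasTracePerVolume {A : C.H →ₗ.[ℂ] C.H} (hdom : ∀ x v, site x v ∈ A.domain)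
    {g h : C.sites → ℂ} (hg : C.IsInvariant g) (hh : C.IsInvariant h) (i : Fin d)
    (hA : ∀ x, C.siteTrace A x = g x + co i x * h x) :
    C.HasTracePerVolume A (C.cellMean fun x => g x + co i x * h x) := by
  refine ⟨hdom, ?_⟩
  refine tendsto_const_nhds.congr fun m => ?_
  have h1 : C.traceOn (cell C.sites C.a (2 * m + 1)) A
      = ∑ x ∈ C.cellFin (2 * m + 1), (g x + co i x * h x) := by
    rw [traceOn]
    simp only [hA]
    exact finsum_mem_eq_finite_toFinset_sum _
      ((C.finite_cell (2 * m + 1)).preimage (Subtype.val_injective.injOn))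
  have hb : ((box d m).card : ℂ) ≠ 0 := by
    rw [Nat.cast_ne_zero, Finset.card_ne_zero]
    exact ⟨0, mem_box.2 fun _ => by simp⟩
  rw [h1, sum_cellFin_invariant C hg hh, ncard_cell, card_cellFin, Nat.cast_mul,
    mul_div_mul_left _ _ hb, cellMean]

/-- The trace over the internal degrees of freedom of the diagonal matrix element at `x`. -/
def diagTrace (A : C.Op) (x : C.sites) : ℂ := LinearMap.trace ℂ (Spin N) (entry A x x)

variable {C}

theorem diagTrace_add (A B : C.Op) (x : C.sites) :
    C.diagTrace (A + B) x = C.diagTrace A x + C.diagTrace B x :=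
  map_add (LinearMap.trace ℂ (Spin N)) (entry A x x : Spin N →ₗ[ℂ] Spin N) (entry B x x)

theorem diagTrace_smul (c : ℂ) (A : C.Op) (x : C.sites) :
    C.diagTrace (c • A) x = c * C.diagTrace A x :=
  map_smul (LinearMap.trace ℂ (Spin N)) c (entry A x x : Spin N →ₗ[ℂ] Spin N)

theorem diagTrace_eq_sum (A : C.Op) (x : C.sites) :
    C.diagTrace A x = ∑ k, A (site x (EuclideanSpace.single k 1)) x k :=
  (sum_apply_single_eq_trace _).symm

theorem siteTrace_eq {A : C.H →ₗ.[ℂ] C.H} (hdom : ∀ x v, site x v ∈ A.domain) (x : C.sites) :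
    C.siteTrace A x = ∑ k : Fin N, A ⟨_, hdom x (EuclideanSpace.single k 1)⟩ x k :=
  Finset.sum_congr rfl fun _ _ => dif_pos (hdom x _)

/-- The trace of `A(x, y) B(y, x)`. -/
def pairTrace (A B : C.Op) (x y : C.sites) : ℂ :=
  LinearMap.trace ℂ (Spin N) ((entry A x y : Spin N →ₗ[ℂ] Spin N) * entry B y x)

theorem entry_shift_eq {A : C.Op} (hA : C.IsPeriodic A) (γ : lattice C.a) (x y : C.sites) :
    (entry A (C.shift γ x) (C.shift γ y) : Spin N →ₗ[ℂ] Spin N)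
      = (C.M γ (C.shift γ x)).toLinearEquiv.toLinearMap ∘ₗ (entry A x y : Spin N →ₗ[ℂ] Spin N)
        ∘ₗ (C.M γ (C.shift γ y)).symm.toLinearEquiv.toLinearMap := by
  ext1 v
  have := hA.entry_shift γ x y ((C.M γ (C.shift γ y)).symm v)
  rw [LinearIsometryEquiv.apply_symm_apply] at this
  exact this

/-- The translation unitaries at y cancel between the two factors, and those at x form a
conjugation, which the trace ignores. -/
theorem pairTrace_shift {A B : C.Op} (hA : C.IsPeriodic A) (hB : C.IsPeriodic B)
    (γ : lattice C.a) (x y : C.sites) :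
    pairTrace A B (C.shift γ x) (C.shift γ y) = pairTrace A B x y := by
  rw [pairTrace, entry_shift_eq hA, entry_shift_eq hB, pairTrace,
    ← LinearMap.trace_conj' ((entry A x y : Spin N →ₗ[ℂ] Spin N) *
      (entry B y x : Spin N →ₗ[ℂ] Spin N))
      (C.M γ (C.shift γ x)).toLinearEquiv]
  congr 1
  ext1 v
  show C.M γ _ (entry A x y ((C.M γ (C.shift γ y)).symm (C.M γ (C.shift γ y) _))) = _
  rw [LinearIsometryEquiv.symm_apply_apply]
  rfl

theorem isInvariant_diagTrace {A : C.Op} (hA : C.IsPeriodic A) :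
    C.IsInvariant (C.diagTrace A) := by
  intro γ x
  rw [diagTrace, entry_shift_eq hA, diagTrace,
    ← LinearMap.trace_conj' (entry A x x : Spin N →ₗ[ℂ] Spin N)
      (C.M γ (C.shift γ x)).toLinearEquiv]
  rfl

theorem entry_mul {A B : C.Op} {x y : C.sites} (s : Finset C.sites)
    (hs : ∀ z ∉ s, (entry A x z : Spin N →ₗ[ℂ] Spin N) * entry B z y = 0) :
    (entry (A * B) x y : Spin N →ₗ[ℂ] Spin N)
      = ∑ z ∈ s, (entry A x z : Spin N →ₗ[ℂ] Spin N) * entry B z y := by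
  ext1 v
  rw [LinearMap.sum_apply]
  refine (hasSum_apply_site A (B (site y v)) x).unique ?_
  exact hasSum_sum_of_ne_finset_zero fun z hz => congrArg (fun f => f v) (hs z hz)

theorem diagTrace_mul {A B : C.Op} {r : ℝ}
    (hB : ∀ x y : C.sites, r < dist (x : Sp d) y → ∀ v : Spin N, B (site y v) x = 0)
    (x : C.sites) : C.diagTrace (A * B) x = ∑ y ∈ C.nbhd r x, pairTrace A B x y := by
  rw [diagTrace, entry_mul (C.nbhd r x), map_sum]
  · rfl
  · intro z hz
    ext1 v
    rw [mem_nbhd] at hz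
    show entry A x z (B (site x v) z) = 0
    rw [hB z x (by rw [dist_comm]; exact not_le.1 hz), map_zero]

theorem diagTrace_mul' {A B : C.Op} {r : ℝ}
    (hB : ∀ x y : C.sites, r < dist (x : Sp d) y → ∀ v : Spin N, B (site y v) x = 0)
    (x : C.sites) : C.diagTrace (B * A) x = ∑ y ∈ C.nbhd r x, pairTrace A B y x := by
  rw [diagTrace, entry_mul (C.nbhd r x), map_sum]
  · exact Finset.sum_congr rfl fun y _ => LinearMap.trace_mul_comm ℂ _ _
  · intro z hz
    ext1 v
    rw [mem_nbhd] at hz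
    exact hB x z (not_le.1 hz) _

/-- Mass transport: a pair with its first site in the cell is translated until its second site is in
the cell. Invariance of g and of distances makes the two sums agree term by term. -/
theorem sum_cellSites_swap (g : C.sites → C.sites → ℂ)
    (hg : ∀ γ x y, g (C.shift γ x) (C.shift γ y) = g x y) (r : ℝ) :
    ∑ x ∈ C.cellSites, ∑ y ∈ C.nbhd r x, g x y
      = ∑ y ∈ C.cellSites, ∑ x ∈ C.nbhd r y, g x y := by
  choose rep lat hrep hlat using C.exists_shift
  have hneg : ∀ (γ : lattice C.a) x, C.shift γ (C.shift (-γ) x) = x := fun γ x => by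
    ext1; simp
  have huniq : ∀ (γ : lattice C.a) x, x ∈ C.cellSites →
      rep (C.shift γ x) = x ∧ lat (C.shift γ x) = γ := fun γ x hx => by
    obtain ⟨h1, h2⟩ := C.shift_inj (hrep _) hx (hlat (C.shift γ x))
    exact ⟨h2, h1⟩
  rw [Finset.sum_sigma', Finset.sum_sigma']
  -- Translating and then exchanging the order of the pair is an involution, so the same formula
  -- serves in both directions.
  refine Finset.sum_bij' (fun p _ => ⟨rep p.2, C.shift (-lat p.2) p.1⟩)
    (fun p _ => ⟨rep p.2, C.shift (-lat p.2) p.1⟩) ?_ ?_ ?_ ?_ ?_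
  all_goals
    rintro ⟨x, y⟩ hp
    obtain ⟨hx, hy⟩ := Finset.mem_sigma.1 hp
    simp only [mem_nbhd] at hy hx
  · refine Finset.mem_sigma.2 ⟨hrep y, C.mem_nbhd.2 ?_⟩
    rw [← C.dist_shift (lat y), hlat, hneg, dist_comm]
    exact hy
  · refine Finset.mem_sigma.2 ⟨hrep y, C.mem_nbhd.2 ?_⟩
    rw [← C.dist_shift (lat y), hlat, hneg, dist_comm]
    exact hy
  · obtain ⟨h1, h2⟩ := huniq (-lat y) x hx
    simp only [h1, h2, neg_neg, hlat]
  · obtain ⟨h1, h2⟩ := huniq (-lat y) x hx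
    simp only [h1, h2, neg_neg, hlat]
  · rw [← hg (lat y) _ (rep y)]
    simp only [hneg, hlat]

/-- Cyclicity of the trace per unit volume. -/
theorem cellMean_diagTrace_mul_comm {A B : C.Op} (hA : C.IsPeriodic A) (hB : C.IsPeriodic B)
    (hr : C.HasFiniteRange B) :
    C.cellMean (C.diagTrace (A * B)) = C.cellMean (C.diagTrace (B * A)) := by
  obtain ⟨r, hr⟩ := hr
  rw [cellMean, cellMean]
  simp only [diagTrace_mul hr, diagTrace_mul' hr]
  rw [sum_cellSites_swap _ (pairTrace_shift hA hB)]

theorem cellMean_add (g h : C.sites → ℂ) :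
    C.cellMean (fun x => g x + h x) = C.cellMean g + C.cellMean h := by
  rw [cellMean, Finset.sum_add_distrib, add_div]; rfl

theorem cellMean_mul (c : ℂ) (g : C.sites → ℂ) :
    C.cellMean (fun x => c * g x) = c * C.cellMean g := by
  rw [cellMean, ← Finset.mul_sum, mul_div_assoc]; rfl

theorem cellMean_conj (g : C.sites → ℂ) :
    C.cellMean (fun x => (starRingEnd ℂ) (g x)) = (starRingEnd ℂ) (C.cellMean g) := by
  rw [cellMean, cellMean, map_div₀, map_sum, map_natCast]

theorem inner_site_left {X : Set (Sp d)} (x : X) (v : Spin N) (ψ : Hilb X (Spin N)) :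
    inner ℂ (site x v) ψ = inner ℂ v (ψ x) :=
  lp.inner_single_left (G := fun _ : X => Spin N) x v ψ

theorem inner_site_right {X : Set (Sp d)} (x : X) (v : Spin N) (ψ : Hilb X (Spin N)) :
    inner ℂ ψ (site x v) = inner ℂ (ψ x) v :=
  lp.inner_single_right (G := fun _ : X => Spin N) x v ψ

theorem diagTrace_star (A : C.Op) (x : C.sites) :
    C.diagTrace (star A) x = (starRingEnd ℂ) (C.diagTrace A x) := by
  rw [diagTrace, diagTrace, LinearMap.trace_eq_sum_inner _ (EuclideanSpace.basisFun (Fin N) ℂ),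
    LinearMap.trace_eq_sum_inner _ (EuclideanSpace.basisFun (Fin N) ℂ), map_sum]
  refine Finset.sum_congr rfl fun k _ => ?_
  rw [inner_conj_symm]
  show inner ℂ _ ((ContinuousLinearMap.adjoint A) (site x _) x) = inner ℂ (A (site x _) x) _
  rw [← inner_site_left, ContinuousLinearMap.adjoint_inner_right, inner_site_right]

end Crystal

end

end SCond

namespace SCond
noncomputable section

open Complex (I)

theorem hasDerivAt_star {R : Type*} [NormedRing R] [StarRing R] [ContinuousStar R]
    [NormedAlgebra ℂ R] [StarModule ℂ R] {f : ℝ → R} {f' : R} {t : ℝ} (h : HasDerivAt f f' t) :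
    HasDerivAt (fun t => star (f t)) (star f') t :=
  HasDerivAt.star h

/-! ### Adjoints, and multiplication operators on sites -/

section Adjoints

variable {d : ℕ} {X : Set (Sp d)} {V : Type} [NormedAddCommGroup V] [InnerProductSpace ℂ V]
  [CompleteSpace V]

theorem star_phase (j : Fin d) (t : ℝ) :
    star (phase j t : Hilb X V →L[ℂ] Hilb X V) = phase j (-t) := by
  symm
  refine (ContinuousLinearMap.eq_adjoint_iff _ _).2 fun ψ φ => ?_
  rw [lp.inner_eq_tsum, lp.inner_eq_tsum]
  congr 1
  ext x
  rw [phase_apply, phase_apply, inner_smul_left, inner_smul_right, ← Complex.exp_conj]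
  congr 2
  simp

theorem HasDer.star {j : Fin d} {A B : Hilb X V →L[ℂ] Hilb X V} (h : HasDer (phase j) A B) :
    HasDer (phase j) (star A) (star B) := by
  have h1 := hasDerivAt_star h
  refine h1.congr_of_eventuallyEq (Filter.Eventually.of_forall fun t => ?_)
  show phase j t * Star.star A * phase j (-t) = Star.star (phase j t * A * phase j (-t))
  simp only [star_mul, star_phase, neg_neg, mul_assoc]

theorem HasDer.isSelfAdjoint {j : Fin d} {A B : Hilb X V →L[ℂ] Hilb X V}
    (h : HasDer (phase j) A B) (hA : IsSelfAdjoint A) : IsSelfAdjoint B := by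
  have := h.star
  rw [hA.star_eq] at this
  exact this.unique h

theorem isSelfAdjoint_fibreOp {s : V →L[ℂ] V} (hs : IsSelfAdjoint s) :
    IsSelfAdjoint (fibreOp X s) := by
  refine Eq.symm ?_
  refine (ContinuousLinearMap.eq_adjoint_iff _ _).2 fun ψ φ => ?_
  rw [lp.inner_eq_tsum, lp.inner_eq_tsum]
  congr 1
  ext x
  show inner ℂ (s (ψ x)) (φ x) = inner ℂ (ψ x) (s (φ x))
  exact (ContinuousLinearMap.isSelfAdjoint_iff_isSymmetric.1 hs) _ _

omit [CompleteSpace V] in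
theorem fibreOp_apply (s : V →L[ℂ] V) (ψ : Hilb X V) (x : X) : fibreOp X s ψ x = s (ψ x) := rfl

theorem hasDer_fibreOp (j : Fin d) (s : V →L[ℂ] V) : HasDer (phase j) (fibreOp X s) 0 :=
  .of_commute (isUnitCurve_phase j) fun t => by
    ext ψ x : 3
    exact (map_smul s _ _).symm

omit [CompleteSpace V] in
theorem unitaryComp_apply (e : X ≃ X) (U : X → V ≃ₗᵢ[ℂ] V) (ψ : Hilb X V) (x : X) :
    unitaryComp e U ψ x = U x (ψ (e x)) := rfl

omit [CompleteSpace V] in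
theorem unitaryComp_site (e : X ≃ X) (U : X → V ≃ₗᵢ[ℂ] V) (x : X) (v : V) :
    unitaryComp e U (site x v) = site (e.symm x) (U (e.symm x) v) := by
  ext y : 2
  rw [unitaryComp_apply]
  by_cases h : y = e.symm x
  · subst h
    rw [Equiv.apply_symm_apply, site_apply_self, site_apply_self]
  · rw [site_apply_ne h, site_apply_ne (fun h' => h (by rw [← h', Equiv.symm_apply_apply])),
      map_zero]

omit [CompleteSpace V] in
open scoped Classical in
theorem chi_apply (Ω : Set (Sp d)) (ψ : Hilb X V) (x : X) :
    chi X V Ω ψ x = if (x : Sp d) ∈ Ω then ψ x else 0 := by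
  show (if (x : Sp d) ∈ Ω then 1 else 0 : V →L[ℂ] V) (ψ x) = _
  split_ifs <;> rfl

omit [CompleteSpace V] in
theorem chi_site_of_mem {Ω : Set (Sp d)} {x : X} (h : (x : Sp d) ∈ Ω) (v : V) :
    chi X V Ω (site x v) = site x v := by
  ext y : 2
  rw [chi_apply]
  by_cases hy : y = x
  · subst hy; rw [if_pos h]
  · rw [site_apply_ne hy, ite_self]

/-- Two distinct sites of Ω would put two independent vectors into a one-dimensional range. The
rank-one hypothesis enters the proof only in this form. -/
theorem eq_of_finrank_range_chi {Ω : Set (Sp d)}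
    (h : Module.finrank ℂ (LinearMap.range (chi X ℂ Ω).toLinearMap) = 1) {x y : X}
    (hx : (x : Sp d) ∈ Ω) (hy : (y : Sp d) ∈ Ω) : x = y := by
  obtain ⟨w, -, hw⟩ := finrank_eq_one_iff'.1 h
  have hmem : ∀ z : X, (z : Sp d) ∈ Ω →
      site z (1 : ℂ) ∈ LinearMap.range (chi X ℂ Ω).toLinearMap := fun z hz =>
    ⟨site z 1, chi_site_of_mem hz 1⟩
  obtain ⟨c, hc⟩ := hw ⟨_, hmem x hx⟩
  obtain ⟨c', hc'⟩ := hw ⟨_, hmem y hy⟩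
  have h1 : c • (w : Hilb X ℂ) = site x 1 := congrArg Subtype.val hc
  have h2 : c' • (w : Hilb X ℂ) = site y 1 := congrArg Subtype.val hc'
  by_contra hne
  have e1 : c * (w : Hilb X ℂ) x = 1 := by
    have := congrArg (fun f : Hilb X ℂ => f x) h1
    simpa using this
  have e2 : c' * (w : Hilb X ℂ) x = 0 := by
    have := congrArg (fun f : Hilb X ℂ => f x) h2
    simpa [site_apply_ne hne] using this
  have e3 : c' * (w : Hilb X ℂ) y = 1 := by
    have := congrArg (fun f : Hilb X ℂ => f y) h2
    simpa using this
  rcases mul_eq_zero.1 e2 with h0 | h0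
  · rw [h0, zero_mul] at e3; exact zero_ne_one e3
  · rw [h0, mul_zero] at e1; exact zero_ne_one e1

end Adjoints

/-! ### Adjoints of contour integrals -/

section ContourAdjoint

variable {H : Type} [NormedAddCommGroup H] [InnerProductSpace ℂ H] [CompleteSpace H]

/-- The reflection `θ ↦ 2π - θ`. -/
def angRefl : C(Ang, Ang) where
  toFun θ := ⟨2 * Real.pi - θ, by linarith [θ.2.2], by linarith [θ.2.1]⟩
  continuous_toFun := by fun_prop

theorem circleMap_two_pi_sub (c : ℝ) (r θ : ℝ) :
    circleMap c r (2 * Real.pi - θ) = (starRingEnd ℂ) (circleMap c r θ) := by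
  simp only [circleMap, map_add, map_mul, Complex.conj_ofReal, ← Complex.exp_conj, Complex.conj_I]
  congr 2
  rw [show ((2 * Real.pi - θ : ℝ) : ℂ) * I = θ * -I + 2 * Real.pi * I by push_cast; ring,
    Complex.exp_add, Complex.exp_two_pi_mul_I, mul_one]

/-- Conjugation sends the angle θ to 2π - θ. It changes the sign of the prefactor i and of the i in
dz, and the two signs cancel. -/
theorem star_contourInt (r : ℝ) (f g : C(Ang, H →L[ℂ] H))
    (h : ∀ θ, g θ = star (f (angRefl θ))) :
    star (contourInt (H →L[ℂ] H) r f) = contourInt (H →L[ℂ] H) r g := by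
  have h1 : ∀ θ ∈ Set.uIcc 0 (2 * Real.pi), contourFun r g θ
      = -star (contourFun r f (2 * Real.pi - θ)) := by
    intro θ hθ
    rw [Set.uIcc_of_le zero_le_two_pi] at hθ
    have hθ' : 2 * Real.pi - θ ∈ Set.Icc 0 (2 * Real.pi) :=
      ⟨by linarith [hθ.2], by linarith [hθ.1]⟩
    have hc := circleMap_two_pi_sub 0 r θ
    rw [Complex.ofReal_zero] at hc
    rw [contourFun, contourFun, Set.projIcc_of_mem zero_le_two_pi hθ,
      Set.projIcc_of_mem zero_le_two_pi hθ', h, star_smul, hc, ← neg_smul]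
    congr 1
    simp
  rw [contourInt_apply, contourInt_apply, star_smul, intervalIntegral.integral_congr h1,
    intervalIntegral.integral_neg, smul_neg, ← neg_smul]
  congr 1
  · simp [neg_div]
  · rw [intervalIntegral.integral_comp_sub_left (fun θ => star (contourFun r f θ))]
    simp only [sub_self, sub_zero]
    exact ((starL' ℝ (A := H →L[ℂ] H) : (H →L[ℂ] H) →L[ℝ] (H →L[ℂ] H)).intervalIntegral_comp_comm
      (intervalIntegrable_contourFun r f 0 _)).symm

theorem star_sandwich {A : H →L[ℂ] H} {b μ : ℝ} (hA : IsSelfAdjoint A)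
    (h : Avoids A (circ b μ)) (r : ℝ) (B : H →L[ℂ] H) :
    star (sandwich A (circ b μ) r B) = sandwich A (circ b μ) r (star B) := by
  have hres : ∀ θ, star (res A (circ b μ) (angRefl θ)) = res A (circ b μ) θ := by
    intro θ
    rw [h.res_apply, h.res_apply, ← Ring.inverse_star, star_sub, hA.star_eq, star_smul, star_one]
    congr 3
    show star (circleMap _ _ (2 * Real.pi - θ)) = circleMap _ _ θ
    rw [circleMap_two_pi_sub]
    exact star_star _
  refine star_contourInt r _ _ fun θ => ?_
  show res A (circ b μ) θ * star B * res A (circ b μ) θ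
    = star (res A (circ b μ) (angRefl θ) * B * res A (circ b μ) (angRefl θ))
  rw [star_mul, star_mul, hres, mul_assoc]

end ContourAdjoint

/-! ### Algebra of periodic operators, and derivatives of cell means -/

namespace Crystal

variable {d N : ℕ} {C : Crystal d N} {A B : C.Op}

theorem IsPeriodic.add (hA : C.IsPeriodic A) (hB : C.IsPeriodic B) : C.IsPeriodic (A + B) :=
  fun γ => Commute.add_left (hA γ) (hB γ)

theorem IsPeriodic.sub (hA : C.IsPeriodic A) (hB : C.IsPeriodic B) : C.IsPeriodic (A - B) :=
  fun γ => Commute.sub_left (hA γ) (hB γ)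

theorem IsPeriodic.mul (hA : C.IsPeriodic A) (hB : C.IsPeriodic B) : C.IsPeriodic (A * B) :=
  fun γ => Commute.mul_left (hA γ) (hB γ)

theorem IsPeriodic.neg (hA : C.IsPeriodic A) : C.IsPeriodic (-A) :=
  fun γ => Commute.neg_left (hA γ)

theorem IsPeriodic.smul (hA : C.IsPeriodic A) (c : ℂ) : C.IsPeriodic (c • A) :=
  fun γ => Commute.smul_left (hA γ) c

theorem IsPeriodic.exp (hA : C.IsPeriodic A) : C.IsPeriodic (NormedSpace.exp A) :=
  fun γ => Commute.exp_left (hA γ)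

theorem IsPeriodic.sandwich (hA : C.IsPeriodic A) (hB : C.IsPeriodic B) {z : C(Ang, ℂ)}
    (h : Avoids A z) (r : ℝ) : C.IsPeriodic (sandwich A z r B) := fun γ => by
  have hγ : Commute (C.T γ) A := (hA γ).symm
  rw [h.sandwich_mul hγ, h.mul_sandwich hγ, hB γ]

/-- `diagTrace` at a site as a continuous linear functional. -/
def diagTraceL (x : C.sites) : C.Op →L[ℂ] ℂ :=
  ∑ k, (EuclideanSpace.proj k).comp
    ((ev x).comp (ContinuousLinearMap.apply ℂ C.H (site x (EuclideanSpace.single k 1))))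

theorem diagTraceL_apply (x : C.sites) (A : C.Op) : diagTraceL x A = C.diagTrace A x := by
  rw [diagTrace_eq_sum, diagTraceL, _root_.sum_apply]
  rfl

theorem hasDerivAt_diagTrace_mul {f : ℝ → C.Op} {f' : C.Op} (hf : HasDerivAt f f' 0) (B : C.Op)
    (x : C.sites) :
    HasDerivAt (fun ε => C.diagTrace (B * f ε) x) (C.diagTrace (B * f') x) 0 := by
  have := (((diagTraceL x).comp (ContinuousLinearMap.mul ℂ C.Op B)).restrictScalars
    ℝ).hasFDerivAt.comp_hasDerivAt (0 : ℝ) hf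
  simp only [← diagTraceL_apply]
  exact this

theorem hasDerivAt_cellMean {g : ℝ → C.sites → ℂ} {g' : C.sites → ℂ}
    (hg : ∀ x, HasDerivAt (fun ε => g ε x) (g' x) 0) :
    HasDerivAt (fun ε => C.cellMean (g ε)) (C.cellMean g') 0 :=
  (HasDerivAt.fun_sum fun x _ => hg x).div_const _

end Crystal

end

end SCond

/-! ### Linear response: regularity, traces and conductivities of a model -/

namespace SCond
noncomputable section

open Complex (I)

theorem hasDerivAt_exp_conj {R : Type*} [NormedRing R] [NormedAlgebra ℂ R] [CompleteSpace R]
    (A P : R) : HasDerivAt (fun ε : ℝ => NormedSpace.exp (-(I * ε) • A) * P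
      * NormedSpace.exp ((I * ε) • A)) (-I • (A * P - P * A)) 0 := by
  have h : ∀ c : ℂ, HasDerivAt (fun ε : ℝ => NormedSpace.exp ((c * ε) • A)) (c • A) 0 := fun c => by
    have h1 := hasDerivAt_exp_smul_const (𝕂 := ℝ) (c • A) 0
    simp only [zero_smul, NormedSpace.exp_zero, one_mul] at h1
    refine h1.congr_of_eventuallyEq (Filter.Eventually.of_forall fun ε => ?_)
    show _ = NormedSpace.exp (ε • c • A)
    rw [← Complex.coe_smul, smul_smul, mul_comm]
  have h1 := ((h (-I)).mul_const P).mul (h I)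
  simp only [Complex.ofReal_zero, mul_zero, zero_smul, NormedSpace.exp_zero, mul_one,
    one_mul] at h1
  have h2 : -I • A * P + P * I • A = -I • (A * P - P * A) := by
    rw [smul_sub, smul_mul_assoc, mul_smul_comm, neg_smul, neg_smul, sub_neg_eq_add]
  rw [h2] at h1
  refine h1.congr_of_eventuallyEq (Filter.Eventually.of_forall fun ε => ?_)
  simp only [Pi.mul_apply, neg_mul]

namespace Model

variable {d N : ℕ} {C : Crystal d N} (Q : Model C)

theorem bottom_lt : Q.bottom < -‖Q.H0‖ := by
  rw [bottom]; linarith [abs_nonneg Q.μ]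

theorem bottom_lt_mu : Q.bottom < Q.μ := by
  rw [bottom]; linarith [neg_abs_le Q.μ, norm_nonneg Q.H0]

/-- The radius of the contour. -/
def radius : ℝ := (Q.μ - Q.bottom) / 2

/-- The contour. -/
def contour : C(Ang, ℂ) := circ Q.bottom Q.μ

theorem avoids : Avoids Q.H0 Q.contour := avoids_circ Q.selfAdjoint Q.gap Q.bottom_lt

/-- The map `B ↦ (i/2π) ∮ (H₀ - z)⁻¹ B (H₀ - z)⁻¹ dz`. -/
def sw (B : C.Op) : C.Op := sandwich Q.H0 Q.contour Q.radius B

theorem Pi0_eq : Q.Pi0 = contourInt C.Op Q.radius (res Q.H0 Q.contour) :=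
  spectralProj_eq_contourInt Q.selfAdjoint Q.gap Q.bottom_lt Q.bottom_lt_mu

theorem Pi0_mul_self : Q.Pi0 * Q.Pi0 = Q.Pi0 := spectralProj_mul_self Q.gap

theorem isSelfAdjoint_Pi0 : IsSelfAdjoint Q.Pi0 := isSelfAdjoint_spectralProj

theorem commute_Pi0 {B : C.Op} (h : Commute B Q.H0) : Commute B Q.Pi0 := by
  rw [Pi0_eq]; exact Q.avoids.commute_contourInt_res h _

theorem commute_Pi0_H0 : Commute Q.Pi0 Q.H0 := (Q.commute_Pi0 (Commute.refl _)).symm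

theorem isPeriodic_Pi0 : C.IsPeriodic Q.Pi0 := fun γ =>
  ((Q.commute_Pi0 (show Commute (C.T γ) Q.H0 from (Q.periodic γ).symm)).symm).eq

theorem invLiouville_eq (A : C.Op) : Q.invLiouville A = Q.sw (A * Q.Pi0 - Q.Pi0 * A) := by
  rw [invLiouville, sw, sandwich]
  symm
  refine contourInt_eq_circleIntegral _ _ _ _ fun θ => ?_
  show res Q.H0 Q.contour θ * _ * res Q.H0 Q.contour θ = _
  rw [Q.avoids.res_apply]
  rfl

theorem exists_hasDer_H0 (k : Fin d) :
    ∃ B : C.Op, C.HasFiniteRange B ∧ HasDer (phase k) Q.H0 B := Q.finiteRange.exists_hasDer k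

/-- The derivative of `e^{i t X_k} H₀ e^{-i t X_k}` at `t = 0`. -/
def dH (k : Fin d) : C.Op := (Q.exists_hasDer_H0 k).choose

theorem hasFiniteRange_dH (k : Fin d) : C.HasFiniteRange (Q.dH k) :=
  (Q.exists_hasDer_H0 k).choose_spec.1

theorem hasDer_H0 (k : Fin d) : HasDer (phase k) Q.H0 (Q.dH k) :=
  (Q.exists_hasDer_H0 k).choose_spec.2

/-- The derivative of `e^{i t X_k} Π₀ e^{-i t X_k}` at `t = 0`. -/
def dP (k : Fin d) : C.Op := -Q.sw (Q.dH k)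

/-- The Schur test is not available for Π₀, which need not have finite range. The Riesz formula
passes differentiability on from H₀ instead. -/
theorem hasDer_Pi0 (k : Fin d) : HasDer (phase k) Q.Pi0 (Q.dP k) := by
  rw [Pi0_eq]
  exact (Q.hasDer_H0 k).integral_resolvent (isUnitCurve_phase k) Q.avoids _

theorem exists_hasDer_sw {k : Fin d} {B B' : C.Op} (hB : HasDer (phase k) B B') :
    ∃ D, HasDer (phase k) (Q.sw B) D :=
  HasDer.exists_sandwich (isUnitCurve_phase k) Q.avoids (Q.hasDer_H0 k) hB _

theorem exists_hasDer_dP (i j : Fin d) : ∃ D, HasDer (phase i) (Q.dP j) D := by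
  obtain ⟨B, -, hB⟩ := (Q.hasFiniteRange_dH j).exists_hasDer i
  obtain ⟨D, hD⟩ := Q.exists_hasDer_sw hB
  exact ⟨_, hD.neg⟩

theorem derPos_H0 (k : Fin d) : derPos Q.H0 k = I • Q.dH k := (Q.hasDer_H0 k).kerDer.derPos_eq

theorem derPi0_eq (k : Fin d) : Q.derPi0 k = -(I • Q.dP k) := by
  rw [derPi0, (Q.hasDer_Pi0 k).kerDer.derPos_eq]

theorem wellPosed (i j : Fin d) : Q.WellPosed i j :=
  ⟨⟨_, (Q.hasDer_Pi0 j).kerDer.isBddClosure⟩, ⟨_, (Q.hasDer_H0 i).kerDer.isBddClosure⟩⟩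

theorem isPeriodic_derPos_H0 (k : Fin d) : C.IsPeriodic (derPos Q.H0 k) := by
  rw [derPos_H0]; exact (Q.hasDer_H0 k).kerDer.isPeriodic Q.periodic

theorem isPeriodic_derPi0 (k : Fin d) : C.IsPeriodic (Q.derPi0 k) := by
  rw [derPi0_eq]; exact ((Q.hasDer_Pi0 k).kerDer.isPeriodic Q.isPeriodic_Pi0).neg

theorem isPeriodic_invLiouville {A : C.Op} (hA : C.IsPeriodic A) :
    C.IsPeriodic (Q.invLiouville A) := by
  rw [invLiouville_eq]
  exact Q.periodic.sandwich ((hA.mul Q.isPeriodic_Pi0).sub (Q.isPeriodic_Pi0.mul hA)) Q.avoids _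

theorem isPeriodic_Pi1 (j : Fin d) : C.IsPeriodic (Q.Pi1 j) :=
  Q.isPeriodic_invLiouville (Q.isPeriodic_derPi0 j)

theorem isPeriodic_generator (j : Fin d) : C.IsPeriodic (Q.generator j) :=
  (Q.isPeriodic_invLiouville (((Q.isPeriodic_derPi0 j).mul Q.isPeriodic_Pi0).sub
    (Q.isPeriodic_Pi0.mul (Q.isPeriodic_derPi0 j)))).smul _

theorem isPeriodic_PiEps (j : Fin d) (ε : ℝ) : C.IsPeriodic (Q.PiEps j ε) :=
  (((Q.isPeriodic_generator j).smul _).exp.mul Q.isPeriodic_Pi0).mul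
    ((Q.isPeriodic_generator j).smul _).exp

theorem exists_hasDer_invLiouville {k : Fin d} {A : C.Op} (hA : ∃ D, HasDer (phase k) A D) :
    ∃ D, HasDer (phase k) (Q.invLiouville A) D := by
  obtain ⟨D, hD⟩ := hA
  have hu := isUnitCurve_phase (X := C.sites) (V := Spin N) k
  rw [invLiouville_eq]
  exact Q.exists_hasDer_sw ((hD.mul hu (Q.hasDer_Pi0 k)).sub ((Q.hasDer_Pi0 k).mul hu hD))

theorem exists_hasDer_derPi0 (i j : Fin d) : ∃ D, HasDer (phase i) (Q.derPi0 j) D := by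
  obtain ⟨D, hD⟩ := Q.exists_hasDer_dP i j
  rw [derPi0_eq]
  exact ⟨_, (hD.smul I).neg⟩

theorem exists_hasDer_Pi1 (i j : Fin d) : ∃ D, HasDer (phase i) (Q.Pi1 j) D :=
  Q.exists_hasDer_invLiouville (Q.exists_hasDer_derPi0 i j)

theorem exists_hasDer_generator (i j : Fin d) : ∃ D, HasDer (phase i) (Q.generator j) D := by
  have hu := isUnitCurve_phase (X := C.sites) (V := Spin N) i
  obtain ⟨D, hD⟩ := Q.exists_hasDer_derPi0 i j
  obtain ⟨D', hD'⟩ := Q.exists_hasDer_invLiouville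
    ⟨_, (hD.mul hu (Q.hasDer_Pi0 i)).sub ((Q.hasDer_Pi0 i).mul hu hD)⟩
  exact ⟨_, hD'.smul I⟩

theorem exists_hasDer_PiEps (i j : Fin d) (ε : ℝ) : ∃ D, HasDer (phase i) (Q.PiEps j ε) D := by
  have hu := isUnitCurve_phase (X := C.sites) (V := Spin N) i
  obtain ⟨D, hD⟩ := Q.exists_hasDer_generator i j
  obtain ⟨D₁, h₁⟩ := (hD.smul (-(I * ε))).exp hu
  obtain ⟨D₂, h₂⟩ := (hD.smul (I * ε)).exp hu
  exact ⟨_, (h₁.mul hu (Q.hasDer_Pi0 i)).mul hu h₂⟩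

/-- The torque `[H₀, S]`. -/
def torque : C.Op := Q.H0 * Q.S - Q.S * Q.H0

theorem isPeriodic_S : C.IsPeriodic Q.S := Q.s_periodic

theorem isPeriodic_torque : C.IsPeriodic Q.torque :=
  (Q.periodic.mul Q.isPeriodic_S).sub (Q.isPeriodic_S.mul Q.periodic)

theorem exists_hasDer_torque (i : Fin d) : ∃ D, HasDer (phase i) Q.torque D := by
  have hu := isUnitCurve_phase (X := C.sites) (V := Spin N) i
  have hS : HasDer (phase i) Q.S 0 := hasDer_fibreOp i Q.s
  exact ⟨_, ((Q.hasDer_H0 i).mul hu hS).sub (hS.mul hu (Q.hasDer_H0 i))⟩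

/-- Both A and [H₀, S] preserve the domain of X_i. This makes X_i [H₀, S] A meaningful on compactly
supported functions, and is why derivatives in direction i of Π₁ and Π^ε are established. -/
theorem torque_mul_site_mem {i : Fin d} {A : C.Op} (hA : ∃ D, HasDer (phase i) A D)
    (x : C.sites) (v : Spin N) :
    Q.torque (A (site x v)) ∈ (pos C.sites (Spin N) i).domain := by
  obtain ⟨D, hD⟩ := hA
  obtain ⟨D', hD'⟩ := Q.exists_hasDer_torque i
  exact hD'.kerDer.mem_domain (hD.kerDer.mem_domain (site_mem_pos_domain i x v))

section Traces

open Crystal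

theorem hasTrace_rotationOp (i j : Fin d) :
    C.HasTracePerVolume (Q.rotationOp i j)
      (C.cellMean fun x => co i x * (I * C.diagTrace (Q.torque * Q.Pi1 j) x)) := by
  have hdom : ∀ x v, site x v ∈ (Q.rotationOp i j).domain :=
    fun x v => by
      have := Q.torque_mul_site_mem (Q.exists_hasDer_Pi1 i j) x v
      unfold rotationOp
      exact this
  have h1 : ∀ x v k, (Q.rotationOp i j ⟨site x v, hdom x v⟩ : C.H) x k
      = I * (co i x * (Q.torque * Q.Pi1 j) (site x v) x k) := fun _ _ _ => rfl
  have h2 : ∀ x, C.siteTrace (Q.rotationOp i j) x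
      = 0 + co i x * (I * C.diagTrace (Q.torque * Q.Pi1 j) x) := by
    intro x
    rw [siteTrace_eq hdom, diagTrace_eq_sum, zero_add, Finset.mul_sum, Finset.mul_sum]
    refine Finset.sum_congr rfl fun k _ => ?_
    exact (h1 x (EuclideanSpace.single k 1) k).trans (mul_left_comm _ _ _)
  have h3 : C.IsInvariant fun x => I * C.diagTrace (Q.torque * Q.Pi1 j) x := fun γ x => by
    beta_reduce
    rw [isInvariant_diagTrace (Q.isPeriodic_torque.mul (Q.isPeriodic_Pi1 j)) γ x]
  have := C.hasTracePerVolume hdom (g := fun _ => 0) (fun _ _ => rfl) h3 i h2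
  simpa only [zero_add] using this

/-- The bounded operator whose partial version is the conventional current. -/
def jc (i : Fin d) : C.Op :=
  (1 / 2 : ℂ) • (I • (derPos Q.H0 i * Q.S) + I • (Q.S * derPos Q.H0 i))

theorem isPeriodic_jc (i : Fin d) : C.IsPeriodic (Q.jc i) :=
  ((((Q.isPeriodic_derPos_H0 i).mul Q.isPeriodic_S).smul I).add
    ((Q.isPeriodic_S.mul (Q.isPeriodic_derPos_H0 i)).smul I)).smul _

theorem hasTrace_Jconv (i : Fin d) {A : C.Op} (hA : C.IsPeriodic A) :
    C.HasTracePerVolume (mulBdd (Q.Jconv i) A) (C.cellMean (C.diagTrace (Q.jc i * A))) := by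
  have hdom : ∀ x v, site x v ∈ (mulBdd (Q.Jconv i) A).domain := fun _ _ => trivial
  have := C.hasTracePerVolume hdom (g := C.diagTrace (Q.jc i * A)) (h := fun _ => 0)
    (isInvariant_diagTrace ((Q.isPeriodic_jc i).mul hA)) (fun _ _ => rfl) i
    (fun x => by
      rw [siteTrace_eq hdom, diagTrace_eq_sum, mul_zero, add_zero]
      rfl)
  simpa only [mul_zero, add_zero] using this

theorem hasTrace_Jprop (i : Fin d) {A : C.Op} (hA : C.IsPeriodic A)
    (hA' : ∃ D, HasDer (phase i) A D) :
    C.HasTracePerVolume (mulBdd (Q.Jprop i) A)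
      (C.cellMean fun x => C.diagTrace (I • (derPos Q.H0 i * Q.S) * A) x
        + co i x * (I * C.diagTrace (Q.torque * A) x)) := by
  have hdom : ∀ x v, site x v ∈ (mulBdd (Q.Jprop i) A).domain := fun x v =>
    ⟨trivial, Q.torque_mul_site_mem hA' x v⟩
  refine C.hasTracePerVolume hdom (isInvariant_diagTrace
    ((((Q.isPeriodic_derPos_H0 i).mul Q.isPeriodic_S).smul I).mul hA)) (fun γ x => by
      rw [isInvariant_diagTrace (Q.isPeriodic_torque.mul hA) γ x]) i
    (fun x => ?_)
  rw [siteTrace_eq hdom, diagTrace_eq_sum, diagTrace_eq_sum, Finset.mul_sum, Finset.mul_sum,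
    ← Finset.sum_add_distrib]
  refine Finset.sum_congr rfl fun k _ => ?_
  rw [mul_left_comm]
  rfl

end Traces

theorem sw_smul (c : ℂ) (B : C.Op) : Q.sw (c • B) = c • Q.sw B := sandwich_smul _ c B

theorem mul_sw {B : C.Op} (hB : Commute B Q.H0) (D : C.Op) : B * Q.sw D = Q.sw (B * D) :=
  Q.avoids.mul_sandwich hB _ D

theorem sw_mul {B : C.Op} (hB : Commute B Q.H0) (D : C.Op) : Q.sw D * B = Q.sw (D * B) :=
  Q.avoids.sandwich_mul hB _ D

theorem sw_sub (B D : C.Op) : Q.sw (B - D) = Q.sw B - Q.sw D := sandwich_sub _ B D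

/-- The commutator K of a bounded operator with the projection P = Π₀ is off-diagonal: P K P = 0 and
K P + P K = K. Hence [[K, P], P] = K. Since P commutes with H₀, the outer commutator with P passes
inside the contour integral. -/
theorem Pi1_eq_commutator (j : Fin d) :
    Q.Pi1 j = -I • (Q.generator j * Q.Pi0 - Q.Pi0 * Q.generator j) := by
  set P := Q.Pi0 with hP
  set G := Q.derPi0 j with hG
  set K := G * P - P * G with hK
  have hPP : P * P = P := Q.Pi0_mul_self
  have h1 : Q.generator j = I • Q.sw (K * P - P * K) := by
    rw [generator, invLiouville_eq]
  have h2 : Q.Pi1 j = Q.sw K := by rw [Pi1, invLiouville_eq]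
  rw [h1, h2, smul_mul_assoc, mul_smul_comm, ← smul_sub, smul_smul, Q.sw_mul Q.commute_Pi0_H0,
    Q.mul_sw Q.commute_Pi0_H0, ← sw_sub, neg_mul, Complex.I_mul_I, neg_neg, one_smul]
  congr 1
  have e1 : K * P * P = K * P := by rw [mul_assoc, hPP]
  have e2 : P * (P * K) = P * K := by rw [← mul_assoc, hPP]
  have e3 : P * K * P = 0 := by
    rw [hK, mul_sub, sub_mul, ← mul_assoc P P G, hPP, mul_assoc, mul_assoc G P P, hPP, ← mul_assoc,
      sub_self]
  have e4 : K * P = G * P - P * G * P := by rw [hK, sub_mul, mul_assoc G P P, hPP]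
  have e5 : P * K = P * G * P - P * G := by rw [hK, mul_sub, ← mul_assoc, ← mul_assoc P P G, hPP]
  clear_value K
  rw [sub_mul, mul_sub, e1, e2, ← mul_assoc P K P, e3, e4, e5, hK]
  abel

theorem PiEps_zero (j : Fin d) : Q.PiEps j 0 = Q.Pi0 := by
  rw [PiEps]; simp [NormedSpace.exp_zero]

theorem hasDerivAt_PiEps (j : Fin d) : HasDerivAt (fun ε : ℝ => Q.PiEps j ε) (Q.Pi1 j) 0 := by
  rw [Q.Pi1_eq_commutator j]
  exact hasDerivAt_exp_conj _ _

theorem isSelfAdjoint_dP (j : Fin d) : IsSelfAdjoint (Q.dP j) :=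
  (Q.hasDer_Pi0 j).isSelfAdjoint Q.isSelfAdjoint_Pi0

/-- The closure of [X_j, Π₀] is skew-adjoint, so its commutator with Π₀ is self-adjoint, and the
contour map respects adjoints because the circle is symmetric about the real axis. -/
theorem isSelfAdjoint_Pi1 (j : Fin d) : IsSelfAdjoint (Q.Pi1 j) := by
  have hG : star (Q.derPi0 j) = -Q.derPi0 j := by
    rw [derPi0_eq, star_neg, star_smul, (Q.isSelfAdjoint_dP j).star_eq]
    simp
  rw [IsSelfAdjoint, Pi1, invLiouville_eq, sw, contour,
    star_sandwich Q.selfAdjoint Q.avoids, star_sub, star_mul, star_mul, hG,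
    Q.isSelfAdjoint_Pi0.star_eq]
  congr 1
  noncomm_ring

theorem isSelfAdjoint_S : IsSelfAdjoint Q.S := isSelfAdjoint_fibreOp Q.s_selfAdjoint

-- With J = i[H₀, X_i] self-adjoint, the adjoint of J S Π₁ is Π₁ S J. By cyclicity, available
-- because S J has finite range, the traces of J S Π₁ and S J Π₁ are complex conjugates.
-- Symmetrizing the current therefore leaves the real part unchanged.
open Crystal in
theorem re_cellMean_current (i j : Fin d) :
    (C.cellMean (C.diagTrace (Q.jc i * Q.Pi1 j))).re
      = (C.cellMean (C.diagTrace (I • (derPos Q.H0 i * Q.S) * Q.Pi1 j))).re := by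
  set J : C.Op := -Q.dH i with hJ
  have hD : ∀ B : C.Op, I • (derPos Q.H0 i * B) = J * B := fun B => by
    rw [derPos_H0, smul_mul_assoc, smul_smul, Complex.I_mul_I, hJ, neg_mul, neg_smul, one_smul]
  have hD' : ∀ B : C.Op, I • (B * derPos Q.H0 i) = B * J := fun B => by
    rw [derPos_H0, mul_smul_comm, smul_smul, Complex.I_mul_I, hJ, mul_neg, neg_smul, one_smul]
  have hJs : star J = J := by
    rw [hJ, star_neg, ((Q.hasDer_H0 i).isSelfAdjoint Q.selfAdjoint).star_eq]
  have hJp : C.IsPeriodic J := by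
    have : J = I • derPos Q.H0 i := by rw [← mul_one J, ← hD, mul_one]
    rw [this]; exact (Q.isPeriodic_derPos_H0 i).smul _
  have hSJ : C.HasFiniteRange (Q.S * J) := by
    obtain ⟨r, hr⟩ := Q.hasFiniteRange_dH i
    refine ⟨r, fun x y h v => ?_⟩
    show Q.s (-(Q.dH i (site y v) x)) = 0
    rw [hr x y h v, neg_zero, map_zero]
  have h1 : (C.cellMean (C.diagTrace (J * Q.S * Q.Pi1 j))).re
      = (C.cellMean (C.diagTrace (Q.S * J * Q.Pi1 j))).re := by
    have h2 : star (J * Q.S * Q.Pi1 j) = Q.Pi1 j * (Q.S * J) := by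
      rw [star_mul, star_mul, hJs, Q.isSelfAdjoint_S.star_eq, (Q.isSelfAdjoint_Pi1 j).star_eq]
    rw [← cellMean_diagTrace_mul_comm (Q.isPeriodic_Pi1 j) (Q.isPeriodic_S.mul hJp) hSJ, ← h2]
    rw [show C.diagTrace (star (J * Q.S * Q.Pi1 j))
      = fun x => (starRingEnd ℂ) (C.diagTrace (J * Q.S * Q.Pi1 j) x) from
        funext (diagTrace_star _), cellMean_conj, Complex.conj_re]
  have h3 : C.diagTrace (Q.jc i * Q.Pi1 j) = fun x => (1 / 2 : ℂ) *
      (C.diagTrace (J * Q.S * Q.Pi1 j) x + C.diagTrace (Q.S * J * Q.Pi1 j) x) := by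
    ext x
    rw [jc, hD, hD', smul_mul_assoc, add_mul, diagTrace_smul, diagTrace_add]
  rw [h3, cellMean_mul, cellMean_add, hD]
  have : ((1 / 2 : ℂ) * (C.cellMean (C.diagTrace (J * Q.S * Q.Pi1 j))
      + C.cellMean (C.diagTrace (Q.S * J * Q.Pi1 j)))).re
      = 1 / 2 * ((C.cellMean (C.diagTrace (J * Q.S * Q.Pi1 j))).re
      + (C.cellMean (C.diagTrace (Q.S * J * Q.Pi1 j))).re) := by
    rw [show (1 / 2 : ℂ) = ((1 / 2 : ℝ) : ℂ) by norm_num, Complex.re_ofReal_mul, Complex.add_re]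
  rw [this, ← h1]
  ring

theorem isConductivity_of_hasDerivAt {J : C.H →ₗ.[ℂ] C.H} {j : Fin d} {F : ℝ → ℂ} {F' : ℂ}
    (hF : ∀ ε, C.HasTracePerVolume (mulBdd J (Q.PiEps j ε)) (F ε)) (hd : HasDerivAt F F' 0) :
    Q.IsConductivity J j F'.re := by
  refine ⟨F 0, F, ?_, fun ε _ => hF ε, ?_⟩
  · rw [← Q.PiEps_zero j]; exact hF 0
  · have h1 : HasDerivAt (fun ε => (F ε).re) F'.re 0 :=
      Complex.reCLM.hasFDerivAt.comp_hasDerivAt (0 : ℝ) hd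
    have h2 := (hasDerivAt_iff_isLittleO_nhds_zero.1 h1).mono
      (nhdsWithin_le_nhds (s := Set.Ioi (0 : ℝ)))
    simpa only [zero_add, smul_eq_mul] using h2

open Crystal in
/-- If the diagonal of `[H₀, S] Π₁` is traceless, the proper and the conventional conductivity
coincide. -/
theorem sigma_of_diagTrace_eq_zero (i j : Fin d)
    (h0 : ∀ x, C.diagTrace (Q.torque * Q.Pi1 j) x = 0) :
    Q.IsSigmaRot i j 0 ∧ ∃ σ : ℝ, Q.IsSigmaProp i j σ ∧ Q.IsSigmaConv i j σ := by
  refine ⟨⟨_, Q.hasTrace_rotationOp i j, ?_⟩, _, ?_,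
    Q.isConductivity_of_hasDerivAt (fun ε => Q.hasTrace_Jconv i (Q.isPeriodic_PiEps j ε))
      (hasDerivAt_cellMean fun x => hasDerivAt_diagTrace_mul (Q.hasDerivAt_PiEps j) _ x)⟩
  · simp [h0, cellMean]
  · rw [re_cellMean_current]
    have := Q.isConductivity_of_hasDerivAt (fun ε => Q.hasTrace_Jprop i (Q.isPeriodic_PiEps j ε)
      (Q.exists_hasDer_PiEps i j ε)) (hasDerivAt_cellMean fun x =>
        (hasDerivAt_diagTrace_mul (Q.hasDerivAt_PiEps j) _ x).add
          (((hasDerivAt_diagTrace_mul (Q.hasDerivAt_PiEps j) _ x).const_mul I).const_mul (co i x)))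
    -- The part i X_i [H₀, S] of the proper current contributes i x_i times the diagonal trace of
    -- [H₀, S] Π₁ to the derivative, site by site, and this vanishes.
    simp only [h0, mul_zero, add_zero] at this
    exact this

end Model

end

end SCond

namespace SCond
noncomputable section

open Complex (I)

/-! ### Rotation covariance and the vanishing of the diagonal traces -/

section Rotation

variable {d N : ℕ} {C : Crystal d N} {i j : Fin d} (hij : i ≠ j) {θ : ℝ}
  (hR : ∀ x, x ∈ C.sites ↔ rotVec i j θ x ∈ C.sites) (ρ : Spin N ≃ₗᵢ[ℂ] Spin N)

/-- The rotation of the sites. -/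
def rot : C.sites ≃ C.sites := (rotSites hij θ hR).symm

theorem coe_rot (x : C.sites) : (rot hij hR x : Sp d) = rotVec i j θ x := rfl

theorem rotVec_apply_fst (x : Sp d) :
    rotVec i j θ x i = Real.cos θ * x i - Real.sin θ * x j := by simp [rotVec]

include hij in
theorem rotVec_apply_snd (x : Sp d) :
    rotVec i j θ x j = Real.sin θ * x i + Real.cos θ * x j := by simp [rotVec, hij.symm]

theorem rotOp_site (x : C.sites) (v : Spin N) :
    Model.rotOp hij θ hR ρ (site x v) = site (rot hij hR x) (ρ v) :=
  unitaryComp_site _ _ x v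

theorem rotOp_apply_rot (ψ : C.H) (x : C.sites) :
    Model.rotOp hij θ hR ρ ψ (rot hij hR x) = ρ (ψ x) := by
  show ρ (ψ (rotSites hij θ hR (rot hij hR x))) = _
  rw [show rotSites hij θ hR (rot hij hR x) = x from Equiv.apply_symm_apply _ _]

variable {hij hR ρ}

/-- Two operators are allowed because the rotation mixes the components of a vector operator: A is
one component and B a combination of both. -/
theorem intertwine_iff {A B : C.Op} :
    Model.rotOp hij θ hR ρ * A = B * Model.rotOp hij θ hR ρ ↔
      ∀ x y v, B (site (rot hij hR y) (ρ v)) (rot hij hR x) = ρ (A (site y v) x) := by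
  constructor
  · intro h x y v
    have := congrArg (fun D : C.Op => D (site y v) (rot hij hR x)) h
    simp only [mul_apply_eq_comp, rotOp_site, rotOp_apply_rot] at this
    exact this.symm
  · intro h
    refine op_ext fun y v x => ?_
    obtain ⟨x, rfl⟩ := (rot hij hR).surjective x
    rw [mul_apply_eq_comp, mul_apply_eq_comp, rotOp_site,
      rotOp_apply_rot, h]

theorem diagTrace_rot {A B : C.Op}
    (h : Model.rotOp hij θ hR ρ * A = B * Model.rotOp hij θ hR ρ) (x : C.sites) :
    C.diagTrace B (rot hij hR x) = C.diagTrace A x := by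
  rw [intertwine_iff] at h
  rw [Crystal.diagTrace, Crystal.diagTrace,
    ← LinearMap.trace_conj' (entry A x x : Spin N →ₗ[ℂ] Spin N) ρ.toLinearEquiv]
  congr 1
  ext1 v
  have := h x x (ρ.symm v)
  rw [LinearIsometryEquiv.apply_symm_apply] at this
  exact this

/-- The commutators with `X_i` and `X_j` of a rotation invariant operator rotate as a vector. -/
theorem KerDer.rot {A Bi Bj : C.Op}
    (hA : Model.rotOp hij θ hR ρ * A = A * Model.rotOp hij θ hR ρ)
    (hi : KerDer i A Bi) (hj : KerDer j A Bj) :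
    Model.rotOp hij θ hR ρ * Bi
        = ((Real.cos θ : ℂ) • Bi + (Real.sin θ : ℂ) • Bj) * Model.rotOp hij θ hR ρ ∧
    Model.rotOp hij θ hR ρ * Bj
        = ((Real.cos θ : ℂ) • Bj - (Real.sin θ : ℂ) • Bi) * Model.rotOp hij θ hR ρ := by
  rw [intertwine_iff] at hA
  have hcs : (Real.sin θ : ℂ) ^ 2 + (Real.cos θ : ℂ) ^ 2 = 1 := by
    exact_mod_cast Real.sin_sq_add_cos_sq θ
  have hci : ∀ x : C.sites, co i (SCond.rot hij hR x)
      = (Real.cos θ : ℂ) * co i x - (Real.sin θ : ℂ) * co j x := fun x => by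
    rw [co, coe_rot, rotVec_apply_fst]; push_cast; rfl
  have hcj : ∀ x : C.sites, co j (SCond.rot hij hR x)
      = (Real.sin θ : ℂ) * co i x + (Real.cos θ : ℂ) * co j x := fun x => by
    rw [co, coe_rot, rotVec_apply_snd hij]; push_cast; rfl
  constructor
  · rw [intertwine_iff]
    intro x y v
    show (Real.cos θ : ℂ) • Bi _ _ + (Real.sin θ : ℂ) • Bj _ _ = _
    rw [hi, hj, hi, hA, hci, hci, hcj, hcj, map_smul, smul_smul, smul_smul, ← add_smul]
    congr 1
    linear_combination (co i y - co i x) * hcs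
  · rw [intertwine_iff]
    intro x y v
    show (Real.cos θ : ℂ) • Bj _ _ - (Real.sin θ : ℂ) • Bi _ _ = _
    rw [hi, hj, hj, hA, hci, hci, hcj, hcj, map_smul, smul_smul, smul_smul, ← sub_smul]
    congr 1
    linear_combination (co j y - co j x) * hcs

/-- The commutation is tested on δ_p ⊗ v with v ≠ 0 and evaluated at the rotated site: one side is ρ
v, and the other is zero unless that site lies in the orbit. -/
theorem rot_mem_orbit [Nontrivial (Spin N)] {a : Fin d → Sp d} {P : Set (Sp d)}
    (h : chi C.sites (Spin N) (orbit a P) * Model.rotOp hij θ hR ρ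
      = Model.rotOp hij θ hR ρ * chi C.sites (Spin N) (orbit a P)) {p : C.sites}
    (hp : (p : Sp d) ∈ P) : rotVec i j θ p ∈ orbit a P := by
  obtain ⟨v, hv⟩ := exists_ne (0 : Spin N)
  have hpo : (p : Sp d) ∈ orbit a P := ⟨0, zero_mem _, p, hp, (add_zero _).symm⟩
  have h1 := congrArg (fun D : C.Op => D (site p v) (rot hij hR p)) h
  simp only [mul_apply_eq_comp, rotOp_site, chi_site_of_mem hpo, chi_apply,
    site_apply_self] at h1
  by_contra hne
  rw [if_neg (by rwa [coe_rot])] at h1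
  exact hv (by simpa using h1.symm)

end Rotation

namespace Model

variable {d N : ℕ} {C : Crystal d N} (Q : Model C)

/-- The pair of diagonal traces for the directions i and j is rotated by R, and is unchanged by it
because R acts on a suitable representative of x as a lattice translation. -/
theorem diagTrace_torque_Pi1_eq_zero {i j : Fin d} (hij : i ≠ j) {n : ℕ} (hn : 2 ≤ n)
    {ρ : Spin N ≃ₗᵢ[ℂ] Spin N} {b : Fin d → Sp d} (hsym : Q.RotSymmetric i j hij n ρ b)
    (hrank : PiecesRankOne C b) (x : C.sites) : C.diagTrace (Q.torque * Q.Pi1 j) x = 0 := by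
  -- For N = 0 the symmetry of the characteristic functions says nothing about sites, but every
  -- trace is zero.
  rcases subsingleton_or_nontrivial (Spin N) with hsub | hnt
  · have h0 : (entry (Q.torque * Q.Pi1 j) x x : Spin N →ₗ[ℂ] Spin N) = 0 :=
      LinearMap.ext fun v => Subsingleton.elim _ _
    rw [Crystal.diagTrace, h0, map_zero]
  set θ := 2 * Real.pi / n with hθ
  have hR := hsym.sites_rot
  set W := rotOp hij θ hR ρ with hW
  have hH : Commute W Q.H0 := hsym.H0_rot.symm
  have hP : W * Q.Pi0 = Q.Pi0 * W := Q.commute_Pi0 hH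
  have hS : W * Q.S = Q.S * W := by
    refine intertwine_iff.2 fun x y v => ?_
    rw [S, fibreOp_apply, fibreOp_apply]
    by_cases h : x = y
    · subst h; rw [site_apply_self, site_apply_self, hsym.s_rot]
    · rw [site_apply_ne h, site_apply_ne (fun h' => h ((rot hij hR).injective h'))]
      simp
  have hSW : Commute W Q.S := hS
  have hK : W * Q.torque = Q.torque * W :=
    ((hH.mul_right hSW).sub_right (hSW.mul_right hH)).eq
  obtain ⟨hGi, hGj⟩ := KerDer.rot hP (Q.hasDer_Pi0 i).kerDer (Q.hasDer_Pi0 j).kerDer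
  have hder : ∀ k, I • Q.dP k = -Q.derPi0 k := fun k => by rw [derPi0_eq, neg_neg]
  -- Since R commutes with H₀, Π₀ and [H₀, S], a rotation law for [Π₀, X_k] passes through ℐ and the
  -- product with the torque without change of coefficients.
  have hlin : ∀ (k l : Fin d) (c s : ℂ),
      W * (I • Q.dP k) = (c • (I • Q.dP k) + s • (I • Q.dP l)) * W →
      W * (Q.torque * Q.Pi1 k) = (c • (Q.torque * Q.Pi1 k) + s • (Q.torque * Q.Pi1 l)) * W := by
    intro k l c s h
    have h1 : W * Q.derPi0 k = (c • Q.derPi0 k + s • Q.derPi0 l) * W := by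
      rw [hder, hder, mul_neg, smul_neg, smul_neg, ← neg_add, neg_mul] at h
      exact neg_injective h
    have h2 : W * Q.Pi1 k = (c • Q.Pi1 k + s • Q.Pi1 l) * W := by
      simp only [Pi1, invLiouville_eq]
      rw [Q.mul_sw hH, ← sw_smul, ← sw_smul, add_mul, Q.sw_mul hH, Q.sw_mul hH]
      have hadd : ∀ B D, Q.sw B + Q.sw D = Q.sw (B + D) := fun B D => by
        rw [← sub_neg_eq_add B D, sw_sub, ← neg_one_smul ℂ D, sw_smul, neg_one_smul,
          sub_neg_eq_add]
      rw [hadd, mul_sub, ← mul_assoc, h1, ← mul_assoc, hP, mul_assoc Q.Pi0 W, h1]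
      congr 1
      rw [mul_assoc _ W, hP]
      simp only [smul_sub, mul_add, add_mul, sub_mul, smul_mul_assoc, mul_smul_comm, mul_assoc]
      abel
    rw [← mul_assoc, hK, mul_assoc, h2, ← mul_assoc, mul_add, mul_smul_comm, mul_smul_comm]
  have hrotj := hlin j i (Real.cos θ) (-(Real.sin θ : ℂ)) (by
    rw [hGj, neg_smul, ← sub_eq_add_neg])
  have hroti := hlin i j (Real.cos θ) (Real.sin θ) hGi
  -- One translation brings x to a point p of the second cell. A further translation of p into the
  -- first cell identifies the piece that contains p.
  obtain ⟨γb, hγb, hcb⟩ := exists_sub_mem_cell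
    (fun γ hγ x hx => C.add_mem γ (hsym.basis ▸ hγ) x hx)
    (span_real_eq_top C.linInd hsym.basis) x.2
  rw [hsym.basis] at hγb
  set p : C.sites := ⟨x - γb, hcb.1⟩ with hp
  obtain ⟨γ, hγ, hca⟩ := exists_sub_mem_cell C.add_mem C.span_a p.2
  have hpp : (p : Sp d) ∈ piece C.sites C.a b (-γ) := by
    refine ⟨?_, hcb⟩
    rwa [← sub_eq_add_neg]
  have hmem := rot_mem_orbit (hsym.piece_rot (-γ) (neg_mem hγ)) hpp
  obtain ⟨η, hη, q, hq, hqe⟩ := hmem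
  have hqp : (⟨q, hq.2.1⟩ : C.sites) = p :=
    eq_of_finrank_range_chi (hrank (-γ) (neg_mem hγ) ⟨_, hpp⟩) hq hpp
  -- The rotated p is a lattice translate of some point of the same piece, whose only point is p.
  have hrp : rot hij hR p = C.shift ⟨η, hη⟩ p := by
    ext1
    rw [coe_rot, hqe, Crystal.coe_shift, ← hqp]
  have hinv : ∀ k, C.IsInvariant (C.diagTrace (Q.torque * Q.Pi1 k)) := fun k =>
    Crystal.isInvariant_diagTrace (Q.isPeriodic_torque.mul (Q.isPeriodic_Pi1 k))
  have e1 := diagTrace_rot hrotj p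
  have e2 := diagTrace_rot hroti p
  rw [Crystal.diagTrace_add, Crystal.diagTrace_smul, Crystal.diagTrace_smul, hrp, hinv, hinv]
    at e1 e2
  have hx : x = C.shift ⟨γb, hγb⟩ p := by ext1; simp [hp]
  rw [hx, hinv]
  have hcs : (Real.sin θ : ℂ) ^ 2 + (Real.cos θ : ℂ) ^ 2 = 1 := by
    exact_mod_cast Real.sin_sq_add_cos_sq θ
  have hc : (Real.cos θ : ℂ) ≠ 1 := by
    have hn' : (2 : ℝ) ≤ n := by exact_mod_cast hn
    have hθ0 : 0 < θ := by have := Real.pi_pos; positivity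
    have hθ1 : θ < 2 * Real.pi := by
      rw [hθ, div_lt_iff₀ (by linarith)]
      nlinarith [Real.pi_pos]
    intro h
    have h' : Real.cos θ = 1 := by exact_mod_cast h
    rw [Real.cos_eq_one_iff_of_lt_of_lt (by linarith) hθ1] at h'
    exact hθ0.ne' h'
  -- The factor is the determinant of the rotation minus the identity. It is nonzero because 0 < θ <
  -- 2π.
  have key : (2 - 2 * (Real.cos θ : ℂ)) * C.diagTrace (Q.torque * Q.Pi1 j) p = 0 := by
    linear_combination ((Real.cos θ : ℂ) - 1) * e1 + (Real.sin θ : ℂ) * e2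
      - C.diagTrace (Q.torque * Q.Pi1 j) p * hcs
  rcases mul_eq_zero.1 key with h | h
  · exact absurd (by linear_combination -h / 2) hc
  · exact h

theorem sigma_of_rotSymmetric {i j : Fin d} (hij : i ≠ j) {n : ℕ} (hn : 2 ≤ n)
    {ρ : Spin N ≃ₗᵢ[ℂ] Spin N} {b : Fin d → Sp d} (hsym : Q.RotSymmetric i j hij n ρ b)
    (hrank : PiecesRankOne C b) :
    Q.IsSigmaRot i j 0 ∧ ∃ σ : ℝ, Q.IsSigmaProp i j σ ∧ Q.IsSigmaConv i j σ :=
  Q.sigma_of_diagTrace_eq_zero i j (Q.diagTrace_torque_Pi1_eq_zero hij hn hsym hrank)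

end Model

end

end SCond

namespace SCond
noncomputable section

open Complex (I)

/-! ### Threefold symmetry of the honeycomb structure -/

section HoneycombGeometry

theorem mem_honeyLattice_of_coord {γ : Sp 2} (m n : ℤ) (h0 : γ 0 = √3 * m - √3 / 2 * n)
    (h1 : γ 1 = 3 / 2 * n) : γ ∈ lattice honeyBasis := by
  rw [lattice, Submodule.mem_span_range_iff_exists_fun]
  refine ⟨![m, n], ?_⟩
  ext k
  fin_cases k
  · simp [Fin.sum_univ_two, honeyBasis, h0]; ring
  · simp [Fin.sum_univ_two, honeyBasis, h1]; ring

/-- The angle `θ` is `2π/3` or `-2π/3`, up to full turns. -/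
def IsThirdTurn (θ : ℝ) : Prop :=
  Real.cos θ = -1 / 2 ∧ (Real.sin θ = √3 / 2 ∨ Real.sin θ = -(√3 / 2))

theorem isThirdTurn_two_pi_div_three : IsThirdTurn (2 * Real.pi / 3) := by
  have h : 2 * Real.pi / 3 = Real.pi - Real.pi / 3 := by ring
  refine ⟨?_, .inl ?_⟩
  · rw [h, Real.cos_pi_sub, Real.cos_pi_div_three]; norm_num
  · rw [h, Real.sin_pi_sub, Real.sin_pi_div_three]

theorem IsThirdTurn.neg {θ : ℝ} (h : IsThirdTurn θ) : IsThirdTurn (-θ) := by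
  refine ⟨by rw [Real.cos_neg, h.1], ?_⟩
  rw [Real.sin_neg]
  rcases h.2 with h | h
  · exact .inr (by rw [h])
  · exact .inl (by rw [h, neg_neg])

/-- The rotation of the plane. -/
abbrev turn (θ : ℝ) (x : Sp 2) : Sp 2 := rotVec 0 1 θ x

theorem turn_apply_zero (θ : ℝ) (x : Sp 2) :
    turn θ x 0 = Real.cos θ * x 0 - Real.sin θ * x 1 := by simp [turn, rotVec]

theorem turn_apply_one (θ : ℝ) (x : Sp 2) :
    turn θ x 1 = Real.sin θ * x 0 + Real.cos θ * x 1 := by simp [turn, rotVec]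

theorem turn_add (θ : ℝ) (x y : Sp 2) : turn θ (x + y) = turn θ x + turn θ y := by
  ext k
  fin_cases k
  · simp [turn_apply_zero]; ring
  · simp [turn_apply_one]; ring

theorem turn_smul (θ c : ℝ) (x : Sp 2) : turn θ (c • x) = c • turn θ x := by
  ext k
  fin_cases k
  · simp [turn_apply_zero]; ring
  · simp [turn_apply_one]; ring

/-- The rotation of the plane as a linear map. -/
def turnL (θ : ℝ) : Sp 2 →ₗ[ℝ] Sp 2 where
  toFun := turn θ
  map_add' := turn_add θ
  map_smul' := turn_smul θ

theorem turn_sub (θ : ℝ) (x y : Sp 2) : turn θ (x - y) = turn θ x - turn θ y :=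
  map_sub (turnL θ) x y

theorem turn_neg_turn (θ : ℝ) (x : Sp 2) : turn (-θ) (turn θ x) = x :=
  rotVec_neg_rotVec (by decide) θ x

theorem turn_turn_neg (θ : ℝ) (x : Sp 2) : turn θ (turn (-θ) x) = x :=
  rotVec_rotVec_neg (by decide) θ x

theorem norm_turn (θ : ℝ) (x : Sp 2) : ‖turn θ x‖ = ‖x‖ := by
  rw [EuclideanSpace.norm_eq, EuclideanSpace.norm_eq]
  congr 1
  simp only [Fin.sum_univ_two, Real.norm_eq_abs, sq_abs, turn_apply_zero, turn_apply_one]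
  linear_combination (x 0 ^ 2 + x 1 ^ 2) * Real.sin_sq_add_cos_sq θ

theorem dist_turn (θ : ℝ) (x y : Sp 2) : dist (turn θ x) (turn θ y) = dist x y := by
  rw [dist_eq_norm, ← turn_sub, norm_turn, ← dist_eq_norm]

variable {θ : ℝ}

theorem IsThirdTurn.turn_mem (h : IsThirdTurn θ) {γ : Sp 2} (hγ : γ ∈ lattice honeyBasis) :
    turn θ γ ∈ lattice honeyBasis := by
  obtain ⟨m, n, h0, h1⟩ := mem_honeyLattice hγ
  have h3 : √3 * √3 = (3 : ℝ) := Real.mul_self_sqrt (by norm_num)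
  rcases h.2 with hs | hs
  -- The rotation by 2π/3 sends the first basis vector to the second, and the second to minus the
  -- sum of both.
  · refine mem_honeyLattice_of_coord (-n) (m - n) ?_ ?_
    · rw [turn_apply_zero, h.1, hs, h0, h1]; push_cast; ring
    · rw [turn_apply_one, h.1, hs, h0, h1]; push_cast; linear_combination (m / 2 - n / 4 : ℝ) * h3
  · refine mem_honeyLattice_of_coord (n - m) (-m) ?_ ?_
    · rw [turn_apply_zero, h.1, hs, h0, h1]; push_cast; ring
    · rw [turn_apply_one, h.1, hs, h0, h1]; push_cast; linear_combination (-m / 2 + n / 4 : ℝ) * h3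

theorem IsThirdTurn.turn_mem_iff (h : IsThirdTurn θ) {γ : Sp 2} :
    γ ∈ lattice honeyBasis ↔ turn θ γ ∈ lattice honeyBasis :=
  ⟨h.turn_mem, fun h' => by simpa [turn_neg_turn] using h.neg.turn_mem h'⟩

theorem IsThirdTurn.turn_offset_sub_mem (h : IsThirdTurn θ) :
    turn θ honeyOffset - honeyOffset ∈ lattice honeyBasis := by
  have h3 : √3 * √3 = (3 : ℝ) := Real.mul_self_sqrt (by norm_num)
  rcases h.2 with hs | hs
  · refine mem_honeyLattice_of_coord 0 1 ?_ ?_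
    · rw [PiLp.sub_apply, turn_apply_zero, h.1, hs]; simp [honeyOffset]; ring
    · rw [PiLp.sub_apply, turn_apply_one, h.1, hs]; simp [honeyOffset]; linear_combination h3 / 4
  · refine mem_honeyLattice_of_coord (-1) 0 ?_ ?_
    · rw [PiLp.sub_apply, turn_apply_zero, h.1, hs]; simp [honeyOffset]; ring
    · rw [PiLp.sub_apply, turn_apply_one, h.1, hs]; simp [honeyOffset]; linear_combination -h3 / 4

theorem IsThirdTurn.turn_offset_ne (h : IsThirdTurn θ) :
    turn θ honeyOffset ≠ honeyOffset := by
  intro he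
  have h0 := congrArg (fun v : Sp 2 => v 0) he
  have h3 : (0 : ℝ) < √3 := by positivity
  simp only [turn_apply_zero, h.1] at h0
  rcases h.2 with hs | hs <;> rw [hs] at h0 <;> simp [honeyOffset] at h0 <;> linarith

/-- The rotation by a third of a turn maps each site to a lattice translate of it. -/
theorem IsThirdTurn.turn_sub_mem (h : IsThirdTurn θ) {x : Sp 2} (hx : x ∈ honeyA ∪ honeyB) :
    turn θ x - x ∈ lattice honeyBasis := by
  rcases hx with hx | hx
  · have hx : x - honeyOffset ∈ lattice honeyBasis := hx
    have := add_mem (sub_mem (h.turn_mem hx) hx) h.turn_offset_sub_mem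
    rw [turn_sub] at this
    convert this using 1
    abel
  · have hx : x + honeyOffset ∈ lattice honeyBasis := hx
    have := sub_mem (sub_mem (h.turn_mem hx) hx) h.turn_offset_sub_mem
    rw [turn_add] at this
    convert this using 1
    abel

theorem IsThirdTurn.turn_mem_sites (h : IsThirdTurn θ) {x : Sp 2} (hx : x ∈ honeyA ∪ honeyB) :
    turn θ x ∈ honeyA ∪ honeyB := by
  simpa using honey_add_mem _ (h.turn_sub_mem hx) x hx

theorem IsThirdTurn.turn_mem_sites_iff (h : IsThirdTurn θ) {x : Sp 2} :
    x ∈ honeyA ∪ honeyB ↔ turn θ x ∈ honeyA ∪ honeyB :=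
  ⟨h.turn_mem_sites, fun h' => by simpa [turn_neg_turn] using h.neg.turn_mem_sites h'⟩

theorem mem_honeyA_add {x γ : Sp 2} (hγ : γ ∈ lattice honeyBasis) :
    x + γ ∈ honeyA ↔ x ∈ honeyA := by
  show x + γ - honeyOffset ∈ lattice honeyBasis ↔ x - honeyOffset ∈ lattice honeyBasis
  rw [add_sub_right_comm, Submodule.add_mem_iff_left _ hγ]

theorem mem_honeyB_add {x γ : Sp 2} (hγ : γ ∈ lattice honeyBasis) :
    x + γ ∈ honeyB ↔ x ∈ honeyB := by
  show x + γ + honeyOffset ∈ lattice honeyBasis ↔ x + honeyOffset ∈ lattice honeyBasis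
  rw [add_right_comm, Submodule.add_mem_iff_left _ hγ]

theorem IsThirdTurn.turn_mem_honeyA_iff (h : IsThirdTurn θ) {x : Sp 2}
    (hx : x ∈ honeyA ∪ honeyB) : turn θ x ∈ honeyA ↔ x ∈ honeyA := by
  simpa using mem_honeyA_add (x := x) (h.turn_sub_mem hx)

theorem IsThirdTurn.turn_mem_honeyB_iff (h : IsThirdTurn θ) {x : Sp 2}
    (hx : x ∈ honeyA ∪ honeyB) : turn θ x ∈ honeyB ↔ x ∈ honeyB := by
  simpa using mem_honeyB_add (x := x) (h.turn_sub_mem hx)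

theorem offset_mem_cell : honeyOffset ∈ cell (honeyA ∪ honeyB) honeyBasis 1 := by
  refine ⟨.inl (by simp [honeyA]), ![1 / 3, -1 / 3], ?_, ?_⟩
  · ext k
    fin_cases k
    · simp [Fin.sum_univ_two, honeyBasis, honeyOffset]; ring
    · simp [Fin.sum_univ_two, honeyBasis, honeyOffset]; ring
  · intro j
    fin_cases j <;> norm_num [abs_le]

theorem neg_mem_cell {x : Sp 2} (h : x ∈ cell (honeyA ∪ honeyB) honeyBasis 1) :
    -x ∈ cell (honeyA ∪ honeyB) honeyBasis 1 := by
  obtain ⟨hx, α, hα, hb⟩ := h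
  refine ⟨?_, -α, by simp [hα], by simpa using hb⟩
  rcases hx with hx | hx
  · right
    show -x + honeyOffset ∈ lattice honeyBasis
    simpa [sub_eq_add_neg, add_comm] using
      neg_mem (show x - honeyOffset ∈ lattice honeyBasis from hx)
  · left
    show -x - honeyOffset ∈ lattice honeyBasis
    simpa [sub_eq_add_neg, add_comm] using
      neg_mem (show x + honeyOffset ∈ lattice honeyBasis from hx)

theorem eq_of_mem_cell {X : Set (Sp 2)} {a : Fin 2 → Sp 2} (h : IsPrimitiveCell X a) {x y : Sp 2}
    (hx : x ∈ cell X a 1) (hy : y ∈ cell X a 1) (hxy : x - y ∈ lattice a) : x = y := by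
  by_contra hne
  exact h _ hxy (sub_ne_zero.2 hne) y hy (by rwa [add_sub_cancel])

theorem eq_offset_of_mem_cell {x : Sp 2} (hx : x ∈ cell (honeyA ∪ honeyB) honeyBasis 1)
    (hA : x ∈ honeyA) : x = honeyOffset :=
  eq_of_mem_cell honey_primitive hx offset_mem_cell hA

theorem eq_neg_offset_of_mem_cell {x : Sp 2} (hx : x ∈ cell (honeyA ∪ honeyB) honeyBasis 1)
    (hB : x ∈ honeyB) : x = -honeyOffset :=
  eq_of_mem_cell honey_primitive hx (neg_mem_cell offset_mem_cell) (by rwa [sub_neg_eq_add])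

/-- The rotated lattice basis. -/
def turnBasis (θ : ℝ) (k : Fin 2) : Sp 2 := turn θ (honeyBasis k)

theorem sum_turnBasis (θ : ℝ) (α : Fin 2 → ℝ) :
    ∑ j, α j • turnBasis θ j = turn θ (∑ j, α j • honeyBasis j) := by
  show _ = turnL θ _
  rw [map_sum]
  exact Finset.sum_congr rfl fun j _ => (map_smul (turnL θ) _ _).symm

theorem IsThirdTurn.mem_cell_turnBasis (h : IsThirdTurn θ) {x : Sp 2}
    (hx : x ∈ cell (honeyA ∪ honeyB) (turnBasis θ) 1) :
    turn (-θ) x ∈ cell (honeyA ∪ honeyB) honeyBasis 1 := by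
  obtain ⟨hx, α, hα, hb⟩ := hx
  exact ⟨h.neg.turn_mem_sites hx, α, by rw [hα, sum_turnBasis, turn_neg_turn], hb⟩

theorem IsThirdTurn.lattice_turnBasis (h : IsThirdTurn θ) :
    lattice (turnBasis θ) = lattice honeyBasis := by
  have hle : ∀ {φ : ℝ}, IsThirdTurn φ → lattice (turnBasis φ) ≤ lattice honeyBasis := fun hφ => by
    rw [lattice, Submodule.span_le]
    rintro _ ⟨k, rfl⟩
    exact hφ.turn_mem (Submodule.subset_span ⟨k, rfl⟩)
  refine le_antisymm (hle h) fun γ hγ => ?_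
  have hγ' := h.neg.turn_mem hγ
  rw [lattice, Submodule.mem_span_range_iff_exists_fun] at hγ' ⊢
  obtain ⟨c, hc⟩ := hγ'
  refine ⟨c, ?_⟩
  have := sum_turnBasis θ (fun j => (c j : ℝ))
  simp only [Int.cast_smul_eq_zsmul] at this
  rw [this, hc, turn_turn_neg]

theorem IsThirdTurn.primitive_turnBasis (h : IsThirdTurn θ) :
    IsPrimitiveCell (honeyA ∪ honeyB) (turnBasis θ) := by
  intro γ hγ hne x hx hx'
  rw [h.lattice_turnBasis] at hγ
  refine honey_primitive _ (h.neg.turn_mem hγ) (fun h0 => hne ?_) _ (h.mem_cell_turnBasis hx) ?_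
  · rw [← turn_turn_neg θ γ, h0]
    exact map_zero (turnL θ)
  · rw [← turn_add]
    exact h.mem_cell_turnBasis hx'

/-- Each cell has one site per sublattice: ±δ in the first and ±Rδ in the second, where δ =
`honeyOffset`. If a piece held both sublattices, then γ = δ - Rδ and γ = Rδ - δ, which forces Rδ =
δ. With b equal to the original basis, the piece γ = 0 would contain both sites. -/
theorem IsThirdTurn.eq_of_mem_piece (h : IsThirdTurn θ) {γ x y : Sp 2} (hγ : γ ∈ lattice honeyBasis)
    (hx : x ∈ piece (honeyA ∪ honeyB) honeyBasis (turnBasis θ) γ)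
    (hy : y ∈ piece (honeyA ∪ honeyB) honeyBasis (turnBasis θ) γ) : x = y := by
  have hA : ∀ {z : Sp 2}, z ∈ piece (honeyA ∪ honeyB) honeyBasis (turnBasis θ) γ → z ∈ honeyA →
      z = turn θ honeyOffset ∧ z + γ = honeyOffset := fun {z} hz hzA => by
    have hs : z ∈ honeyA ∪ honeyB := .inl hzA
    refine ⟨?_, eq_offset_of_mem_cell hz.1 ((mem_honeyA_add hγ).2 hzA)⟩
    rw [← eq_offset_of_mem_cell (h.mem_cell_turnBasis hz.2) ((h.neg.turn_mem_honeyA_iff hs).2 hzA),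
      turn_turn_neg]
  have hB : ∀ {z : Sp 2}, z ∈ piece (honeyA ∪ honeyB) honeyBasis (turnBasis θ) γ → z ∈ honeyB →
      z = -turn θ honeyOffset ∧ z + γ = -honeyOffset := fun {z} hz hzB => by
    have hs : z ∈ honeyA ∪ honeyB := .inr hzB
    refine ⟨?_, eq_neg_offset_of_mem_cell hz.1 ((mem_honeyB_add hγ).2 hzB)⟩
    rw [← show turn θ (-honeyOffset) = -turn θ honeyOffset from map_neg (turnL θ) _,
      ← eq_neg_offset_of_mem_cell (h.mem_cell_turnBasis hz.2)
        ((h.neg.turn_mem_honeyB_iff hs).2 hzB), turn_turn_neg]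
  have hAB : ∀ {z w : Sp 2}, z = turn θ honeyOffset ∧ z + γ = honeyOffset →
      w = -turn θ honeyOffset ∧ w + γ = -honeyOffset → False := by
    rintro z w ⟨rfl, h1⟩ ⟨rfl, h2⟩
    refine h.turn_offset_ne ?_
    have h3 : (2 : ℝ) • turn θ honeyOffset = (2 : ℝ) • honeyOffset := by
      rw [two_smul, two_smul]
      calc _ = turn θ honeyOffset + γ - (-turn θ honeyOffset + γ) := by abel
        _ = _ := by rw [h1, h2]; abel
    exact smul_right_injective _ (two_ne_zero (α := ℝ)) h3
  rcases hx.2.1 with hxA | hxB <;> rcases hy.2.1 with hyA | hyB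
  · rw [(hA hx hxA).1, (hA hy hyA).1]
  · exact (hAB (hA hx hxA) (hB hy hyB)).elim
  · exact (hAB (hA hy hyA) (hB hx hxB)).elim
  · rw [(hB hx hxB).1, (hB hy hyB).1]

theorem finrank_range_chi_eq_one {d : ℕ} {X : Set (Sp d)} {Ω : Set (Sp d)} (p : X)
    (hp : (p : Sp d) ∈ Ω) (hΩ : ∀ x ∈ Ω, x = (p : Sp d)) :
    Module.finrank ℂ (LinearMap.range (chi X ℂ Ω).toLinearMap) = 1 := by
  refine finrank_eq_one (⟨site p 1, site p 1, chi_site_of_mem hp 1⟩ :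
    LinearMap.range (chi X ℂ Ω).toLinearMap) ?_ ?_
  · intro h0
    have h1 := congrArg (fun f : Hilb X ℂ => f p) (congrArg Subtype.val h0)
    simp at h1
  · rintro ⟨_, ψ, rfl⟩
    refine ⟨ψ p, Subtype.ext ?_⟩
    show ψ p • site p (1 : ℂ) = chi X ℂ Ω ψ
    ext x : 2
    rw [chi_apply, ← site_smul, smul_eq_mul, mul_one]
    by_cases hx : x = p
    · subst hx; rw [site_apply_self, if_pos hp]
    · rw [site_apply_ne hx, if_neg fun h' => hx (Subtype.ext (hΩ _ h'))]

theorem IsThirdTurn.piecesRankOne (h : IsThirdTurn θ) : PiecesRankOne honeycomb (turnBasis θ) := by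
  rintro γ hγ ⟨p, hp⟩
  exact finrank_range_chi_eq_one ⟨p, hp.2.1⟩ hp fun x hx => h.eq_of_mem_piece hγ hx hp

/-- The rotation moves every site by a lattice vector, so on sites it preserves any
lattice-invariant set. -/
theorem IsThirdTurn.turn_mem_orbit_iff (h : IsThirdTurn θ) {P : Set (Sp 2)} {x : Sp 2}
    (hx : x ∈ honeyA ∪ honeyB) : turn θ x ∈ orbit honeyBasis P ↔ x ∈ orbit honeyBasis P := by
  have hm := h.turn_sub_mem hx
  constructor
  · rintro ⟨η, hη, p, hp, he⟩
    exact ⟨η - (turn θ x - x), sub_mem hη hm, p, hp, by rw [he]; abel⟩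
  · rintro ⟨η, hη, p, hp, he⟩
    exact ⟨η + (turn θ x - x), add_mem hη hm, p, hp, by rw [← add_assoc, ← he]; abel⟩

end HoneycombGeometry

end

end SCond

namespace SCond
noncomputable section

open Complex (I)

/-! ### The Kane–Mele Hamiltonian and its symmetries -/

section KaneMele

/-- The sign is built from sites, bond lengths and cross products only. Reindexing the intermediate
site then covers translations and rotations at once. -/
theorem kmNu_equiv (e : Sp 2 ≃ Sp 2) (hs : ∀ z, e z ∈ honeyA ∪ honeyB ↔ z ∈ honeyA ∪ honeyB)
    (hd : ∀ x y, dist (e x) (e y) = dist x y)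
    (hc : ∀ x y z, (e z - e y) 0 * (e x - e z) 1 - (e z - e y) 1 * (e x - e z) 0
      = (z - y) 0 * (x - z) 1 - (z - y) 1 * (x - z) 0) (x y : Sp 2) :
    kmNu (e x) (e y) = kmNu x y := by
  rw [kmNu, kmNu, ← finsum_comp_equiv e]
  refine finsum_congr fun z => ?_
  rw [hc, hd, hd]
  exact finsum_congr_Prop (by rw [hs]) fun _ => rfl

theorem kmNu_add {γ : Sp 2} (hγ : γ ∈ lattice honeyBasis) (x y : Sp 2) :
    kmNu (x + γ) (y + γ) = kmNu x y :=
  kmNu_equiv (Equiv.addRight γ)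
    (fun z => or_congr (mem_honeyA_add hγ) (mem_honeyB_add hγ))
    (fun x y => dist_add_right x y γ)
    (fun x y z => by simp only [Equiv.coe_addRight, add_sub_add_right_eq_sub]) x y

/-- Reversing the path exchanges the two bonds and negates both, so the cross product changes sign.
This makes i λ_SO ν σ_z Hermitian. -/
theorem kmNu_swap (x y : Sp 2) : kmNu y x = -kmNu x y := by
  rw [kmNu, kmNu, ← finsum_neg_distrib]
  refine finsum_congr fun z => ?_
  rw [← finsum_neg_distrib]
  refine finsum_congr_Prop ?_ fun _ => ?_
  · rw [dist_comm z x, dist_comm y z]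
    exact propext ⟨fun h => ⟨h.1, h.2.2, h.2.1⟩, fun h => ⟨h.1, h.2.2, h.2.1⟩⟩
  · simp only [PiLp.sub_apply]
    ring

theorem kmNu_turn {θ : ℝ} (h : IsThirdTurn θ) (x y : Sp 2) :
    kmNu (turn θ x) (turn θ y) = kmNu x y :=
  kmNu_equiv ⟨turn θ, turn (-θ), turn_neg_turn θ, turn_turn_neg θ⟩
    (fun z => h.turn_mem_sites_iff.symm) (dist_turn θ)
    (fun x y z => by
      simp only [Equiv.coe_fn_mk, ← turn_sub, turn_apply_zero, turn_apply_one]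
      linear_combination ((z - y) 0 * (x - z) 1 - (z - y) 1 * (x - z) 0)
        * Real.sin_sq_add_cos_sq θ) x y

variable (t lso lr lv : ℝ)

theorem bond_eq (a b : ℂ) : (t : ℂ) • 1 + (I * lr) • (a • pauliX - b • pauliY)
    = !![(t : ℂ), I * lr * (a + I * b); I * lr * (a - I * b), (t : ℂ)] := by
  ext k l
  fin_cases k <;> fin_cases l <;> simp [pauliX, pauliY] <;> exact .inl (by ring)

theorem smul_pauliZ (c : ℂ) : c • pauliZ = !![c, 0; 0, -c] := by
  ext k l
  fin_cases k <;> fin_cases l <;> simp [pauliZ]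

open scoped Classical in
theorem kmHop_add {γ : Sp 2} (hγ : γ ∈ lattice honeyBasis) (x y : Sp 2) :
    kmHop t lso lr lv (x + γ) (y + γ) = kmHop t lso lr lv x y := by
  have hA : (if x + γ ∈ honeyA then lv else -lv) = if x ∈ honeyA then lv else -lv :=
    if_congr (mem_honeyA_add hγ) rfl rfl
  simp only [kmHop, dist_add_right, add_sub_add_right_eq_sub, kmNu_add hγ, add_left_inj]
  rw [hA]

theorem kmHop_eq_zero {x y : Sp 2} (h : √3 < dist x y) : kmHop t lso lr lv x y = 0 := by
  have h1 : (1 : ℝ) ≤ √3 := Real.one_le_sqrt.2 (by norm_num)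
  have h2 : x ≠ y := by
    rintro rfl
    rw [dist_self] at h
    linarith
  rw [kmHop, if_neg (by linarith), if_neg h.ne', if_neg h2, add_zero, add_zero]

open scoped Classical in
theorem kmHop_conjTranspose (x y : Sp 2) :
    (kmHop t lso lr lv x y).conjTranspose = kmHop t lso lr lv y x := by
  have e3 : (if x = y then (((if x ∈ honeyA then lv else -lv : ℝ) : ℂ)
      • (1 : Matrix (Fin 2) (Fin 2) ℂ)) else 0).conjTranspose
      = if y = x then (((if y ∈ honeyA then lv else -lv : ℝ) : ℂ) • 1) else 0 := by
    by_cases h : x = y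
    · subst h
      rw [if_pos rfl, Matrix.conjTranspose_smul, Matrix.conjTranspose_one, Complex.star_def,
        Complex.conj_ofReal]
    · rw [if_neg h, if_neg (Ne.symm h), Matrix.conjTranspose_zero]
  rw [kmHop, kmHop, Matrix.conjTranspose_add, Matrix.conjTranspose_add, e3, dist_comm y x,
    kmNu_swap x y]
  congr 2
  · split_ifs
    · rw [bond_eq, bond_eq]
      ext k l
      fin_cases k <;> fin_cases l <;> simp <;> ring
    · simp
  · split_ifs
    · rw [smul_pauliZ, smul_pauliZ]
      ext k l
      fin_cases k <;> fin_cases l <;> simp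
    · simp

/-- The rotation of the spin about the `z` axis, up to a global phase. -/
def spinTurnMat (θ : ℝ) : Matrix (Fin 2) (Fin 2) ℂ :=
  !![1, 0; 0, (Real.cos θ : ℂ) + I * (Real.sin θ : ℂ)]

-- For d = x - y the upper off-diagonal Rashba entry is a real multiple of d_x - i d_y, so rotation
-- multiplies it by e^{-iθ}. Conjugation by diag(1, e^{iθ}) supplies exactly this phase, while the
-- other terms are diagonal and rotation invariant.
open scoped Classical in
theorem kmHop_turn {θ : ℝ} (h : IsThirdTurn θ) {x y : Sp 2} (hx : x ∈ honeyA ∪ honeyB) :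
    kmHop t lso lr lv (turn θ x) (turn θ y) * spinTurnMat θ
      = spinTurnMat θ * kmHop t lso lr lv x y := by
  have hcs : (Real.sin θ : ℂ) ^ 2 + (Real.cos θ : ℂ) ^ 2 = 1 := by
    exact_mod_cast Real.sin_sq_add_cos_sq θ
  have hinj : turn θ x = turn θ y ↔ x = y :=
    ⟨fun h => by rw [← turn_neg_turn θ x, h, turn_neg_turn], fun h => by rw [h]⟩
  have hA : (if turn θ x ∈ honeyA then lv else -lv) = if x ∈ honeyA then lv else -lv :=
    if_congr (h.turn_mem_honeyA_iff hx) rfl rfl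
  simp only [kmHop, dist_turn, kmNu_turn h, hinj, ← turn_sub, bond_eq, smul_pauliZ]
  rw [hA]
  simp only [turn_apply_zero, turn_apply_one, add_mul, mul_add]
  generalize x - y = D
  refine congrArg₂ (· + ·) (congrArg₂ (· + ·) ?_ ?_) ?_
  · split_ifs
    · rw [spinTurnMat, Matrix.mul_fin_two, Matrix.mul_fin_two]
      push_cast at hcs ⊢
      congr 1
      ext k l
      fin_cases k <;> fin_cases l
      · simp
      · simp only [Fin.zero_eta, Fin.mk_one, Matrix.cons_val_zero, Matrix.cons_val_one]
        linear_combination (I * lr * (D 1 + I * D 0)) * hcs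
          + (I * lr * Complex.sin θ * (D 0 * Complex.cos θ - D 1 * Complex.sin θ)) * Complex.I_sq
      · simp only [Fin.zero_eta, Fin.mk_one, Matrix.cons_val_zero, Matrix.cons_val_one]
        linear_combination (I * lr * D 0 * Complex.sin θ) * Complex.I_sq
      · simp [mul_comm]
    · simp
  · split_ifs
    · rw [spinTurnMat, Matrix.mul_fin_two, Matrix.mul_fin_two]
      simp [mul_comm]
    · simp
  · split_ifs <;> simp

theorem spinTurnMat_mem (θ : ℝ) :
    Matrix.toEuclideanCLM (𝕜 := ℂ) (spinTurnMat θ) ∈ unitary (Spin 2 →L[ℂ] Spin 2) := by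
  have hcs : (Real.sin θ : ℂ) ^ 2 + (Real.cos θ : ℂ) ^ 2 = 1 := by
    exact_mod_cast Real.sin_sq_add_cos_sq θ
  have hstar : star (spinTurnMat θ)
      = !![1, 0; 0, (Real.cos θ : ℂ) - I * (Real.sin θ : ℂ)] := by
    rw [Matrix.star_eq_conjTranspose, spinTurnMat]
    ext k l
    fin_cases k <;> fin_cases l <;> simp only [Matrix.conjTranspose_apply] <;>
      simp [-Complex.ofReal_cos, -Complex.ofReal_sin]
    ring
  have h1 : star (spinTurnMat θ) * spinTurnMat θ = 1 := by
    rw [hstar, spinTurnMat, Matrix.mul_fin_two, Matrix.one_fin_two]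
    have : ((Real.cos θ : ℂ) - I * (Real.sin θ : ℂ)) * ((Real.cos θ : ℂ) + I * (Real.sin θ : ℂ))
        = 1 := by
      linear_combination hcs - (Real.sin θ : ℂ) ^ 2 * Complex.I_sq
    rw [zero_mul, zero_add, this]
    simp
  have h2 : spinTurnMat θ * star (spinTurnMat θ) = 1 := mul_eq_one_comm.1 h1
  rw [Unitary.mem_iff, ← map_star, ← map_mul, ← map_mul, h1, h2, map_one]
  exact ⟨rfl, rfl⟩

/-- The unitary `diag(1, e^{iθ})`. -/
def spinTurn (θ : ℝ) : Spin 2 ≃ₗᵢ[ℂ] Spin 2 := Unitary.linearIsometryEquiv ⟨_, spinTurnMat_mem θ⟩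

theorem spinTurn_apply (θ : ℝ) (v : Spin 2) :
    spinTurn θ v = Matrix.toEuclideanCLM (𝕜 := ℂ) (spinTurnMat θ) v := rfl

open scoped Classical in
theorem exists_isKaneMele : ∃ H0, IsKaneMele t lso lr lv H0 := by
  obtain ⟨n, hn⟩ := honeycomb.exists_op_of_kernel √3
  let k : honeycomb.sites → honeycomb.sites → Spin 2 →L[ℂ] Spin 2 := fun x y =>
    Matrix.toEuclideanCLM (𝕜 := ℂ) (kmHop t lso lr lv x y)
  -- The amplitudes are translation invariant, so each equals one issuing from a site of the
  -- fundamental cell. The finite sum of those norms is a crude uniform bound.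
  obtain ⟨A, -, hA⟩ := hn k (∑ c ∈ honeycomb.cellSites, ∑ y ∈ honeycomb.nbhd √3 c, ‖k c y‖)
    (Finset.sum_nonneg fun _ _ => Finset.sum_nonneg fun _ _ => norm_nonneg _) fun x y hxy => by
    obtain ⟨c, γ, hc, rfl⟩ := honeycomb.exists_shift x
    obtain ⟨z, rfl⟩ := (honeycomb.shift γ).surjective y
    rw [Crystal.dist_shift] at hxy
    have h : k (honeycomb.shift γ c) (honeycomb.shift γ z) = k c z :=
      congrArg (fun m => Matrix.toEuclideanCLM (𝕜 := ℂ) m) (kmHop_add t lso lr lv γ.2 c z)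
    rw [h]
    exact (Finset.single_le_sum (f := fun y => ‖k c y‖) (fun _ _ => norm_nonneg _)
      (honeycomb.mem_nbhd.2 hxy)).trans (Finset.single_le_sum
        (f := fun c => ∑ y ∈ honeycomb.nbhd √3 c, ‖k c y‖)
        (fun _ _ => Finset.sum_nonneg fun _ _ => norm_nonneg _) hc)
  refine ⟨A, fun x y v => ?_⟩
  rw [hA]
  split_ifs with h
  · rfl
  · rw [kmHop_eq_zero t lso lr lv (not_le.1 h), map_zero]; rfl

variable {t lso lr lv} {H0 : honeycomb.Op}

theorem inner_site {d : ℕ} {X : Set (Sp d)} {V : Type} [NormedAddCommGroup V]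
    [InnerProductSpace ℂ V] (x : X) (v : V) (ψ : Hilb X V) :
    inner ℂ (site x v) ψ = inner ℂ v (ψ x) := by
  classical
  rw [site]
  convert lp.inner_single_left (𝕜 := ℂ) (G := fun _ : X => V) x v ψ

theorem IsKaneMele.isSelfAdjoint (h : IsKaneMele t lso lr lv H0) : IsSelfAdjoint H0 := by
  refine op_ext fun y v x => ext_inner_left ℂ fun w => ?_
  rw [ContinuousLinearMap.star_eq_adjoint, ← inner_site, ContinuousLinearMap.adjoint_inner_right,
    ← inner_conj_symm, inner_site, inner_conj_symm, h, h, ← kmHop_conjTranspose,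
    ← Matrix.star_eq_conjTranspose, map_star, ContinuousLinearMap.star_eq_adjoint,
    ContinuousLinearMap.adjoint_inner_left]

theorem IsKaneMele.isPeriodic (h : IsKaneMele t lso lr lv H0) : honeycomb.IsPeriodic H0 := by
  refine Crystal.isPeriodic_iff.2 fun γ x y v => ?_
  show H0 (site (honeycomb.shift γ y) v) (honeycomb.shift γ x) = H0 (site y v) x
  rw [h, h]
  exact congrArg (fun m => Matrix.toEuclideanCLM (𝕜 := ℂ) m v) (kmHop_add t lso lr lv γ.2 x y)

theorem IsKaneMele.hasFiniteRange (h : IsKaneMele t lso lr lv H0) : honeycomb.HasFiniteRange H0 :=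
  ⟨√3, fun x y hxy v => by rw [h, kmHop_eq_zero t lso lr lv hxy, map_zero]; rfl⟩

theorem isSelfAdjoint_spinZ : IsSelfAdjoint spinZ := by
  rw [isSelfAdjoint_iff, spinZ, ← map_star, Matrix.star_eq_conjTranspose]
  congr 1
  ext k l
  fin_cases k <;> fin_cases l <;> simp [pauliZ]

theorem isPeriodic_fibreOp_honeycomb (s : Spin 2 →L[ℂ] Spin 2) :
    honeycomb.IsPeriodic (fibreOp honeycomb.sites s) := by
  refine Crystal.isPeriodic_iff.2 fun γ x y v => ?_
  show fibreOp honeycomb.sites s (site (honeycomb.shift γ y) v) (honeycomb.shift γ x)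
    = fibreOp honeycomb.sites s (site y v) x
  rw [fibreOp_apply, fibreOp_apply]
  by_cases h : x = y
  · subst h; rw [site_apply_self, site_apply_self]
  · rw [site_apply_ne h, site_apply_ne fun h' => h ((honeycomb.shift γ).injective h')]

/-- The Kane-Mele model with the spin operator `s_z`. -/
def kaneMele (h : IsKaneMele t lso lr lv H0) (μ : ℝ) (hμ : (μ : ℂ) ∉ spectrum ℂ H0) :
    Model honeycomb where
  H0 := H0
  selfAdjoint := h.isSelfAdjoint
  periodic := h.isPeriodic
  finiteRange := h.hasFiniteRange
  μ := μ
  gap := hμ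
  s := spinZ
  s_selfAdjoint := isSelfAdjoint_spinZ
  s_periodic := isPeriodic_fibreOp_honeycomb spinZ

theorem toEuclideanCLM_mul_apply (A B : Matrix (Fin 2) (Fin 2) ℂ) (v : Spin 2) :
    Matrix.toEuclideanCLM (𝕜 := ℂ) A (Matrix.toEuclideanCLM (𝕜 := ℂ) B v)
      = Matrix.toEuclideanCLM (𝕜 := ℂ) (A * B) v := by
  rw [map_mul]; rfl

theorem spinZ_spinTurn (θ : ℝ) (v : Spin 2) : spinZ (spinTurn θ v) = spinTurn θ (spinZ v) := by
  rw [spinTurn_apply, spinTurn_apply, spinZ, toEuclideanCLM_mul_apply, toEuclideanCLM_mul_apply]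
  congr 2
  ext k l
  fin_cases k <;> fin_cases l <;> simp [pauliZ, spinTurnMat]; ring

open scoped Classical in
theorem kaneMele_rotSymmetric (h : IsKaneMele t lso lr lv H0) {μ : ℝ}
    (hμ : (μ : ℂ) ∉ spectrum ℂ H0) {i j : Fin 2} (hij : i ≠ j) {n : ℕ} {θ : ℝ}
    (hθ : IsThirdTurn θ) (hrot : ∀ x, rotVec i j (2 * Real.pi / n) x = turn θ x) :
    (kaneMele h μ hμ).RotSymmetric i j hij n (spinTurn θ) (turnBasis θ) := by
  have hs : ∀ x, x ∈ honeycomb.sites ↔ rotVec i j (2 * Real.pi / n) x ∈ honeycomb.sites :=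
    fun x => hθ.turn_mem_sites_iff.trans (by rw [hrot x]; rfl)
  refine ⟨hθ.lattice_turnBasis, hθ.primitive_turnBasis,
    fun γ => by rw [hrot]; exact hθ.turn_mem_iff, hs, fun γ _ => ?_, ?_, spinZ_spinTurn θ⟩
  · refine Eq.symm (intertwine_iff.2 fun x y v => ?_)
    have hx : (rot hij hs x : Sp 2) ∈ orbit honeycomb.a
        (piece honeycomb.sites honeycomb.a (turnBasis θ) γ) ↔ (x : Sp 2) ∈ orbit honeycomb.a
        (piece honeycomb.sites honeycomb.a (turnBasis θ) γ) := by
      rw [coe_rot, hrot]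
      exact hθ.turn_mem_orbit_iff x.2
    rw [chi_apply, chi_apply]
    refine (if_congr hx rfl rfl).trans ?_
    rw [apply_ite (spinTurn θ), map_zero]
    congr 1
    by_cases hxy : x = y
    · subst hxy; rw [site_apply_self, site_apply_self]
    · rw [site_apply_ne hxy, site_apply_ne fun h' => hxy ((rot hij hs).injective h'), map_zero]
  · refine Eq.symm (intertwine_iff.2 fun x y v => ?_)
    refine (h _ _ _).trans (Eq.trans ?_ (congrArg (spinTurn θ) (h x y v).symm))
    rw [coe_rot, coe_rot, hrot, hrot, spinTurn_apply, spinTurn_apply, toEuclideanCLM_mul_apply,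
      toEuclideanCLM_mul_apply, kmHop_turn t lso lr lv hθ x.2]

/-- Exchanging the axes reverses the orientation of the plane, which is why `IsThirdTurn` admits
both signs of the sine. -/
theorem rotVec_swap (θ : ℝ) (x : Sp 2) : rotVec (1 : Fin 2) 0 θ x = turn (-θ) x := by
  ext k
  fin_cases k
  · simp [rotVec]; ring
  · simp [rotVec]; ring

/-- The choice is n = 3. A rotation by π/3 would exchange the sublattices, which the staggered
potential distinguishes and which no lattice translation can undo. -/
theorem kaneMele_exists_rotSymmetric (h : IsKaneMele t lso lr lv H0) {μ : ℝ}
    (hμ : (μ : ℂ) ∉ spectrum ℂ H0) {i j : Fin 2} (hij : i ≠ j) :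
    ∃ (n : ℕ) (ρ : Spin 2 ≃ₗᵢ[ℂ] Spin 2) (b : Fin 2 → Sp 2),
      2 ≤ n ∧ (kaneMele h μ hμ).RotSymmetric i j hij n ρ b ∧ PiecesRankOne honeycomb b := by
  have h3 : IsThirdTurn (2 * Real.pi / (3 : ℕ)) := by exact_mod_cast isThirdTurn_two_pi_div_three
  have key : ∃ θ, IsThirdTurn θ ∧ ∀ x, rotVec i j (2 * Real.pi / (3 : ℕ)) x = turn θ x := by
    fin_cases i <;> fin_cases j
    · exact absurd rfl hij
    · exact ⟨_, h3, fun _ => rfl⟩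
    · exact ⟨_, h3.neg, rotVec_swap _⟩
    · exact absurd rfl hij
  obtain ⟨θ, hθ, hrot⟩ := key
  exact ⟨3, spinTurn θ, turnBasis θ, by norm_num, kaneMele_rotSymmetric h hμ hij hθ hrot,
    hθ.piecesRankOne⟩

end KaneMele

end

end SCond

theorem proposition5p7 :
    (∀ (d N : ℕ) (C : SCond.Crystal d N) (Q : SCond.Model C) (i j : Fin d) (hij : i ≠ j)
        (n : ℕ) (_ : 2 ≤ n) (ρ : SCond.Spin N ≃ₗᵢ[ℂ] SCond.Spin N) (b : Fin d → SCond.Sp d),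
        Q.RotSymmetric i j hij n ρ b → SCond.PiecesRankOne C b →
          Q.WellPosed i j ∧ Q.IsSigmaRot i j 0 ∧
            ∃ σ : ℝ, Q.IsSigmaProp i j σ ∧ Q.IsSigmaConv i j σ) ∧
    (∀ t lso lr lv : ℝ, ∃ H0 : SCond.honeycomb.Op, SCond.IsKaneMele t lso lr lv H0 ∧
        ∀ μ : ℝ, (μ : ℂ) ∉ spectrum ℂ H0 →
          ∃ Q : SCond.Model SCond.honeycomb, Q.H0 = H0 ∧ Q.μ = μ ∧ Q.s = SCond.spinZ ∧
            ∀ (i j : Fin 2) (hij : i ≠ j),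
              (∃ (n : ℕ) (ρ : SCond.Spin 2 ≃ₗᵢ[ℂ] SCond.Spin 2) (b : Fin 2 → SCond.Sp 2),
                2 ≤ n ∧ Q.RotSymmetric i j hij n ρ b ∧
                  SCond.PiecesRankOne SCond.honeycomb b) ∧
              Q.IsSigmaRot i j 0 ∧ ∃ σ : ℝ, Q.IsSigmaProp i j σ ∧ Q.IsSigmaConv i j σ) := by
  refine ⟨fun d N C Q i j hij n hn ρ b hsym hrank => ⟨Q.wellPosed i j,
    (Q.sigma_of_rotSymmetric hij hn hsym hrank).1,
    (Q.sigma_of_rotSymmetric hij hn hsym hrank).2⟩, ?_⟩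
  intro t lso lr lv
  obtain ⟨H0, h⟩ := SCond.exists_isKaneMele t lso lr lv
  refine ⟨H0, h, fun μ hμ => ⟨SCond.kaneMele h μ hμ, rfl, rfl, rfl, fun i j hij => ?_⟩⟩
  obtain ⟨n, ρ, b, hn, hsym, hrank⟩ := SCond.kaneMele_exists_rotSymmetric h hμ hij
  exact ⟨⟨n, ρ, b, hn, hsym, hrank⟩,
    (SCond.kaneMele h μ hμ).sigma_of_rotSymmetric hij hn hsym hrank⟩
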